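/- An algebraic dynamical system $(G,P,\theta)$ consists of a countable discrete group $G$, a countable left cancellative monoid $P$ such that for all $p,q\in P$ the set $pP\cap qP$ is either empty or of the form $rP$ for some $r\in P$ (a right LCM semigroup), and an action $\theta$ of $P$ by injective group endomorphisms of $G$ (so $\theta_1=\mathrm{id}$ and $\theta_{pq}=\theta_p\theta_q$) such that $\theta_p(G)\cap\theta_q(G)=\theta_r(G)$ whenever $pP\cap qP=rP$. Let $\mathcal A[G,P,\theta]$ be the universal unital $C^*$-algebra generated by a unitary representation $u$ of $G$ and an isometric representation $s$ of $P$ such that, for all $p,q\in P$ and $g\in G$, $s_pu_g=u_{\theta_p(g)}s_p$, and $s_p^*u_gs_q=u_ks_{p'}s_{q'}^*u_\ell^*$ whenever $pP\cap qP=rP$, $pp'=qq'=r$ and $g=\theta_p(k)\theta_q(\ell^{-1})$ with $r,p',q'\in P$, $k,\ell\in G$, while $s_p^*u_gs_q=0$ if there are no such $r,p',q',k,\ell$. Let $C^*(G)$ be the full group $C^*$-algebra of $G$, with generating unitaries $\delta_g$. For $p\in P$ let $\alpha_p$ be the $*$-endomorphism of $C^*(G)$ with $\alpha_p(\delta_g)=\delta_{\theta_p(g)}$,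 and let $L_p$ be the bounded linear map on $C^*(G)$ with $L_p(\delta_{\theta_p(g)})=\delta_g$ for $g\in G$ and $L_p(\delta_h)=0$ for $h\notin\theta_p(G)$. Let $M_p$ be the completion of $C^*(G)/N_p$, where $N_p=\{a: L_p(a^*a)=0\}$, in the norm coming from the $C^*(G)$-valued inner product $\langle\pi_p(a),\pi_p(b)\rangle_p=L_p(a^*b)$, where $\pi_p: C^*(G)\to M_p$ is the quotient map. It is a right-Hilbert $C^*(G)$-bimodule, with $b\cdot\pi_p(a)=\pi_p(ba)$ and $\pi_p(a)\cdot b=\pi_p(a\alpha_p(b))$. Let $M=\bigsqcup_{p\in P}M_p$ be the product system of right-Hilbert $C^*(G)$-bimodules over $P$ with the multiplication $M_p\times M_q\to M_{pq}$ determined by $\pi_p(a)\pi_q(b)=\pi_{pq}(a\alpha_p(b))$, that is, $\pi_p(\delta_g)\pi_q(\delta_h)=\pi_{pq}(\delta_{g\theta_p(h)})$; here $M_1$ is identified with $C^*(G)$ through $\pi_1$. For $\xi,\eta\in M_p$ put $\Theta_{\xi,\eta}(\mu)=\xi\cdot\langle\eta,\mu\rangle_p$, and let $\mathcal K(M_p)$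 be the closed linear span of these operators. For $r=pp'$ and $T\in\mathcal K(M_p)$ let $\iota_p^r(T)$ be the bounded operator on $M_r$ with $\iota_p^r(T)(\xi\eta)=(T\xi)\eta$ for $\xi\in M_p$, $\eta\in M_{p'}$. The product system $M$ is compactly aligned if $\iota_p^r(T)\iota_q^r(T')\in\mathcal K(M_r)$ whenever $pP\cap qP=rP$, $T\in\mathcal K(M_p)$ and $T'\in\mathcal K(M_q)$. A representation of $M$ in a $C^*$-algebra $B$ is a family of linear maps $\psi_p:M_p\to B$ such that $\psi_1$ is a $*$-homomorphism (not necessarily unital), $\psi_p(\xi)\psi_q(\eta)=\psi_{pq}(\xi\eta)$ and $\psi_p(\xi)^*\psi_p(\xi')=\psi_1(\langle\xi,\xi'\rangle_p)$ for all $p,q\in P$, $\xi,\xi'\in M_p$, $\eta\in M_q$; it induces homomorphisms $\psi^{(p)}:\mathcal K(M_p)\to B$ with $\psi^{(p)}(\Theta_{\xi,\eta})=\psi_p(\xi)\psi_p(\eta)^*$. If $M$ is compactly aligned, the representation is Nica covariant if, for all $p,q\in P$, $T\in\mathcal K(M_p)$, $T'\in\mathcal K(M_q)$, one has $\psi^{(p)}(T)\psi^{(q)}(T')=\psi^{(r)}(\iota_p^r(T)\iota_q^r(T'))$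 for every $r$ with $pP\cap qP=rP$, and $\psi^{(p)}(T)\psi^{(q)}(T')=0$ if there is no such $r$. The Nica–Toeplitz algebra $\mathcal{NT}(M)$ is the universal $C^*$-algebra generated by a Nica covariant representation $j=(j_p)_{p\in P}$ of $M$. Theorem. For every algebraic dynamical system $(G,P,\theta)$ the product system $M$ is compactly aligned, and there is a $*$-isomorphism $\varphi:\mathcal A[G,P,\theta]\to\mathcal{NT}(M)$ such that $\varphi(u_g)=j_1(\delta_g)$ for all $g\in G$ and $\varphi(s_p)=j_p(\pi_p(1))$ for all $p\in P$. -/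

import Mathlib

universe u v w

noncomputable section

set_option linter.unusedSectionVars false

namespace ADS

open UniformSpace

/-! ### C*-seminorms and the C*-algebras they define -/

/-- A C*-seminorm on a unital complex *-algebra. -/
structure CStarSeminorm (R : Type u) [Ring R] [Algebra ℂ R] [StarRing R]
    extends Seminorm ℂ R where
  mul_le' : ∀ a b : R, toFun (a * b) ≤ toFun a * toFun b
  star_mul_self' : ∀ a : R, toFun (star a * a) = toFun a ^ 2

namespace CStarSeminorm

variable {R : Type u} [Ring R] [Algebra ℂ R] [StarRing R]

instance : CoeFun (CStarSeminorm R) (fun _ => R → ℝ) := ⟨fun ρ => ρ.toSeminorm⟩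

theorem nonneg (ρ : CStarSeminorm R) (a : R) : 0 ≤ ρ a := apply_nonneg ρ.toSeminorm a

theorem mul_le (ρ : CStarSeminorm R) (a b : R) : ρ (a * b) ≤ ρ a * ρ b := ρ.mul_le' a b

theorem star_mul_self (ρ : CStarSeminorm R) (a : R) : ρ (star a * a) = ρ a ^ 2 :=
  ρ.star_mul_self' a

theorem star_le (ρ : CStarSeminorm R) (a : R) : ρ a ≤ ρ (star a) := by
  rcases (ρ.nonneg a).eq_or_lt with h | h
  · rw [← h]; exact ρ.nonneg _
  · have := ρ.mul_le (star a) a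
    rw [ρ.star_mul_self, sq] at this
    exact le_of_mul_le_mul_right this h

theorem star_eq (ρ : CStarSeminorm R) (a : R) : ρ (star a) = ρ a :=
  le_antisymm (by simpa using ρ.star_le (star a)) (ρ.star_le a)

theorem one_le (ρ : CStarSeminorm R) : ρ 1 ≤ 1 := by
  have := ρ.star_mul_self 1
  simp only [star_one, mul_one] at this
  nlinarith [ρ.nonneg 1]

/-- The algebra `R` equipped with the topology of the seminorm `ρ`. -/
def Pre (_ρ : CStarSeminorm R) : Type u := R

instance (ρ : CStarSeminorm R) : Ring ρ.Pre := inferInstanceAs (Ring R)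
instance (ρ : CStarSeminorm R) : Algebra ℂ ρ.Pre := inferInstanceAs (Algebra ℂ R)
instance (ρ : CStarSeminorm R) : StarRing ρ.Pre := inferInstanceAs (StarRing R)

instance (ρ : CStarSeminorm R) : Norm ρ.Pre := ⟨ρ.toSeminorm⟩

instance (ρ : CStarSeminorm R) : SeminormedRing ρ.Pre where
  __ : Ring ρ.Pre := inferInstance
  __ : SeminormedAddCommGroup ρ.Pre :=
    SeminormedAddCommGroup.ofCore (𝕜 := ℂ)
      { norm_nonneg := ρ.nonneg
        norm_smul := fun c a => map_smul_eq_mul ρ.toSeminorm c a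
        norm_triangle := fun a b => map_add_le_add ρ.toSeminorm a b }
  norm_mul_le := ρ.mul_le

instance (ρ : CStarSeminorm R) : NormedSpace ℂ ρ.Pre where
  norm_smul_le c a := (map_smul_eq_mul ρ.toSeminorm c a).le

instance (ρ : CStarSeminorm R) : NormedStarGroup ρ.Pre where
  norm_star_le a := (ρ.star_eq a).le

/-- The C*-algebra obtained by (separating and) completing `R` in the C*-seminorm `ρ`. -/
def Compl (ρ : CStarSeminorm R) : Type u := Completion ρ.Pre

section Construction

@[reducible] def complNormedRing (ρ : CStarSeminorm R) : NormedRing ρ.Compl :=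
  inferInstanceAs (NormedRing (Completion ρ.Pre))

attribute [local instance] complNormedRing

theorem complComplete (ρ : CStarSeminorm R) : CompleteSpace ρ.Compl :=
  inferInstanceAs (CompleteSpace (Completion ρ.Pre))

attribute [local instance] complComplete

@[reducible] def complNormedSpace (ρ : CStarSeminorm R) : NormedSpace ℂ ρ.Compl :=
  inferInstanceAs (NormedSpace ℂ (Completion ρ.Pre))

attribute [local instance] complNormedSpace

/-- The canonical map of `R` into its completion. -/
def emb (ρ : CStarSeminorm R) (a : R) : ρ.Compl := ((show ρ.Pre from a : ρ.Pre) : Completion ρ.Pre)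

theorem norm_emb (ρ : CStarSeminorm R) (a : R) : ‖ρ.emb a‖ = ρ a :=
  Completion.norm_coe (E := ρ.Pre) a

theorem denseRange_emb (ρ : CStarSeminorm R) : DenseRange ρ.emb :=
  Completion.denseRange_coe (α := ρ.Pre)

theorem emb_add (ρ : CStarSeminorm R) (a b : R) : ρ.emb (a + b) = ρ.emb a + ρ.emb b :=
  Completion.coe_add (α := ρ.Pre) a b

theorem emb_mul (ρ : CStarSeminorm R) (a b : R) : ρ.emb (a * b) = ρ.emb a * ρ.emb b :=
  Completion.coe_mul (α := ρ.Pre) a b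

theorem emb_smul (ρ : CStarSeminorm R) (c : ℂ) (a : R) : ρ.emb (c • a) = c • ρ.emb a :=
  Completion.coe_smul (X := ρ.Pre) c a

theorem emb_one (ρ : CStarSeminorm R) : ρ.emb 1 = 1 := rfl

@[reducible] def complStar (ρ : CStarSeminorm R) : Star ρ.Compl :=
  ⟨Completion.map (α := ρ.Pre) (β := ρ.Pre) star⟩

attribute [local instance] complStar

theorem continuous_star' (ρ : CStarSeminorm R) : Continuous (star : ρ.Compl → ρ.Compl) :=
  Completion.continuous_map

theorem emb_star (ρ : CStarSeminorm R) (a : R) : ρ.emb (star a) = star (ρ.emb a) :=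
  (Completion.map_coe (α := ρ.Pre) (β := ρ.Pre)
    (starNormedAddGroupHom (E := ρ.Pre)).uniformContinuous a).symm

@[reducible] def complNormedAlgebra (ρ : CStarSeminorm R) : NormedAlgebra ℂ ρ.Compl where
  __ := Algebra.ofModule (R := ℂ) (A := ρ.Compl)
    (fun c x y => by
      refine ρ.denseRange_emb.induction_on₂ (p := fun x y => c • x * y = c • (x * y)) ?_ ?_ x y
      · exact isClosed_eq ((continuous_fst.const_smul c).mul continuous_snd)
          ((continuous_fst.mul continuous_snd).const_smul c)
      · intro a b
        rw [← emb_smul, ← emb_mul, ← emb_mul, ← emb_smul, smul_mul_assoc])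
    (fun c x y => by
      refine ρ.denseRange_emb.induction_on₂ (p := fun x y => x * c • y = c • (x * y)) ?_ ?_ x y
      · exact isClosed_eq (continuous_fst.mul (continuous_snd.const_smul c))
          ((continuous_fst.mul continuous_snd).const_smul c)
      · intro a b
        rw [← emb_smul, ← emb_mul, ← emb_mul, ← emb_smul, mul_smul_comm])
  norm_smul_le := norm_smul_le

attribute [local instance] complNormedAlgebra

variable [StarModule ℂ R]

instance complCStarAlgebra (ρ : CStarSeminorm R) : CStarAlgebra ρ.Compl where
  star_involutive x := by
    refine ρ.denseRange_emb.induction_on (p := fun x => star (star x) = x) x ?_ ?_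
    · exact isClosed_eq (ρ.continuous_star'.comp ρ.continuous_star') continuous_id
    · intro a
      rw [← emb_star, ← emb_star, star_star]
  star_mul x y := by
    refine ρ.denseRange_emb.induction_on₂ (p := fun x y => star (x * y) = star y * star x) ?_ ?_ x y
    · exact isClosed_eq (ρ.continuous_star'.comp (continuous_fst.mul continuous_snd))
        ((ρ.continuous_star'.comp continuous_snd).mul (ρ.continuous_star'.comp continuous_fst))
    · intro a b
      rw [← emb_mul, ← emb_star, ← emb_star, ← emb_star, ← emb_mul, StarMul.star_mul]
  star_add x y := by
    refine ρ.denseRange_emb.induction_on₂ (p := fun x y => star (x + y) = star x + star y) ?_ ?_ x y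
    · exact isClosed_eq (ρ.continuous_star'.comp (continuous_fst.add continuous_snd))
        ((ρ.continuous_star'.comp continuous_fst).add (ρ.continuous_star'.comp continuous_snd))
    · intro a b
      rw [← emb_add, ← emb_star, ← emb_star, ← emb_star, ← emb_add, star_add]
  norm_mul_self_le x := by
    refine ρ.denseRange_emb.induction_on (p := fun x => ‖x‖ * ‖x‖ ≤ ‖star x * x‖) x ?_ ?_
    · exact isClosed_le (continuous_norm.mul continuous_norm) ((ρ.continuous_star'.mul continuous_id).norm)
    · intro a
      rw [← emb_star, ← emb_mul, norm_emb, norm_emb, star_mul_self, sq]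
  star_smul c x := by
    refine ρ.denseRange_emb.induction_on (p := fun x => star (c • x) = star c • star x) x ?_ ?_
    · exact isClosed_eq (ρ.continuous_star'.comp (continuous_id.const_smul c))
        (ρ.continuous_star'.const_smul (star c))
    · intro a
      rw [← emb_smul, ← emb_star, ← emb_star, ← emb_smul, star_smul]

end Construction

variable [StarModule ℂ R]

/-- The canonical map of `R` into its completion, as a *-homomorphism. -/
def toCompl (ρ : CStarSeminorm R) : R →⋆ₐ[ℂ] ρ.Compl where
  toFun := ρ.emb
  map_one' := ρ.emb_one
  map_mul' := ρ.emb_mul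
  map_zero' := by have := ρ.emb_smul 0 0; simpa using this
  map_add' := ρ.emb_add
  commutes' c := by
    rw [Algebra.algebraMap_eq_smul_one, Algebra.algebraMap_eq_smul_one, emb_smul, emb_one]
  map_star' := ρ.emb_star

theorem norm_toCompl (ρ : CStarSeminorm R) (a : R) : ‖ρ.toCompl a‖ = ρ a := ρ.norm_emb a

theorem denseRange_toCompl (ρ : CStarSeminorm R) : DenseRange ρ.toCompl := ρ.denseRange_emb

attribute [irreducible] Compl complCStarAlgebra toCompl

/-- The supremum of a pointwise bounded family of C*-seminorms. -/
def sup (F : Set (CStarSeminorm R)) (hF : ∀ a, BddAbove (Set.range fun ρ : F => ρ.1 a)) :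
    CStarSeminorm R where
  toFun a := ⨆ ρ : F, ρ.1 a
  map_zero' := by
    have : ∀ ρ : F, ρ.1 0 = 0 := fun ρ => map_zero ρ.1.toSeminorm
    simp [this]
  add_le' a b := by
    refine Real.iSup_le (fun ρ => ?_)
      (add_nonneg (Real.iSup_nonneg fun ρ => ρ.1.nonneg _) (Real.iSup_nonneg fun ρ => ρ.1.nonneg _))
    exact (map_add_le_add ρ.1.toSeminorm a b).trans
      (add_le_add (le_ciSup (hF a) ρ) (le_ciSup (hF b) ρ))
  neg' a := by
    have : ∀ ρ : F, ρ.1 (-a) = ρ.1 a := fun ρ => map_neg_eq_map ρ.1.toSeminorm a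
    simp [this]
  smul' c a := by
    have : ∀ ρ : F, ρ.1 (c • a) = ‖c‖ * ρ.1 a := fun ρ => map_smul_eq_mul ρ.1.toSeminorm c a
    simp only [this]
    exact (Real.mul_iSup_of_nonneg (norm_nonneg c) _).symm
  mul_le' a b := by
    refine Real.iSup_le (fun ρ => ?_)
      (mul_nonneg (Real.iSup_nonneg fun ρ => ρ.1.nonneg _) (Real.iSup_nonneg fun ρ => ρ.1.nonneg _))
    exact (ρ.1.mul_le a b).trans
      (mul_le_mul (le_ciSup (hF a) ρ) (le_ciSup (hF b) ρ) (ρ.1.nonneg _)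
        (Real.iSup_nonneg fun ρ => ρ.1.nonneg _))
  star_mul_self' a := by
    have h0 : 0 ≤ ⨆ ρ : F, ρ.1 a := Real.iSup_nonneg fun ρ => ρ.1.nonneg _
    apply le_antisymm
    · refine Real.iSup_le (fun ρ => ?_) (sq_nonneg _)
      rw [ρ.1.star_mul_self]
      exact pow_le_pow_left₀ (ρ.1.nonneg _) (le_ciSup (hF a) ρ) 2
    · have h1 : 0 ≤ ⨆ ρ : F, ρ.1 (star a * a) := Real.iSup_nonneg fun ρ => ρ.1.nonneg _
      rw [← Real.le_sqrt h0 h1]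
      refine Real.iSup_le (fun ρ => ?_) (Real.sqrt_nonneg _)
      rw [Real.le_sqrt (ρ.1.nonneg _) h1, ← ρ.1.star_mul_self]
      exact le_ciSup (hF (star a * a)) ρ

theorem le_sup (F : Set (CStarSeminorm R)) (hF : ∀ a, BddAbove (Set.range fun ρ : F => ρ.1 a))
    {ρ : CStarSeminorm R} (h : ρ ∈ F) (a : R) : ρ a ≤ sup F hF a :=
  le_ciSup (hF a) ⟨ρ, h⟩

theorem sup_le (F : Set (CStarSeminorm R)) (hF : ∀ a, BddAbove (Set.range fun ρ : F => ρ.1 a))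
    {a : R} {C : ℝ} (hC : 0 ≤ C) (h : ∀ ρ ∈ F, ρ a ≤ C) : sup F hF a ≤ C :=
  Real.iSup_le (fun ρ => h ρ.1 ρ.2) hC

end CStarSeminorm

/-! ### The *-algebra of a monoid with involution; free *-algebras -/

section StarMonoidAlgebra

variable {W : Type u} [Monoid W]

/-- The conjugate linear extension to `ℂ[W]` of an involution of the monoid `W`. -/
def starMap (inv : W → W) (x : MonoidAlgebra ℂ W) : MonoidAlgebra ℂ W :=
  (x.map (starRingEnd ℂ : ℂ →+* ℂ).toAddMonoidHom).mapDomain inv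

theorem starMap_single (inv : W → W) (w : W) (c : ℂ) :
    starMap inv (MonoidAlgebra.single w c) = MonoidAlgebra.single (inv w) (starRingEnd ℂ c) := by
  simp [starMap]

theorem starMap_add (inv : W → W) (x y : MonoidAlgebra ℂ W) :
    starMap inv (x + y) = starMap inv x + starMap inv y := by
  simp [starMap, MonoidAlgebra.map_add, MonoidAlgebra.mapDomain_add]

theorem starMap_zero (inv : W → W) : starMap inv (0 : MonoidAlgebra ℂ W) = 0 := by
  simp [starMap]

/-- An anti-multiplicative involution `inv` of `W` makes `ℂ[W]` a *-algebra, with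
`(∑ c_w w)* = ∑ conj(c_w) inv(w)`. -/
@[reducible] def starRingOfInvolution (inv : W → W) (h1 : ∀ w, inv (inv w) = w)
    (h2 : ∀ w w', inv (w * w') = inv w' * inv w) : StarRing (MonoidAlgebra ℂ W) where
  star := starMap inv
  star_involutive x := by
    induction x using MonoidAlgebra.induction_linear with
    | zero => simp [starMap_zero]
    | add x y hx hy => rw [starMap_add, starMap_add, hx, hy]
    | single w c => simp [starMap_single, h1]
  star_mul x y := by
    induction x using MonoidAlgebra.induction_linear with
    | zero => simp [starMap_zero]
    | add x y hx hy => rw [add_mul, starMap_add, starMap_add, mul_add, hx, hy]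
    | single w c =>
      induction y using MonoidAlgebra.induction_linear with
      | zero => simp [starMap_zero]
      | add x y hx hy => rw [mul_add, starMap_add, starMap_add, add_mul, hx, hy]
      | single w' c' =>
        simp only [MonoidAlgebra.single_mul_single, starMap_single, h2, map_mul, mul_comm]
  star_add := starMap_add inv

theorem starModule_of_involution (inv : W → W) (h1 : ∀ w, inv (inv w) = w)
    (h2 : ∀ w w', inv (w * w') = inv w' * inv w) :
    @StarModule ℂ (MonoidAlgebra ℂ W) _ (starRingOfInvolution inv h1 h2).toStar _ :=
  letI := starRingOfInvolution inv h1 h2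
  ⟨fun c x => by
    change starMap inv (c • x) = (starRingEnd ℂ c) • starMap inv x
    induction x using MonoidAlgebra.induction_linear with
    | zero => simp [starMap_zero]
    | add x y hx hy => rw [smul_add, starMap_add, starMap_add, smul_add, hx, hy]
    | single w d => simp [starMap_single]⟩

end StarMonoidAlgebra

/-- The free unital complex *-algebra on the set `X`: linear combinations of words in the letters
`x = (x, false)` and `x* = (x, true)`. -/
def FreeStarAlg (X : Type u) : Type u := MonoidAlgebra ℂ (FreeMonoid (X × Bool))

namespace FreeStarAlg

variable {X : Type u}

instance : Ring (FreeStarAlg X) := inferInstanceAs (Ring (MonoidAlgebra ℂ (FreeMonoid (X × Bool))))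
instance : Algebra ℂ (FreeStarAlg X) :=
  inferInstanceAs (Algebra ℂ (MonoidAlgebra ℂ (FreeMonoid (X × Bool))))

/-- The involution of words: reverse the word and exchange `x` with `x*`. -/
def wordStar (w : FreeMonoid (X × Bool)) : FreeMonoid (X × Bool) :=
  FreeMonoid.ofList ((w.toList.map fun l => (l.1, !l.2)).reverse)

theorem wordStar_wordStar (w : FreeMonoid (X × Bool)) : wordStar (wordStar w) = w := by
  apply FreeMonoid.toList.injective
  simp [wordStar, Function.comp_def]

theorem wordStar_mul (w w' : FreeMonoid (X × Bool)) :
    wordStar (w * w') = wordStar w' * wordStar w := by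
  apply FreeMonoid.toList.injective
  simp [wordStar]

instance : StarRing (FreeStarAlg X) :=
  starRingOfInvolution (W := FreeMonoid (X × Bool)) wordStar wordStar_wordStar wordStar_mul

instance : StarModule ℂ (FreeStarAlg X) :=
  starModule_of_involution (W := FreeMonoid (X × Bool)) wordStar wordStar_wordStar wordStar_mul

/-- The free generators. -/
def gen (x : X) : FreeStarAlg X :=
  MonoidAlgebra.of ℂ (FreeMonoid (X × Bool)) (FreeMonoid.of (x, false))

theorem star_gen (x : X) : star (gen x) =
    MonoidAlgebra.of ℂ (FreeMonoid (X × Bool)) (FreeMonoid.of (x, true)) := by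
  change starMap wordStar _ = _
  simp only [gen, MonoidAlgebra.of_apply, starMap_single, map_one]
  rfl

theorem induction {motive : FreeStarAlg X → Prop} (a : FreeStarAlg X)
    (one : motive 1) (gen_mul : ∀ x a, motive a → motive (gen x * a))
    (star_gen_mul : ∀ x a, motive a → motive (star (gen x) * a))
    (add : ∀ a b, motive a → motive b → motive (a + b))
    (smul : ∀ (c : ℂ) a, motive a → motive (c • a)) : motive a := by
  refine MonoidAlgebra.induction_on (motive := motive) a ?_ add (fun c a => smul c a)
  intro w
  induction w using FreeMonoid.recOn with
  | one => rw [map_one]; exact one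
  | of_mul l w ih =>
    rw [map_mul]
    rcases l with ⟨x, _ | _⟩
    · exact gen_mul x _ ih
    · rw [← star_gen]
      exact star_gen_mul x _ ih

end FreeStarAlg

/-! ### Universal C*-algebras -/

section Universal

variable {X : Type u}

/-- The C*-seminorms on the free *-algebra on `X` for which the generators, regarded as elements of
the C*-algebra defined by the seminorm, satisfy `Rel`. -/
def admissible (Rel : ∀ (B : Type u) [CStarAlgebra B], (X → B) → Prop) :
    Set (CStarSeminorm (FreeStarAlg X)) :=
  {ρ | Rel ρ.Compl fun x => ρ.toCompl (FreeStarAlg.gen x)}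

theorem bddAbove_admissible {Rel : ∀ (B : Type u) [CStarAlgebra B], (X → B) → Prop}
    (hRel : ∀ x, ∃ C : ℝ, ∀ (B : Type u) [CStarAlgebra B] (f : X → B), Rel B f → ‖f x‖ ≤ C)
    (a : FreeStarAlg X) : BddAbove (Set.range fun ρ : admissible Rel => ρ.1 a) := by
  have key : ∃ C : ℝ, ∀ ρ ∈ admissible Rel, ρ a ≤ C := by
    have hg : ∀ x, ∃ C : ℝ, ∀ ρ ∈ admissible Rel, ρ (FreeStarAlg.gen x) ≤ C := by
      intro x
      obtain ⟨C, hC⟩ := hRel x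
      refine ⟨C, fun ρ hρ => ?_⟩
      rw [← ρ.norm_toCompl]
      exact hC _ _ hρ
    have hm : ∀ a b : FreeStarAlg X, (∃ C : ℝ, ∀ ρ ∈ admissible Rel, ρ a ≤ C) →
        (∃ C : ℝ, ∀ ρ ∈ admissible Rel, ρ b ≤ C) → ∃ C : ℝ, ∀ ρ ∈ admissible Rel, ρ (a * b) ≤ C := by
      rintro a b ⟨C, hC⟩ ⟨D, hD⟩
      refine ⟨|C| * |D|, fun ρ hρ => (ρ.mul_le a b).trans ?_⟩
      exact mul_le_mul ((hC ρ hρ).trans (le_abs_self C)) ((hD ρ hρ).trans (le_abs_self D))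
        (ρ.nonneg b) (abs_nonneg C)
    induction a using FreeStarAlg.induction with
    | one => exact ⟨1, fun ρ _ => ρ.one_le⟩
    | gen_mul x a ih => exact hm _ _ (hg x) ih
    | star_gen_mul x a ih =>
      refine hm _ _ ?_ ih
      obtain ⟨C, hC⟩ := hg x
      exact ⟨C, fun ρ hρ => (ρ.star_eq _).le.trans (hC ρ hρ)⟩
    | add a b ha hb =>
      obtain ⟨C, hC⟩ := ha
      obtain ⟨D, hD⟩ := hb
      exact ⟨C + D, fun ρ hρ =>
        (map_add_le_add ρ.toSeminorm a b).trans (add_le_add (hC ρ hρ) (hD ρ hρ))⟩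
    | smul c a ha =>
      obtain ⟨C, hC⟩ := ha
      exact ⟨‖c‖ * C, fun ρ hρ => (map_smul_eq_mul ρ.toSeminorm c a).le.trans
        (mul_le_mul_of_nonneg_left (hC ρ hρ) (norm_nonneg c))⟩
  obtain ⟨C, hC⟩ := key
  exact ⟨C, by rintro _ ⟨ρ, rfl⟩; exact hC ρ.1 ρ.2⟩

/-- The universal unital C*-algebra generated by elements indexed by `X` subject to the conditions
`Rel`: the completion of the free *-algebra on `X` in the largest C*-seminorm coming from C*-algebras
generated by elements satisfying `Rel`. The argument `hRel` says that `Rel` bounds the norms of the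
generators. -/
def UnivCStar (Rel : ∀ (B : Type u) [CStarAlgebra B], (X → B) → Prop)
    (hRel : ∀ x, ∃ C : ℝ, ∀ (B : Type u) [CStarAlgebra B] (f : X → B), Rel B f → ‖f x‖ ≤ C) :
    Type u :=
  (CStarSeminorm.sup (admissible Rel) (bddAbove_admissible hRel)).Compl

namespace UnivCStar

variable (Rel : ∀ (B : Type u) [CStarAlgebra B], (X → B) → Prop)
    (hRel : ∀ x, ∃ C : ℝ, ∀ (B : Type u) [CStarAlgebra B] (f : X → B), Rel B f → ‖f x‖ ≤ C)

instance : CStarAlgebra (UnivCStar Rel hRel) :=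
  inferInstanceAs (CStarAlgebra (CStarSeminorm.sup _ (bddAbove_admissible hRel)).Compl)

/-- The canonical generators of the universal C*-algebra. -/
def gen (x : X) : UnivCStar Rel hRel :=
  (CStarSeminorm.sup _ (bddAbove_admissible hRel)).toCompl (FreeStarAlg.gen x)

end UnivCStar

end Universal

/-! ### The full group C*-algebra -/

/-- The complex group *-algebra `ℂ[G]`, in which `g* = g⁻¹`. -/
def GroupAlg (G : Type u) : Type u := MonoidAlgebra ℂ G

section GroupAlg

variable {G : Type u} [Group G]

namespace GroupAlg

instance : Ring (GroupAlg G) := inferInstanceAs (Ring (MonoidAlgebra ℂ G))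
instance : Algebra ℂ (GroupAlg G) := inferInstanceAs (Algebra ℂ (MonoidAlgebra ℂ G))
instance : StarRing (GroupAlg G) := starRingOfInvolution (W := G) (·⁻¹) inv_inv mul_inv_rev
instance : StarModule ℂ (GroupAlg G) :=
  starModule_of_involution (W := G) (·⁻¹) inv_inv mul_inv_rev

/-- The group element `g` in `ℂ[G]`. -/
def of (g : G) : GroupAlg G := MonoidAlgebra.of ℂ G g

theorem of_one : of (1 : G) = 1 := map_one (MonoidAlgebra.of ℂ G)

theorem of_mul (g h : G) : of (g * h) = of g * of h := map_mul (MonoidAlgebra.of ℂ G) g h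

theorem star_of (g : G) : star (of g) = of g⁻¹ := by
  change starMap _ _ = _
  simp [of, starMap_single]

theorem induction {motive : GroupAlg G → Prop} (a : GroupAlg G) (of : ∀ g, motive (of g))
    (add : ∀ a b, motive a → motive b → motive (a + b))
    (smul : ∀ (c : ℂ) a, motive a → motive (c • a)) : motive a :=
  MonoidAlgebra.induction_on (motive := motive) a of add (fun c a => smul c a)

theorem linearMap_ext {E : Type w} [AddCommMonoid E] [Module ℂ E] {f g : GroupAlg G →ₗ[ℂ] E}
    (h : ∀ x, f (of x) = g (of x)) : f = g := by
  ext a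
  induction a using induction with
  | of x => exact h x
  | add a b ha hb => rw [map_add, map_add, ha, hb]
  | smul c a ha => rw [map_smul, map_smul, ha]

theorem seminorm_of_le (ρ : CStarSeminorm (GroupAlg G)) (g : G) : ρ (of g) ≤ 1 := by
  have := ρ.star_mul_self (of g)
  rw [star_of, ← of_mul, inv_mul_cancel, of_one] at this
  nlinarith [ρ.nonneg (of g), ρ.one_le]

theorem bddAbove_seminorm (a : GroupAlg G) :
    BddAbove (Set.range fun ρ : (Set.univ : Set (CStarSeminorm (GroupAlg G))) => ρ.1 a) := by
  have key : ∃ C : ℝ, ∀ ρ : CStarSeminorm (GroupAlg G), ρ a ≤ C := by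
    induction a using induction with
    | of g => exact ⟨1, fun ρ => seminorm_of_le ρ g⟩
    | add a b ha hb =>
      obtain ⟨C, hC⟩ := ha
      obtain ⟨D, hD⟩ := hb
      exact ⟨C + D, fun ρ => (map_add_le_add ρ.toSeminorm a b).trans (add_le_add (hC ρ) (hD ρ))⟩
    | smul c a ha =>
      obtain ⟨C, hC⟩ := ha
      exact ⟨‖c‖ * C, fun ρ => (map_smul_eq_mul ρ.toSeminorm c a).le.trans
        (mul_le_mul_of_nonneg_left (hC ρ) (norm_nonneg c))⟩
  obtain ⟨C, hC⟩ := key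
  exact ⟨C, by rintro _ ⟨ρ, rfl⟩; exact hC ρ.1⟩

end GroupAlg

variable (G) in
/-- The largest C*-seminorm on `ℂ[G]`. -/
def maxSeminorm : CStarSeminorm (GroupAlg G) :=
  CStarSeminorm.sup Set.univ GroupAlg.bddAbove_seminorm

theorem le_maxSeminorm (ρ : CStarSeminorm (GroupAlg G)) (a : GroupAlg G) :
    ρ a ≤ maxSeminorm G a :=
  CStarSeminorm.le_sup _ _ (Set.mem_univ ρ) a

variable (G) in
/-- The full group C*-algebra `C*(G)` of the discrete group `G`: the completion of `ℂ[G]` in its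
largest C*-seminorm. -/
def GroupCStar : Type u := (maxSeminorm G).Compl

instance : CStarAlgebra (GroupCStar G) := inferInstanceAs (CStarAlgebra (maxSeminorm G).Compl)

namespace GroupCStar

/-- The canonical *-homomorphism `ℂ[G] → C*(G)`. -/
def incl : GroupAlg G →⋆ₐ[ℂ] GroupCStar G := (maxSeminorm G).toCompl

theorem norm_incl (a : GroupAlg G) : ‖incl a‖ = maxSeminorm G a := (maxSeminorm G).norm_toCompl a

theorem denseRange_incl : DenseRange (incl : GroupAlg G → GroupCStar G) :=
  (maxSeminorm G).denseRange_toCompl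

/-- The canonical generating unitaries `δ_g` of `C*(G)`. -/
def delta (g : G) : GroupCStar G := incl (GroupAlg.of g)

theorem delta_one : delta (1 : G) = 1 := by rw [delta, GroupAlg.of_one, map_one]

theorem delta_mul (g h : G) : delta (g * h) = delta g * delta h := by
  rw [delta, GroupAlg.of_mul, map_mul]; rfl

theorem star_delta (g : G) : star (delta g) = delta g⁻¹ := by
  rw [delta, ← map_star, GroupAlg.star_of]; rfl

end GroupCStar

end GroupAlg


/-! ### Extension of bounded bilinear maps -/

section BilinExtend

variable {σ : ℂ →+* ℂ} [RingHomIsometric σ] {E₁ E₂ F₁ F₂ F : Type*}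
  [AddCommGroup E₁] [Module ℂ E₁] [AddCommGroup E₂] [Module ℂ E₂]
  [NormedAddCommGroup F₁] [NormedSpace ℂ F₁] [NormedAddCommGroup F₂] [NormedSpace ℂ F₂]
  [NormedAddCommGroup F] [NormedSpace ℂ F] [CompleteSpace F]

/-- The continuous extension of a (sesqui- or) bilinear map along the maps `e₁`, `e₂` with dense
ranges. -/
def bilinExtend (f : E₁ →ₛₗ[σ] E₂ →ₗ[ℂ] F) (e₁ : E₁ →ₗ[ℂ] F₁) (e₂ : E₂ →ₗ[ℂ] F₂)
    (h₂ : DenseRange e₂) (hf : ∀ x y, ‖f x y‖ ≤ ‖e₁ x‖ * ‖e₂ y‖) : F₁ →SL[σ] F₂ →L[ℂ] F :=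
  LinearMap.extendOfNorm (σ₁₂ := σ) (E := E₁)
    { toFun := fun x => (f x).extendOfNorm e₂
      map_add' := fun x y =>
        LinearMap.extendOfNorm_unique h₂ (‖e₁ (x + y)‖) (hf (x + y)) _ (by
          ext z
          simp [LinearMap.extendOfNorm_eq h₂ ⟨_, hf x⟩, LinearMap.extendOfNorm_eq h₂ ⟨_, hf y⟩])
      map_smul' := fun c x =>
        LinearMap.extendOfNorm_unique h₂ (‖e₁ (c • x)‖) (hf (c • x)) _ (by
          ext z
          simp [LinearMap.extendOfNorm_eq h₂ ⟨_, hf x⟩]) }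
    e₁

variable (f : E₁ →ₛₗ[σ] E₂ →ₗ[ℂ] F) (e₁ : E₁ →ₗ[ℂ] F₁) (e₂ : E₂ →ₗ[ℂ] F₂)

theorem bilinExtend_apply (h₁ : DenseRange e₁) (h₂ : DenseRange e₂)
    (hf : ∀ x y, ‖f x y‖ ≤ ‖e₁ x‖ * ‖e₂ y‖) (x : E₁) (y : E₂) :
    bilinExtend f e₁ e₂ h₂ hf (e₁ x) (e₂ y) = f x y := by
  unfold bilinExtend
  rw [LinearMap.extendOfNorm_eq h₁]
  · exact LinearMap.extendOfNorm_eq h₂ ⟨_, hf x⟩ y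
  · exact ⟨1, fun x => by
      rw [one_mul]
      exact LinearMap.opNorm_extendOfNorm_le h₂ (norm_nonneg _) (hf x)⟩

end BilinExtend

/-! ### Pre-Hilbert modules and their completions -/

/-- The cone of positive elements of a C*-algebra. -/
def IsPos {B : Type*} [CStarAlgebra B] (b : B) : Prop := ∃ c : B, b = star c * c

section IsPos

variable {B : Type*} [CStarAlgebra B]

attribute [local instance] CStarAlgebra.spectralOrder CStarAlgebra.spectralOrderedRing

theorem isPos_iff {b : B} : IsPos b ↔ 0 ≤ b :=
  CStarAlgebra.nonneg_iff_eq_star_mul_self.symm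

theorem IsPos.add {a b : B} (ha : IsPos a) (hb : IsPos b) : IsPos (a + b) :=
  isPos_iff.2 (add_nonneg (isPos_iff.1 ha) (isPos_iff.1 hb))

theorem IsPos.sum {ι : Type*} (s : Finset ι) (f : ι → B) (hf : ∀ i ∈ s, IsPos (f i)) :
    IsPos (∑ i ∈ s, f i) :=
  isPos_iff.2 (Finset.sum_nonneg fun i hi => isPos_iff.1 (hf i hi))

theorem isClosed_isPos : IsClosed {b : B | IsPos b} := by
  simp only [isPos_iff]
  exact isClosed_Ici

theorem norm_le_of_isPos_sub {a b : B} (ha : IsPos a) (h : IsPos (b - a)) : ‖a‖ ≤ ‖b‖ :=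
  CStarAlgebra.norm_le_norm_of_nonneg_of_le (isPos_iff.1 ha) (sub_nonneg.1 (isPos_iff.1 h))

theorem isPos_norm_smul_sub (a b : B) :
    IsPos (‖b‖ ^ 2 • (star a * a) - star a * (star b * b) * a) := by
  rw [isPos_iff, sub_nonneg, sq, ← CStarRing.norm_star_mul_self (x := b)]
  exact CStarAlgebra.star_left_conjugate_le_norm_smul (hb := IsSelfAdjoint.star_mul_self b)

/-- The estimate behind the Cauchy-Schwarz inequality in (pre-)Hilbert modules. -/
theorem norm_sq_le_of_isPos {a b c : B} (ha : IsPos a)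
    (h : ∀ t : ℝ, IsPos (t ^ 2 • (star c * a * c) - (2 * t) • (star c * c) + b)) :
    ‖c‖ ^ 2 ≤ ‖a‖ * ‖b‖ := by
  have key : ∀ s : ℝ, ‖a‖ < s → ‖c‖ ^ 2 ≤ s * ‖b‖ := by
    intro s hs
    have hs0 : 0 < s := (norm_nonneg a).trans_lt hs
    have hcc : 0 ≤ star c * c := star_mul_self_nonneg c
    have h0 := isPos_iff.1 (h s⁻¹)
    have h1 : star c * a * c ≤ s • (star c * c) := by
      refine (CStarAlgebra.star_left_conjugate_le_norm_smul
        (hb := (isPos_iff.1 ha).isSelfAdjoint)).trans ?_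
      exact smul_le_smul_of_nonneg_right hs.le hcc
    have h2 : s⁻¹ ^ 2 • (star c * a * c) ≤ s⁻¹ ^ 2 • (s • (star c * c)) :=
      smul_le_smul_of_nonneg_left h1 (by positivity)
    have h3 : s⁻¹ • (star c * c) ≤ b := by
      rw [smul_smul] at h2
      have e1 : s⁻¹ ^ 2 * s = s⁻¹ := by field_simp
      rw [e1] at h2
      have h4 : 0 ≤ s⁻¹ • (star c * c) - (2 * s⁻¹) • (star c * c) + b :=
        h0.trans (by gcongr)
      have h5 : s⁻¹ • (star c * c) - (2 * s⁻¹) • (star c * c) + b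
          = b - s⁻¹ • (star c * c) := by
        rw [← sub_smul, two_mul, sub_add_cancel_left, neg_smul]; abel
      rw [h5] at h4
      exact sub_nonneg.1 h4
    have h6 := CStarAlgebra.norm_le_norm_of_nonneg_of_le
      (smul_nonneg (inv_nonneg.2 hs0.le) hcc) h3
    rw [norm_smul, CStarRing.norm_star_mul_self, Real.norm_of_nonneg (inv_nonneg.2 hs0.le)] at h6
    rw [sq]
    calc ‖c‖ * ‖c‖ = s * (s⁻¹ * (‖c‖ * ‖c‖)) := by field_simp
      _ ≤ s * ‖b‖ := by gcongr
  by_contra! hlt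
  rcases (norm_nonneg b).eq_or_lt with hb | hb
  · have := key (‖a‖ + 1) (by linarith)
    rw [← hb] at this hlt
    simp only [mul_zero] at this hlt
    linarith
  · have h1 : ‖a‖ < ‖c‖ ^ 2 / ‖b‖ := by rwa [lt_div_iff₀ hb]
    obtain ⟨s, hs1, hs2⟩ := exists_between h1
    have := key s hs1
    rw [lt_div_iff₀ hb] at hs2
    linarith

end IsPos

/-- A complex vector space with a positive semidefinite sesquilinear form with values in the
C*-algebra `B`. The condition `act` holds as soon as there is a right action for which `ip` is
`B`-linear in the second variable: take `z = x · ip x y`. -/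
structure PreHilbert (E : Type u) [AddCommGroup E] [Module ℂ E] (B : Type v) [CStarAlgebra B] where
  ip : E →ₗ⋆[ℂ] E →ₗ[ℂ] B
  star_ip : ∀ x y, star (ip x y) = ip y x
  pos : ∀ x, IsPos (ip x x)
  act : ∀ x y, ∃ z, ∀ w, ip w z = ip w x * ip x y

namespace PreHilbert

variable {E : Type u} [AddCommGroup E] [Module ℂ E] {B : Type v} [CStarAlgebra B]
  (H : PreHilbert E B)

theorem cauchySchwarz (x y : E) : ‖H.ip x y‖ ^ 2 ≤ ‖H.ip x x‖ * ‖H.ip y y‖ := by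
  obtain ⟨z, hz⟩ := H.act x y
  have h1 : H.ip z x = star (H.ip x y) * H.ip x x := by
    rw [← H.star_ip x z, hz, star_mul, H.star_ip x x]
  have h2 : H.ip y z = star (H.ip x y) * H.ip x y := by rw [hz, H.star_ip]
  have h3 : H.ip z y = star (H.ip x y) * H.ip x y := by
    rw [← H.star_ip y z, h2, star_mul, star_star]
  refine norm_sq_le_of_isPos (H.pos x) fun t => ?_
  have h4 := H.pos ((t : ℂ) • z - y)
  have h5 : H.ip ((t : ℂ) • z - y) ((t : ℂ) • z - y) =
      t ^ 2 • (star (H.ip x y) * H.ip x x * H.ip x y) - (2 * t) • (star (H.ip x y) * H.ip x y)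
        + H.ip y y := by
    rw [map_sub, map_sub, LinearMap.sub_apply, LinearMap.sub_apply, (H.ip _).map_smul,
      (H.ip _).map_smul, H.ip.map_smulₛₗ,
      LinearMap.smul_apply, LinearMap.smul_apply, Complex.conj_ofReal, hz z, h1, h2, h3,
      Complex.coe_smul, Complex.coe_smul, Complex.coe_smul, two_mul, add_smul, smul_smul, sq]
    abel
  rwa [h5] at h4

/-- The seminorm `‖⟨x, x⟩‖^(1/2)`. -/
def nrm (x : E) : ℝ := √‖H.ip x x‖

theorem nrm_nonneg (x : E) : 0 ≤ H.nrm x := Real.sqrt_nonneg _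

theorem nrm_sq (x : E) : H.nrm x ^ 2 = ‖H.ip x x‖ := Real.sq_sqrt (norm_nonneg _)

theorem norm_ip_le (x y : E) : ‖H.ip x y‖ ≤ H.nrm x * H.nrm y := by
  refine le_of_sq_le_sq ?_ (mul_nonneg (H.nrm_nonneg x) (H.nrm_nonneg y))
  rw [mul_pow, nrm_sq, nrm_sq]
  exact H.cauchySchwarz x y

theorem nrm_add_le (x y : E) : H.nrm (x + y) ≤ H.nrm x + H.nrm y := by
  refine le_of_sq_le_sq ?_ (add_nonneg (H.nrm_nonneg x) (H.nrm_nonneg y))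
  rw [nrm_sq]
  simp only [map_add, LinearMap.add_apply]
  have h1 := norm_add_le (H.ip x x + H.ip y x) (H.ip x y + H.ip y y)
  have h2 := norm_add_le (H.ip x x) (H.ip y x)
  have h3 := norm_add_le (H.ip x y) (H.ip y y)
  have h4 := H.norm_ip_le x y
  have h5 := H.norm_ip_le y x
  have h6 := H.nrm_sq x
  have h7 := H.nrm_sq y
  nlinarith

theorem nrm_smul (c : ℂ) (x : E) : H.nrm (c • x) = ‖c‖ * H.nrm x := by
  rw [← sq_eq_sq₀ (H.nrm_nonneg _) (mul_nonneg (norm_nonneg _) (H.nrm_nonneg _)), mul_pow, nrm_sq,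
    nrm_sq]
  simp only [map_smul, map_smulₛₗ, LinearMap.smul_apply, norm_smul, RCLike.norm_conj]
  ring

/-- The vector space `E` with the seminorm `‖⟨x, x⟩‖^(1/2)`. -/
def Pre (_H : PreHilbert E B) : Type u := E

instance : AddCommGroup H.Pre := inferInstanceAs (AddCommGroup E)
instance : Module ℂ H.Pre := inferInstanceAs (Module ℂ E)
instance : Norm H.Pre := ⟨H.nrm⟩

theorem core : SeminormedSpace.Core ℂ H.Pre where
  norm_nonneg := H.nrm_nonneg
  norm_smul := H.nrm_smul
  norm_triangle := H.nrm_add_le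

instance : SeminormedAddCommGroup H.Pre := SeminormedAddCommGroup.ofCore H.core
instance : NormedSpace ℂ H.Pre where
  norm_smul_le c a := (H.nrm_smul c a).le

/-- The completion of the quotient of `E` by the vectors with `⟨x, x⟩ = 0`. -/
def Space : Type u := UniformSpace.Completion H.Pre

instance spaceNormedAddCommGroup : NormedAddCommGroup H.Space :=
  inferInstanceAs (NormedAddCommGroup (UniformSpace.Completion H.Pre))

instance spaceNormedSpace : NormedSpace ℂ H.Space :=
  inferInstanceAs (NormedSpace ℂ (UniformSpace.Completion H.Pre))

instance spaceComplete : CompleteSpace H.Space :=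
  inferInstanceAs (CompleteSpace (UniformSpace.Completion H.Pre))

/-- The canonical map of `E` into the completion. -/
def proj : E →ₗ[ℂ] H.Space :=
  (UniformSpace.Completion.toComplL (𝕜 := ℂ) (E := H.Pre)).toLinearMap

theorem denseRange_proj : DenseRange H.proj := UniformSpace.Completion.denseRange_coe (α := H.Pre)

theorem norm_proj (x : E) : ‖H.proj x‖ = H.nrm x := UniformSpace.Completion.norm_coe (E := H.Pre) x

attribute [irreducible] Space spaceNormedAddCommGroup spaceNormedSpace proj

theorem norm_proj_sq (x : E) : ‖H.proj x‖ ^ 2 = ‖H.ip x x‖ := by rw [norm_proj, nrm_sq]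

/-- The extension of the sesquilinear form to the completion. -/
def innerL : H.Space →L⋆[ℂ] H.Space →L[ℂ] B :=
  bilinExtend H.ip H.proj H.proj H.denseRange_proj
    (fun x y => by rw [norm_proj, norm_proj]; exact H.norm_ip_le x y)

theorem innerL_proj (x y : E) : H.innerL (H.proj x) (H.proj y) = H.ip x y :=
  bilinExtend_apply _ _ _ H.denseRange_proj _ _ x y

theorem star_innerL (x y : H.Space) : star (H.innerL x y) = H.innerL y x := by
  refine H.denseRange_proj.induction_on₂ (p := fun x y => star (H.innerL x y) = H.innerL y x)
    ?_ ?_ x y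
  · exact isClosed_eq (by fun_prop) (by fun_prop)
  · intro a b
    rw [innerL_proj, innerL_proj, star_ip]

theorem isPos_innerL (x : H.Space) : IsPos (H.innerL x x) := by
  refine H.denseRange_proj.induction_on (p := fun x => IsPos (H.innerL x x)) x ?_ ?_
  · exact isClosed_isPos.preimage (f := fun x => H.innerL x x) (by fun_prop)
  · intro a
    rw [innerL_proj]
    exact H.pos a

theorem norm_innerL_self (x : H.Space) : ‖x‖ ^ 2 = ‖H.innerL x x‖ := by
  refine H.denseRange_proj.induction_on (p := fun x => ‖x‖ ^ 2 = ‖H.innerL x x‖) x ?_ ?_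
  · exact isClosed_eq (by fun_prop) (by fun_prop)
  · intro a
    rw [innerL_proj, norm_proj_sq]

theorem innerL_ext {x y : H.Space} (h : ∀ z, H.innerL z x = H.innerL z y) : x = y := by
  rw [← sub_eq_zero, ← norm_eq_zero, ← sq_eq_zero_iff, norm_innerL_self, map_sub, h, sub_self,
    norm_zero]

end PreHilbert


/-! ### The endomorphism `α` and the transfer operator `L` of `C*(G)` -/

section Transfer

variable {G : Type u} [Group G]

namespace GroupAlg

/-- The algebra endomorphism of `ℂ[G]` with `g ↦ φ g`. -/
def mapAlg (φ : Monoid.End G) : GroupAlg G →ₐ[ℂ] GroupAlg G :=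
  MonoidAlgebra.mapDomainAlgHom ℂ ℂ φ

theorem mapAlg_of (φ : Monoid.End G) (g : G) : mapAlg φ (of g) = of (φ g) := by
  change MonoidAlgebra.mapDomain φ (MonoidAlgebra.of ℂ G g) = MonoidAlgebra.of ℂ G (φ g)
  simp

/-- The *-endomorphism of `ℂ[G]` with `g ↦ φ g`. -/
def map (φ : Monoid.End G) : GroupAlg G →⋆ₐ[ℂ] GroupAlg G :=
  { mapAlg φ with
    map_star' := fun a => by
      change mapAlg φ (star a) = star (mapAlg φ a)
      induction a using GroupAlg.induction with
      | of g => rw [star_of, mapAlg_of, mapAlg_of, star_of, map_inv]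
      | add a b ha hb => rw [star_add, map_add, map_add, star_add, ha, hb]
      | smul c a ha => rw [star_smul, map_smul, map_smul, star_smul, ha] }

theorem map_of (φ : Monoid.End G) (g : G) : map φ (of g) = of (φ g) := mapAlg_of φ g

/-- The linear map of `ℂ[G]` with `φ g ↦ g`, and `h ↦ 0` if `h` is not in the range of `φ`. -/
def transfer (φ : Monoid.End G) (hφ : Function.Injective φ) : GroupAlg G →ₗ[ℂ] GroupAlg G where
  toFun := MonoidAlgebra.comapDomain φ hφ
  map_add' := MonoidAlgebra.comapDomain_add φ hφ
  map_smul' c a := by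
    apply MonoidAlgebra.coeff_injective
    ext g
    rfl

variable (φ : Monoid.End G) (hφ : Function.Injective φ)

theorem transfer_of_map (g : G) : transfer φ hφ (of (φ g)) = of g :=
  MonoidAlgebra.comapDomain_single_map φ hφ g 1

theorem transfer_of_notMem {g : G} (hg : g ∉ Set.range φ) : transfer φ hφ (of g) = 0 :=
  MonoidAlgebra.comapDomain_single_of_not_mem_range hg hφ

theorem transfer_star (a : GroupAlg G) :
    transfer φ hφ (star a) = star (transfer φ hφ a) := by
  induction a using GroupAlg.induction with
  | of g =>
    rw [star_of]
    by_cases hg : g ∈ Set.range φ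
    · obtain ⟨k, rfl⟩ := hg
      rw [← map_inv, transfer_of_map, transfer_of_map, star_of]
    · rw [transfer_of_notMem φ hφ hg, transfer_of_notMem φ hφ, star_zero]
      rintro ⟨k, hk⟩
      exact hg ⟨k⁻¹, by rw [map_inv, hk, inv_inv]⟩
  | add a b ha hb => rw [star_add, map_add, map_add, star_add, ha, hb]
  | smul c a ha => rw [star_smul, map_smul, map_smul, star_smul, ha]

theorem transfer_mul_map (a b : GroupAlg G) :
    transfer φ hφ (a * map φ b) = transfer φ hφ a * b := by
  induction a using GroupAlg.induction with
  | of g =>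
    induction b using GroupAlg.induction with
    | of h =>
      rw [map_of, ← of_mul]
      by_cases hg : g ∈ Set.range φ
      · obtain ⟨k, rfl⟩ := hg
        rw [← map_mul, transfer_of_map, transfer_of_map, of_mul]
      · rw [transfer_of_notMem φ hφ hg, transfer_of_notMem φ hφ, zero_mul]
        rintro ⟨k, hk⟩
        exact hg ⟨k * h⁻¹, by rw [map_mul, hk, map_inv, mul_inv_cancel_right]⟩
    | add a b ha hb => rw [map_add, mul_add, map_add, ha, hb, mul_add]
    | smul c a ha => rw [map_smul, mul_smul_comm, map_smul, ha, mul_smul_comm]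
  | add a b ha hb => rw [add_mul, map_add, ha, hb, map_add, add_mul]
  | smul c a ha => rw [smul_mul_assoc, map_smul, ha, map_smul, smul_mul_assoc]

/-- The contribution of the left coset `q` of the range of `φ`. -/
theorem transfer_star_mul_of (T : Finset (G ⧸ φ.range)) (g h : G)
    (hT : (QuotientGroup.mk h : G ⧸ φ.range) ∈ T) :
    transfer φ hφ (star (of g) * of h) =
      ∑ q ∈ T, star (transfer φ hφ (of (q.out⁻¹ * g))) * transfer φ hφ (of (q.out⁻¹ * h)) := by
  have hout : ∀ (q : G ⧸ φ.range) (x : G), q.out⁻¹ * x ∈ Set.range φ ↔ QuotientGroup.mk x = q := by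
    intro q x
    conv_rhs => rw [← q.out_eq', eq_comm, QuotientGroup.eq]
    rfl
  rw [Finset.sum_eq_single_of_mem _ hT]
  · obtain ⟨k, hk⟩ := (hout _ h).2 rfl
    rw [← hk, transfer_of_map, star_of, ← of_mul]
    by_cases hg : (QuotientGroup.mk g : G ⧸ φ.range) = QuotientGroup.mk h
    · obtain ⟨l, hl⟩ := (hout _ g).2 hg
      rw [← hl, transfer_of_map, star_of, ← of_mul, ← transfer_of_map φ hφ (l⁻¹ * k)]
      congr 2
      rw [map_mul, map_inv, hl, hk]
      group
    · rw [transfer_of_notMem φ hφ (fun hh => hg ((hout _ g).1 hh)), star_zero, zero_mul]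
      apply transfer_of_notMem
      intro hh
      exact hg (QuotientGroup.eq.2 hh)
  · intro q _ hq
    rw [transfer_of_notMem φ hφ (g := q.out⁻¹ * h) (fun hh => hq ((hout q h).1 hh).symm), mul_zero]

theorem exists_transfer_star_mul_self (a : GroupAlg G) :
    ∃ (T : Finset (G ⧸ φ.range)), transfer φ hφ (star a * a) =
      ∑ q ∈ T, star (transfer φ hφ (of q.out⁻¹ * a)) * transfer φ hφ (of q.out⁻¹ * a) := by
  classical
  have key : ∀ b : GroupAlg G, ∃ T₀ : Finset (G ⧸ φ.range), ∀ T, T₀ ⊆ T → ∀ a : GroupAlg G,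
      transfer φ hφ (star a * b) =
      ∑ q ∈ T, star (transfer φ hφ (of q.out⁻¹ * a)) * transfer φ hφ (of q.out⁻¹ * b) := by
    intro b
    induction b using GroupAlg.induction with
    | of h =>
      refine ⟨{QuotientGroup.mk h}, fun T hT a => ?_⟩
      induction a using GroupAlg.induction with
      | of g =>
        rw [transfer_star_mul_of φ hφ T g h (hT (Finset.mem_singleton_self _))]
        simp only [of_mul]
      | add a b ha hb =>
        simp only [star_add, add_mul, mul_add, map_add, ha, hb, Finset.sum_add_distrib]
      | smul c a ha =>
        simp only [star_smul, smul_mul_assoc, mul_smul_comm, map_smul, ha, Finset.smul_sum]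
    | add b c hb hc =>
      obtain ⟨T₁, h₁⟩ := hb
      obtain ⟨T₂, h₂⟩ := hc
      refine ⟨T₁ ∪ T₂, fun T hT a => ?_⟩
      rw [mul_add, map_add, h₁ T (Finset.union_subset_left hT), h₂ T (Finset.union_subset_right hT),
        ← Finset.sum_add_distrib]
      simp only [mul_add, map_add]
    | smul c b hb =>
      obtain ⟨T₁, h₁⟩ := hb
      refine ⟨T₁, fun T hT a => ?_⟩
      rw [mul_smul_comm, map_smul, h₁ T hT, Finset.smul_sum]
      simp only [mul_smul_comm, map_smul]
  obtain ⟨T, hT⟩ := key a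
  exact ⟨T, hT T subset_rfl a⟩

/-- For a C*-seminorm `ρ` on `ℂ[G]`, the semidefinite form `L(a* b)` with values in the C*-algebra
defined by `ρ`. -/
def preHilbert (ρ : CStarSeminorm (GroupAlg G)) : PreHilbert (GroupAlg G) ρ.Compl where
  ip := LinearMap.mk₂'ₛₗ (starRingEnd ℂ) (RingHom.id ℂ)
    (fun a b => ρ.toCompl (transfer φ hφ (star a * b)))
    (fun a b c => by simp only [star_add, add_mul, map_add])
    (fun c a b => by simp only [star_smul, smul_mul_assoc, map_smul, starRingEnd_apply])
    (fun a b c => by simp only [mul_add, map_add])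
    (fun c a b => by simp only [mul_smul_comm, map_smul, RingHom.id_apply])
  star_ip a b := by
    simp only [LinearMap.mk₂'ₛₗ_apply]
    rw [← map_star, ← transfer_star, star_mul, star_star]
  pos a := by
    simp only [LinearMap.mk₂'ₛₗ_apply]
    obtain ⟨T, hT⟩ := exists_transfer_star_mul_self φ hφ a
    rw [hT, map_sum]
    refine IsPos.sum _ _ fun q _ => ⟨ρ.toCompl (transfer φ hφ (of q.out⁻¹ * a)), ?_⟩
    rw [map_mul, map_star]
  act a b := by
    refine ⟨a * map φ (transfer φ hφ (star a * b)), fun w => ?_⟩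
    simp only [LinearMap.mk₂'ₛₗ_apply]
    rw [← mul_assoc, transfer_mul_map, map_mul]

theorem preHilbert_ip (ρ : CStarSeminorm (GroupAlg G)) (a b : GroupAlg G) :
    (preHilbert φ hφ ρ).ip a b = ρ.toCompl (transfer φ hφ (star a * b)) := rfl

theorem exists_nrm_mul_le (ρ : CStarSeminorm (GroupAlg G)) (a : GroupAlg G) :
    ∃ C, ∀ b, (preHilbert φ hφ ρ).nrm (a * b) ≤ C * (preHilbert φ hφ ρ).nrm b := by
  induction a using GroupAlg.induction with
  | of g =>
    refine ⟨1, fun b => ?_⟩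
    rw [one_mul, PreHilbert.nrm, PreHilbert.nrm, preHilbert_ip, preHilbert_ip, star_mul, mul_assoc,
      ← mul_assoc _ (of g), star_of, ← of_mul, inv_mul_cancel, of_one, one_mul]
  | add a a' ha ha' =>
    obtain ⟨C, hC⟩ := ha
    obtain ⟨D, hD⟩ := ha'
    refine ⟨C + D, fun b => ?_⟩
    rw [add_mul, add_mul]
    exact ((preHilbert φ hφ ρ).nrm_add_le _ _).trans (add_le_add (hC b) (hD b))
  | smul c a ha =>
    obtain ⟨C, hC⟩ := ha
    refine ⟨‖c‖ * C, fun b => ?_⟩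
    rw [smul_mul_assoc, PreHilbert.nrm_smul, mul_assoc]
    exact mul_le_mul_of_nonneg_left (hC b) (norm_nonneg c)

/-- Left multiplication by `a` as a bounded operator for the form `L(a* b)`. -/
def leftMul (ρ : CStarSeminorm (GroupAlg G)) (a : GroupAlg G) :
    (preHilbert φ hφ ρ).Pre →L[ℂ] (preHilbert φ hφ ρ).Pre :=
  LinearMap.mkContinuousOfExistsBound (LinearMap.mulLeft ℂ a : GroupAlg G →ₗ[ℂ] GroupAlg G)
    (exists_nrm_mul_le φ hφ ρ a)

theorem nrm_mul_le (ρ : CStarSeminorm (GroupAlg G)) (a b : GroupAlg G) :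
    (preHilbert φ hφ ρ).nrm (a * b) ≤ ‖leftMul φ hφ ρ a‖ * (preHilbert φ hφ ρ).nrm b :=
  (leftMul φ hφ ρ a).le_opNorm b

theorem norm_leftMul_le (ρ : CStarSeminorm (GroupAlg G)) (a : GroupAlg G) {C : ℝ} (hC : 0 ≤ C)
    (h : ∀ b, (preHilbert φ hφ ρ).nrm (a * b) ≤ C * (preHilbert φ hφ ρ).nrm b) :
    ‖leftMul φ hφ ρ a‖ ≤ C :=
  (leftMul φ hφ ρ a).opNorm_le_bound hC h

theorem sq_norm_leftMul_le (ρ : CStarSeminorm (GroupAlg G)) (a : GroupAlg G) :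
    ‖leftMul φ hφ ρ a‖ ^ 2 ≤ ‖leftMul φ hφ ρ (star a * a)‖ := by
  rw [← Real.le_sqrt (norm_nonneg _) (norm_nonneg _)]
  refine norm_leftMul_le φ hφ ρ a (Real.sqrt_nonneg _) fun b => ?_
  have h0 := (preHilbert φ hφ ρ).nrm_nonneg b
  refine le_of_sq_le_sq ?_ (mul_nonneg (Real.sqrt_nonneg _) h0)
  rw [mul_pow, Real.sq_sqrt (norm_nonneg _), PreHilbert.nrm_sq]
  have h1 : (preHilbert φ hφ ρ).ip (a * b) (a * b) =
      (preHilbert φ hφ ρ).ip b (star a * a * b) := by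
    rw [preHilbert_ip, preHilbert_ip, star_mul]
    simp only [mul_assoc]
  rw [h1]
  refine ((preHilbert φ hφ ρ).norm_ip_le _ _).trans ?_
  have h2 := nrm_mul_le φ hφ ρ (star a * a) b
  nlinarith

/-- The C*-seminorm on `ℂ[G]` induced from `ρ` along `φ`. -/
def induced (ρ : CStarSeminorm (GroupAlg G)) : CStarSeminorm (GroupAlg G) where
  toFun a := ‖leftMul φ hφ ρ a‖
  map_zero' := by
    have : leftMul φ hφ ρ 0 = 0 := by
      ext b
      exact zero_mul (show GroupAlg G from b)
    rw [this, norm_zero]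
  add_le' a a' := by
    have : leftMul φ hφ ρ (a + a') = leftMul φ hφ ρ a + leftMul φ hφ ρ a' := by
      ext b
      exact add_mul a a' (show GroupAlg G from b)
    rw [this]
    exact norm_add_le _ _
  neg' a := by
    have : leftMul φ hφ ρ (-a) = -leftMul φ hφ ρ a := by
      ext b
      exact neg_mul a (show GroupAlg G from b)
    rw [this, norm_neg]
  smul' c a := by
    have : leftMul φ hφ ρ (c • a) = c • leftMul φ hφ ρ a := by
      ext b
      exact smul_mul_assoc c a (show GroupAlg G from b)
    rw [this, norm_smul]
  mul_le' a a' := by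
    refine norm_leftMul_le φ hφ ρ _ (mul_nonneg (norm_nonneg _) (norm_nonneg _)) fun b => ?_
    rw [mul_assoc, mul_assoc]
    exact (nrm_mul_le φ hφ ρ a _).trans
      (mul_le_mul_of_nonneg_left (nrm_mul_le φ hφ ρ a' b) (norm_nonneg _))
  star_mul_self' a := by
    have hmul : ∀ a a', ‖leftMul φ hφ ρ (a * a')‖ ≤ ‖leftMul φ hφ ρ a‖ * ‖leftMul φ hφ ρ a'‖ := by
      intro a a'
      refine norm_leftMul_le φ hφ ρ _ (mul_nonneg (norm_nonneg _) (norm_nonneg _)) fun b => ?_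
      rw [mul_assoc, mul_assoc]
      exact (nrm_mul_le φ hφ ρ a _).trans
        (mul_le_mul_of_nonneg_left (nrm_mul_le φ hφ ρ a' b) (norm_nonneg _))
    have hstar : ∀ a, ‖leftMul φ hφ ρ a‖ ≤ ‖leftMul φ hφ ρ (star a)‖ := by
      intro a
      rcases (norm_nonneg (leftMul φ hφ ρ a)).eq_or_lt with h | h
      · rw [← h]; exact norm_nonneg _
      · have h1 := (sq_norm_leftMul_le φ hφ ρ a).trans (hmul (star a) a)
        rw [sq] at h1
        exact le_of_mul_le_mul_right h1 h
    apply le_antisymm _ (sq_norm_leftMul_le φ hφ ρ a)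
    have h2 := hstar (star a)
    rw [star_star] at h2
    rw [sq]
    exact (hmul _ _).trans (mul_le_mul_of_nonneg_right h2 (norm_nonneg _))

theorem seminorm_transfer_le (ρ : CStarSeminorm (GroupAlg G)) (a : GroupAlg G) :
    ρ (transfer φ hφ a) ≤ induced φ hφ ρ a := by
  have h1 : (preHilbert φ hφ ρ).nrm 1 ≤ 1 := by
    rw [PreHilbert.nrm, preHilbert_ip, ρ.norm_toCompl, star_one, mul_one]
    have : transfer φ hφ (1 : GroupAlg G) = 1 := by
      have h0 := transfer_of_map φ hφ 1
      rwa [map_one, of_one] at h0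
    rw [this]
    exact Real.sqrt_le_one.2 ρ.one_le
  have h2 := (preHilbert φ hφ ρ).norm_ip_le 1 (a * 1)
  rw [preHilbert_ip, ρ.norm_toCompl, star_one, one_mul, mul_one] at h2
  have h3 := nrm_mul_le φ hφ ρ a 1
  rw [mul_one] at h3
  have h4 := (preHilbert φ hφ ρ).nrm_nonneg 1
  have h5 : 0 ≤ ‖leftMul φ hφ ρ a‖ := norm_nonneg _
  change _ ≤ ‖leftMul φ hφ ρ a‖
  have h6 := (preHilbert φ hφ ρ).nrm_nonneg a
  nlinarith [mul_nonneg h4 h6, mul_le_mul h1 h3 h6 zero_le_one,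
    mul_le_mul_of_nonneg_left h1 h5]

theorem maxSeminorm_transfer_le (a : GroupAlg G) :
    maxSeminorm G (transfer φ hφ a) ≤ maxSeminorm G a :=
  CStarSeminorm.sup_le _ _ (CStarSeminorm.nonneg _ _) fun ρ _ =>
    (seminorm_transfer_le φ hφ ρ a).trans (le_maxSeminorm _ a)

/-- The pullback of a C*-seminorm along `φ`. -/
def pullback (ρ : CStarSeminorm (GroupAlg G)) : CStarSeminorm (GroupAlg G) where
  toFun a := ρ (map φ a)
  map_zero' := by rw [map_zero, map_zero]
  add_le' a b := by rw [map_add]; exact map_add_le_add ρ.toSeminorm _ _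
  neg' a := by rw [map_neg, map_neg_eq_map]
  smul' c a := by rw [map_smul, map_smul_eq_mul]
  mul_le' a b := by rw [map_mul]; exact ρ.mul_le _ _
  star_mul_self' a := by rw [map_mul, map_star, ρ.star_mul_self]

theorem maxSeminorm_map_le (a : GroupAlg G) : maxSeminorm G (map φ a) ≤ maxSeminorm G a :=
  CStarSeminorm.sup_le _ _ (CStarSeminorm.nonneg _ _) fun ρ _ => le_maxSeminorm (pullback φ ρ) a

end GroupAlg

namespace GroupCStar

/-- The linear map underlying `incl`. -/
def inclₗ : GroupAlg G →ₗ[ℂ] GroupCStar G where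
  toFun := incl
  map_add' := map_add incl
  map_smul' := map_smul incl

theorem extend_incl (T : GroupAlg G →ₗ[ℂ] GroupAlg G)
    (hT : ∀ a, maxSeminorm G (T a) ≤ maxSeminorm G a) (a : GroupAlg G) :
    (inclₗ ∘ₗ T).extendOfNorm inclₗ (incl a) = incl (T a) := by
  have h1 : DenseRange (inclₗ : GroupAlg G →ₗ[ℂ] GroupCStar G) := denseRange_incl
  have h2 : ∀ x, ‖(inclₗ ∘ₗ T) x‖ ≤ 1 * ‖(inclₗ : GroupAlg G →ₗ[ℂ] GroupCStar G) x‖ := by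
    intro x
    have h3 := hT x
    rw [← norm_incl, ← norm_incl] at h3
    rw [one_mul]
    exact h3
  exact LinearMap.extendOfNorm_eq h1 ⟨1, h2⟩ a

/-- The transfer operator `L : C*(G) → C*(G)` of an injective endomorphism `φ` of `G`: the continuous
linear map with `L(δ_{φ(g)}) = δ_g`, and `L(δ_h) = 0` if `h` is not in the range of `φ`. -/
def transfer (φ : Monoid.End G) (hφ : Function.Injective φ) : GroupCStar G →L[ℂ] GroupCStar G :=
  (inclₗ ∘ₗ GroupAlg.transfer φ hφ).extendOfNorm inclₗ

theorem transfer_incl (φ : Monoid.End G) (hφ : Function.Injective φ) (a : GroupAlg G) :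
    transfer φ hφ (incl a) = incl (GroupAlg.transfer φ hφ a) := by
  refine extend_incl (GroupAlg.transfer φ hφ) (fun x => ?_) a
  exact GroupAlg.maxSeminorm_transfer_le φ hφ x

theorem transfer_delta_map (φ : Monoid.End G) (hφ : Function.Injective φ) (g : G) :
    transfer φ hφ (delta (φ g)) = delta g := by
  rw [delta, transfer_incl, GroupAlg.transfer_of_map]; rfl

theorem transfer_delta_of_notMem (φ : Monoid.End G) (hφ : Function.Injective φ) {g : G}
    (hg : g ∉ Set.range φ) : transfer φ hφ (delta g) = 0 := by
  rw [delta, transfer_incl, GroupAlg.transfer_of_notMem φ hφ hg, map_zero]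

/-- The continuous linear map underlying `alpha`. -/
def alphaL (φ : Monoid.End G) : GroupCStar G →L[ℂ] GroupCStar G :=
  (inclₗ ∘ₗ (GroupAlg.map φ).toAlgHom.toLinearMap).extendOfNorm inclₗ

theorem alphaL_incl (φ : Monoid.End G) (a : GroupAlg G) :
    alphaL φ (incl a) = incl (GroupAlg.map φ a) := by
  refine extend_incl (GroupAlg.map φ).toAlgHom.toLinearMap (fun x => ?_) a
  exact GroupAlg.maxSeminorm_map_le φ x

/-- The *-endomorphism `α` of `C*(G)` induced by an endomorphism `φ` of `G`, with
`α(δ_g) = δ_{φ(g)}`. -/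
def alpha (φ : Monoid.End G) : GroupCStar G →⋆ₐ[ℂ] GroupCStar G where
  toFun := alphaL φ
  map_one' := by rw [← map_one incl, alphaL_incl, map_one]
  map_mul' a b := by
    refine denseRange_incl.induction_on₂
      (p := fun a b => alphaL φ (a * b) = alphaL φ a * alphaL φ b) ?_ ?_ a b
    · exact isClosed_eq (by fun_prop) (by fun_prop)
    · intro a b
      rw [← map_mul, alphaL_incl, alphaL_incl, alphaL_incl, map_mul, map_mul]
  map_zero' := map_zero _
  map_add' := map_add _
  commutes' c := by
    rw [Algebra.algebraMap_eq_smul_one, map_smul, ← map_one incl, alphaL_incl, map_one]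
  map_star' a := by
    refine denseRange_incl.induction_on
      (p := fun a => alphaL φ (star a) = star (alphaL φ a)) a ?_ ?_
    · exact isClosed_eq (by fun_prop) (by fun_prop)
    · intro a
      rw [← map_star, alphaL_incl, alphaL_incl, map_star, map_star]

theorem alpha_incl (φ : Monoid.End G) (a : GroupAlg G) :
    alpha φ (incl a) = incl (GroupAlg.map φ a) := alphaL_incl φ a

theorem alpha_delta (φ : Monoid.End G) (g : G) : alpha φ (delta g) = delta (φ g) := by
  rw [delta, alpha_incl, GroupAlg.map_of]; rfl

theorem continuous_alpha (φ : Monoid.End G) : Continuous (alpha φ) := (alphaL φ).continuous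

theorem clm_ext {E : Type w} [NormedAddCommGroup E] [NormedSpace ℂ E] {f g : GroupCStar G →L[ℂ] E}
    (h : ∀ x, f (delta x) = g (delta x)) : f = g := by
  have h1 : f.toLinearMap ∘ₗ inclₗ = g.toLinearMap ∘ₗ inclₗ := GroupAlg.linearMap_ext h
  ext a
  refine denseRange_incl.induction_on (p := fun a => f a = g a) a ?_ ?_
  · exact isClosed_eq f.continuous g.continuous
  · exact fun a => LinearMap.congr_fun h1 a

variable (φ : Monoid.End G) (hφ : Function.Injective φ)

theorem transfer_star (a : GroupCStar G) : transfer φ hφ (star a) = star (transfer φ hφ a) := by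
  refine denseRange_incl.induction_on
    (p := fun a => transfer φ hφ (star a) = star (transfer φ hφ a)) a ?_ ?_
  · exact isClosed_eq (by fun_prop) (by fun_prop)
  · intro a
    rw [← map_star, transfer_incl, transfer_incl, GroupAlg.transfer_star, map_star]

theorem transfer_mul_alpha (a b : GroupCStar G) :
    transfer φ hφ (a * alpha φ b) = transfer φ hφ a * b := by
  have := continuous_alpha φ
  refine denseRange_incl.induction_on₂
    (p := fun a b => transfer φ hφ (a * alpha φ b) = transfer φ hφ a * b) ?_ ?_ a b
  · exact isClosed_eq (by fun_prop) (by fun_prop)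
  · intro a b
    rw [alpha_incl, ← map_mul, transfer_incl, transfer_incl, GroupAlg.transfer_mul_map, map_mul]

theorem isPos_transfer (a : GroupCStar G) : IsPos (transfer φ hφ (star a * a)) := by
  refine denseRange_incl.induction_on
    (p := fun a => IsPos (transfer φ hφ (star a * a))) a ?_ ?_
  · exact isClosed_isPos.preimage (f := fun a => transfer φ hφ (star a * a)) (by fun_prop)
  · intro a
    obtain ⟨T, hT⟩ := GroupAlg.exists_transfer_star_mul_self φ hφ a
    rw [← map_star, ← map_mul, transfer_incl, hT, map_sum]
    refine IsPos.sum _ _ fun q _ =>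
      ⟨incl (GroupAlg.transfer φ hφ (GroupAlg.of q.out⁻¹ * a)), ?_⟩
    rw [map_mul, map_star]

end GroupCStar

end Transfer


/-! ### Right-Hilbert bimodules and product systems -/

/-- A right-Hilbert `A`-bimodule over the unital C*-algebra `A`: a right Hilbert `A`-module, whose
norm is `‖⟨x, x⟩‖^(1/2)`, with a left action of `A` by adjointable operators. The right action is
written `MulOpposite.op a • x`. -/
class RightHilbertBimodule (A : Type u) [CStarAlgebra A] (E : Type w) [NormedAddCommGroup E]
    [NormedSpace ℂ E] [CompleteSpace E] [Module A E] [Module Aᵐᵒᵖ E] where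
  /-- The `A`-valued inner product, linear in the second variable. -/
  inner : E → E → A
  inner_add_right : ∀ x y z, inner x (y + z) = inner x y + inner x z
  inner_smul_right : ∀ x (c : ℂ) y, inner x (c • y) = c • inner x y
  star_inner : ∀ x y, star (inner x y) = inner y x
  isPos_inner_self : ∀ x, IsPos (inner x x)
  norm_sq_eq : ∀ x, ‖x‖ ^ 2 = ‖inner x x‖
  inner_op_smul_right : ∀ x y (a : A), inner x (MulOpposite.op a • y) = inner x y * a
  inner_smul_eq : ∀ x y (a : A), inner x (a • y) = inner (star a • x) y
  smul_op_smul : ∀ (c : ℂ) (a : A) (x : E), MulOpposite.op (c • a) • x = c • (MulOpposite.op a • x)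
  smul_smul_left : ∀ (c : ℂ) (a : A) (x : E), (c • a) • x = c • (a • x)

/-- A product system of right-Hilbert `A`-bimodules over the monoid `S`, given by its fibres `M_p` and
the products `M_p × M_q → M_r` for `p * q = r`. Formulating the product for all `r` with `p * q = r`
expresses that `⨆ M_p` is a semigroup fibred over `S` without transport along equalities in `S`. -/
structure ProductSystem (A : Type u) [CStarAlgebra A] (S : Type v) [Monoid S] where
  fibre : S → Type w
  [instNormedAddCommGroup : ∀ p, NormedAddCommGroup (fibre p)]
  [instNormedSpace : ∀ p, NormedSpace ℂ (fibre p)]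
  [instCompleteSpace : ∀ p, CompleteSpace (fibre p)]
  [instLeft : ∀ p, Module A (fibre p)]
  [instRight : ∀ p, Module Aᵐᵒᵖ (fibre p)]
  [instBimodule : ∀ p, RightHilbertBimodule A (fibre p)]
  /-- The product of the semigroup `⨆ M_p`. -/
  mul : ∀ {p q r : S}, p * q = r → fibre p → fibre q → fibre r
  mul_assoc : ∀ {p q r s t k : S} (h₁ : p * q = s) (h₂ : s * r = k) (h₃ : q * r = t)
    (h₄ : p * t = k) (x : fibre p) (y : fibre q) (z : fibre r),
    mul h₂ (mul h₁ x y) z = mul h₄ x (mul h₃ y z)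
  add_mul : ∀ {p q r : S} (h : p * q = r) (x x' : fibre p) (y : fibre q),
    mul h (x + x') y = mul h x y + mul h x' y
  mul_add : ∀ {p q r : S} (h : p * q = r) (x : fibre p) (y y' : fibre q),
    mul h x (y + y') = mul h x y + mul h x y'
  smul_mul : ∀ {p q r : S} (h : p * q = r) (c : ℂ) (x : fibre p) (y : fibre q),
    mul h (c • x) y = c • mul h x y
  mul_smul : ∀ {p q r : S} (h : p * q = r) (c : ℂ) (x : fibre p) (y : fibre q),
    mul h x (c • y) = c • mul h x y
  /-- The product preserves the inner product of the balanced tensor product `M_p ⊗_A M_q`. -/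
  inner_mul_mul : ∀ {p q r : S} (h : p * q = r) (x x' : fibre p) (y y' : fibre q),
    RightHilbertBimodule.inner (A := A) (mul h x y) (mul h x' y') =
      RightHilbertBimodule.inner (A := A) y (RightHilbertBimodule.inner (A := A) x x' • y')
  /-- The induced isometry `M_p ⊗_A M_q → M_{pq}` is surjective. -/
  dense_span_mul : ∀ {p q r : S} (h : p * q = r), p ≠ 1 →
    Dense (Submodule.span ℂ {z : fibre r | ∃ x y, z = mul h x y} : Set (fibre r))
  /-- The identification of the bimodule `A` with `M_1`. -/
  unit : A ≃ₗ[ℂ] fibre 1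
  inner_unit : ∀ a b, RightHilbertBimodule.inner (A := A) (unit a) (unit b) = star a * b
  smul_unit : ∀ a b : A, a • unit b = unit (a * b)
  op_smul_unit : ∀ a b : A, MulOpposite.op b • unit a = unit (a * b)
  /-- The product `M_1 × M_p → M_p` is the left action of `A`. -/
  unit_mul : ∀ {p : S} (h : 1 * p = p) (a : A) (x : fibre p), mul h (unit a) x = a • x
  /-- The product `M_p × M_1 → M_p` is the right action of `A`. -/
  mul_unit : ∀ {p : S} (h : p * 1 = p) (a : A) (x : fibre p),
    mul h x (unit a) = MulOpposite.op a • x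

attribute [instance] ProductSystem.instNormedAddCommGroup ProductSystem.instNormedSpace
  ProductSystem.instCompleteSpace ProductSystem.instLeft ProductSystem.instRight
  ProductSystem.instBimodule

/-! ### The product system of a family of transfer operators -/

/-- An action `α` of the monoid `S` on the unital C*-algebra `A` by unital *-endomorphisms, together
with an action `L` of the opposite monoid by unital positive linear maps such that `L_p` is a
transfer operator for `α_p`. -/
structure ExelLarsenSystem (A : Type u) [CStarAlgebra A] (S : Type v) [Monoid S] where
  α : S → A →⋆ₐ[ℂ] A
  α_one : ∀ a, α 1 a = a
  α_mul : ∀ p q a, α (p * q) a = α p (α q a)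
  L : S → A →L[ℂ] A
  L_one : ∀ a, L 1 a = a
  L_mul : ∀ p q a, L (p * q) a = L q (L p a)
  L_unital : ∀ p, L p 1 = 1
  L_star : ∀ p a, L p (star a) = star (L p a)
  L_pos : ∀ p a, IsPos (L p (star a * a))
  L_α_mul : ∀ p a b, L p (α p a * b) = a * L p b

namespace ExelLarsenSystem

variable {A : Type u} [CStarAlgebra A] {S : Type v} [Monoid S] (X : ExelLarsenSystem A S)

theorem L_mul_α (p : S) (a b : A) : X.L p (a * X.α p b) = X.L p a * b := by
  rw [← star_star (a * X.α p b), X.L_star, star_mul, ← map_star (X.α p), X.L_α_mul, star_mul,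
    star_star, ← X.L_star, star_star]

/-- The pre-inner product `⟨a, b⟩_p = L_p(a* b)` on `A`. -/
def preHilbert (p : S) : PreHilbert A A where
  ip := LinearMap.mk₂'ₛₗ (starRingEnd ℂ) (RingHom.id ℂ) (fun a b => X.L p (star a * b))
    (fun a b c => by simp only [star_add, add_mul, map_add])
    (fun c a b => by simp only [star_smul, smul_mul_assoc, map_smul, starRingEnd_apply])
    (fun a b c => by simp only [mul_add, map_add])
    (fun c a b => by simp only [mul_smul_comm, map_smul, RingHom.id_apply])
  star_ip a b := by
    simp only [LinearMap.mk₂'ₛₗ_apply]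
    rw [← X.L_star, star_mul, star_star]
  pos a := X.L_pos p a
  act a b := ⟨a * X.α p (X.L p (star a * b)), fun w => by
    simp only [LinearMap.mk₂'ₛₗ_apply]
    rw [← mul_assoc, L_mul_α]⟩

theorem preHilbert_ip (p : S) (a b : A) : (X.preHilbert p).ip a b = X.L p (star a * b) := rfl

/-- The Hilbert module `M_p`: the completion of `A / N_p`, `N_p = {a | L_p(a* a) = 0}`, in the norm
`‖L_p(a* a)‖^(1/2)`. -/
def Fibre (p : S) : Type u := (X.preHilbert p).Space

instance (p : S) : NormedAddCommGroup (X.Fibre p) :=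
  inferInstanceAs (NormedAddCommGroup (X.preHilbert p).Space)
instance (p : S) : NormedSpace ℂ (X.Fibre p) :=
  inferInstanceAs (NormedSpace ℂ (X.preHilbert p).Space)
instance (p : S) : CompleteSpace (X.Fibre p) :=
  inferInstanceAs (CompleteSpace (X.preHilbert p).Space)

/-- The quotient map `π_p : A → A / N_p ⊆ M_p`. -/
def π (p : S) : A →ₗ[ℂ] X.Fibre p := (X.preHilbert p).proj

theorem denseRange_π (p : S) : DenseRange (X.π p) := (X.preHilbert p).denseRange_proj

theorem norm_π_sq (p : S) (a : A) : ‖X.π p a‖ ^ 2 = ‖X.L p (star a * a)‖ :=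
  (X.preHilbert p).norm_proj_sq a

/-- The inner product `⟨π_p(a), π_p(b)⟩_p = L_p(a* b)` of `M_p`. -/
def innerL (p : S) : X.Fibre p →L⋆[ℂ] X.Fibre p →L[ℂ] A := (X.preHilbert p).innerL

theorem innerL_π (p : S) (a b : A) : X.innerL p (X.π p a) (X.π p b) = X.L p (star a * b) :=
  (X.preHilbert p).innerL_proj a b

theorem innerL_ext {p : S} {x y : X.Fibre p} (h : ∀ z, X.innerL p z x = X.innerL p z y) : x = y :=
  (X.preHilbert p).innerL_ext h

theorem norm_π_mul_le (p : S) (b a : A) : ‖X.π p (b * a)‖ ≤ ‖b‖ * ‖X.π p a‖ := by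
  refine le_of_sq_le_sq ?_ (mul_nonneg (norm_nonneg _) (norm_nonneg _))
  rw [mul_pow, norm_π_sq, norm_π_sq, star_mul, ← Real.norm_of_nonneg (sq_nonneg ‖b‖), ← norm_smul]
  refine norm_le_of_isPos_sub ?_ ?_
  · have := X.L_pos p (b * a)
    rwa [star_mul] at this
  · obtain ⟨c, hc⟩ := isPos_norm_smul_sub a b
    rw [← ContinuousLinearMap.map_smul_of_tower (X.L p), ← map_sub]
    have h1 : star a * star b * (b * a) = star a * (star b * b) * a := by simp only [mul_assoc]
    rw [h1, hc]
    exact X.L_pos p c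

/-- The left action of `A` on `M_p`: `b π_p(a) = π_p(b a)`. -/
def leftL (p : S) : A →L[ℂ] X.Fibre p →L[ℂ] X.Fibre p :=
  bilinExtend (σ := RingHom.id ℂ) ((LinearMap.mul ℂ A).compr₂ (X.π p)) LinearMap.id (X.π p)
    (X.denseRange_π p) (X.norm_π_mul_le p)

theorem leftL_π (p : S) (b a : A) : X.leftL p b (X.π p a) = X.π p (b * a) :=
  bilinExtend_apply (σ := RingHom.id ℂ) ((LinearMap.mul ℂ A).compr₂ (X.π p)) LinearMap.id (X.π p)
    Function.surjective_id.denseRange (X.denseRange_π p) (X.norm_π_mul_le p) b a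

theorem norm_π_mul_α_le {p q r : S} (h : p * q = r) (a b : A) :
    ‖X.π r (a * X.α p b)‖ ≤ ‖X.π p a‖ * ‖X.π q b‖ := by
  subst h
  refine le_of_sq_le_sq ?_ (mul_nonneg (norm_nonneg _) (norm_nonneg _))
  obtain ⟨d, hd⟩ := X.L_pos p a
  have h1 : X.L (p * q) (star (a * X.α p b) * (a * X.α p b)) = X.L q (star (d * b) * (d * b)) := by
    rw [X.L_mul, star_mul, ← map_star (X.α p), mul_assoc, X.L_α_mul, ← mul_assoc, X.L_mul_α, hd, star_mul]
    simp only [mul_assoc]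
  have h2 : ‖X.π p a‖ = ‖d‖ := by
    rw [← sq_eq_sq₀ (norm_nonneg _) (norm_nonneg _), norm_π_sq, hd, CStarRing.norm_star_mul_self, sq]
  rw [norm_π_sq, h1, ← norm_π_sq, h2]
  exact pow_le_pow_left₀ (norm_nonneg _) (X.norm_π_mul_le q d b) 2

/-- The bilinear map `(a, b) ↦ π_r(a α_p(b))` on `A × A`. -/
def preMul (p r : S) : A →ₗ[ℂ] A →ₗ[ℂ] X.Fibre r :=
  ((LinearMap.mul ℂ A).compr₂ (X.π r)).compl₂ (X.α p).toAlgHom.toLinearMap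

theorem preMul_apply (p r : S) (a b : A) : X.preMul p r a b = X.π r (a * X.α p b) := rfl

/-- The product `M_p × M_q → M_r` for `p * q = r`: `π_p(a) π_q(b) = π_r(a α_p(b))`. -/
def mulL {p q r : S} (h : p * q = r) : X.Fibre p →L[ℂ] X.Fibre q →L[ℂ] X.Fibre r :=
  bilinExtend (σ := RingHom.id ℂ) (X.preMul p r) (X.π p) (X.π q) (X.denseRange_π q)
    (X.norm_π_mul_α_le h)

theorem mulL_π {p q r : S} (h : p * q = r) (a b : A) :
    X.mulL h (X.π p a) (X.π q b) = X.π r (a * X.α p b) :=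
  bilinExtend_apply (σ := RingHom.id ℂ) (X.preMul p r) (X.π p) (X.π q) (X.denseRange_π p)
    (X.denseRange_π q) (X.norm_π_mul_α_le h) a b

theorem norm_π_mul_α_le' (p : S) (a b : A) : ‖X.π p (a * X.α p b)‖ ≤ ‖X.π p a‖ * ‖b‖ := by
  refine (X.norm_π_mul_α_le (mul_one p) a b).trans_eq ?_
  congr 1
  rw [← sq_eq_sq₀ (norm_nonneg _) (norm_nonneg _), norm_π_sq, X.L_one,
    CStarRing.norm_star_mul_self, sq]

/-- The right action of `A` on `M_p`: `π_p(a) b = π_p(a α_p(b))`. -/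
def rightL (p : S) : X.Fibre p →L[ℂ] A →L[ℂ] X.Fibre p :=
  bilinExtend (σ := RingHom.id ℂ) (X.preMul p p) (X.π p) LinearMap.id
    Function.surjective_id.denseRange (X.norm_π_mul_α_le' p)

theorem rightL_π (p : S) (a b : A) : X.rightL p (X.π p a) b = X.π p (a * X.α p b) :=
  bilinExtend_apply (σ := RingHom.id ℂ) (X.preMul p p) (X.π p) LinearMap.id (X.denseRange_π p)
    Function.surjective_id.denseRange (X.norm_π_mul_α_le' p) a b

theorem fibre_induction {p : S} {P : X.Fibre p → Prop} (x : X.Fibre p) (hP : IsClosed {x | P x})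
    (h : ∀ a, P (X.π p a)) : P x :=
  (X.denseRange_π p).induction_on x hP h

instance (p : S) : Module A (X.Fibre p) where
  smul a x := X.leftL p a x
  one_smul x := by
    change X.leftL p 1 x = x
    refine X.fibre_induction (P := fun x => X.leftL p 1 x = x) x ?_ ?_
    · exact isClosed_eq (by fun_prop) (by fun_prop)
    · intro a
      rw [leftL_π, one_mul]
  mul_smul a b x := by
    change X.leftL p (a * b) x = X.leftL p a (X.leftL p b x)
    refine X.fibre_induction (P := fun x => X.leftL p (a * b) x = X.leftL p a (X.leftL p b x)) x ?_ ?_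
    · exact isClosed_eq (by fun_prop) (by fun_prop)
    · intro c
      rw [leftL_π, leftL_π, leftL_π, mul_assoc]
  smul_zero a := map_zero (X.leftL p a)
  smul_add a x y := map_add (X.leftL p a) x y
  add_smul a b x := by
    change X.leftL p (a + b) x = X.leftL p a x + X.leftL p b x
    rw [map_add]; rfl
  zero_smul x := by
    change X.leftL p 0 x = 0
    rw [map_zero]; rfl

theorem smul_def (p : S) (a : A) (x : X.Fibre p) : a • x = X.leftL p a x := rfl

instance (p : S) : Module Aᵐᵒᵖ (X.Fibre p) where
  smul a x := X.rightL p x a.unop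
  one_smul x := by
    change X.rightL p x 1 = x
    refine X.fibre_induction (P := fun x => X.rightL p x 1 = x) x ?_ ?_
    · exact isClosed_eq (by fun_prop) (by fun_prop)
    · intro a
      rw [rightL_π, map_one, mul_one]
  mul_smul a b x := by
    change X.rightL p x (b.unop * a.unop) = X.rightL p (X.rightL p x b.unop) a.unop
    refine X.fibre_induction
      (P := fun x => X.rightL p x (b.unop * a.unop) = X.rightL p (X.rightL p x b.unop) a.unop) x ?_ ?_
    · exact isClosed_eq (by fun_prop) (by fun_prop)
    · intro c
      rw [rightL_π, rightL_π, rightL_π, map_mul (X.α p), mul_assoc]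
  smul_zero a := by
    change X.rightL p 0 a.unop = 0
    rw [map_zero]; rfl
  smul_add a x y := by
    change X.rightL p (x + y) a.unop = X.rightL p x a.unop + X.rightL p y a.unop
    rw [map_add]; rfl
  add_smul a b x := map_add (X.rightL p x) a.unop b.unop
  zero_smul x := map_zero (X.rightL p x)

theorem op_smul_def (p : S) (a : A) (x : X.Fibre p) : MulOpposite.op a • x = X.rightL p x a := rfl

instance (p : S) : RightHilbertBimodule A (X.Fibre p) where
  inner x y := X.innerL p x y
  inner_add_right x y z := map_add _ y z
  inner_smul_right x c y := map_smul _ c y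
  star_inner := (X.preHilbert p).star_innerL
  isPos_inner_self := (X.preHilbert p).isPos_innerL
  norm_sq_eq := (X.preHilbert p).norm_innerL_self
  inner_op_smul_right x y a := by
    rw [op_smul_def]
    refine X.fibre_induction (P := fun x => X.innerL p x (X.rightL p y a) = X.innerL p x y * a)
      x ?_ fun b => ?_
    · exact isClosed_eq (by fun_prop) (by fun_prop)
    refine X.fibre_induction
      (P := fun y => X.innerL p (X.π p b) (X.rightL p y a) = X.innerL p (X.π p b) y * a) y ?_ fun c => ?_
    · exact isClosed_eq (by fun_prop) (by fun_prop)
    rw [rightL_π, innerL_π, innerL_π, ← mul_assoc, L_mul_α]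
  inner_smul_eq x y a := by
    rw [smul_def, smul_def]
    refine X.fibre_induction
      (P := fun x => X.innerL p x (X.leftL p a y) = X.innerL p (X.leftL p (star a) x) y) x ?_ fun b => ?_
    · exact isClosed_eq (by fun_prop) (by fun_prop)
    refine X.fibre_induction
      (P := fun y => X.innerL p (X.π p b) (X.leftL p a y) =
        X.innerL p (X.leftL p (star a) (X.π p b)) y) y ?_ fun c => ?_
    · exact isClosed_eq (by fun_prop) (by fun_prop)
    rw [leftL_π, leftL_π, innerL_π, innerL_π, star_mul, star_star, mul_assoc]
  smul_op_smul c a x := map_smul (X.rightL p x) c a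
  smul_smul_left c a x := by
    rw [smul_def, smul_def, map_smul]; rfl

theorem inner_def (p : S) (x y : X.Fibre p) :
    RightHilbertBimodule.inner (A := A) x y = X.innerL p x y := rfl

theorem norm_π_one (a : A) : ‖X.π 1 a‖ = ‖a‖ := by
  rw [← sq_eq_sq₀ (norm_nonneg _) (norm_nonneg _), norm_π_sq, X.L_one,
    CStarRing.norm_star_mul_self, sq]

theorem bijective_π_one : Function.Bijective (X.π 1) := by
  have hiso : Isometry (X.π 1) := AddMonoidHomClass.isometry_of_norm _ X.norm_π_one
  refine ⟨hiso.injective, ?_⟩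
  rw [← Set.range_eq_univ, ← hiso.isClosedEmbedding.isClosed_range.closure_eq]
  exact (X.denseRange_π 1).closure_range

/-- The product system of right-Hilbert `A`-bimodules over `S` with fibres the `M_p` and with the
product `π_p(a) π_q(b) = π_{pq}(a α_p(b))`. -/
def productSystem : ProductSystem.{u, v, u} A S where
  fibre := X.Fibre
  mul h x y := X.mulL h x y
  mul_assoc {p q r s t k} h₁ h₂ h₃ h₄ x y z := by
    refine X.fibre_induction
      (P := fun x => X.mulL h₂ (X.mulL h₁ x y) z = X.mulL h₄ x (X.mulL h₃ y z)) x ?_ fun a => ?_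
    · exact isClosed_eq (by fun_prop) (by fun_prop)
    refine X.fibre_induction
      (P := fun y => X.mulL h₂ (X.mulL h₁ (X.π p a) y) z =
        X.mulL h₄ (X.π p a) (X.mulL h₃ y z)) y ?_ fun b => ?_
    · exact isClosed_eq (by fun_prop) (by fun_prop)
    refine X.fibre_induction
      (P := fun z => X.mulL h₂ (X.mulL h₁ (X.π p a) (X.π q b)) z =
        X.mulL h₄ (X.π p a) (X.mulL h₃ (X.π q b) z)) z ?_ fun c => ?_
    · exact isClosed_eq (by fun_prop) (by fun_prop)
    rw [mulL_π, mulL_π, mulL_π, mulL_π, map_mul (X.α p), ← X.α_mul, h₁, mul_assoc]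
  add_mul h x x' y := by rw [map_add]; rfl
  mul_add h x y y' := map_add _ y y'
  smul_mul h c x y := by rw [map_smul]; rfl
  mul_smul h c x y := map_smul _ c y
  inner_mul_mul {p q r} h x x' y y' := by
    rw [inner_def, inner_def, inner_def, smul_def]
    refine X.fibre_induction
      (P := fun x => X.innerL r (X.mulL h x y) (X.mulL h x' y') =
        X.innerL q y (X.leftL q (X.innerL p x x') y')) x ?_ fun a => ?_
    · exact isClosed_eq (by fun_prop) (by fun_prop)
    refine X.fibre_induction
      (P := fun x' => X.innerL r (X.mulL h (X.π p a) y) (X.mulL h x' y') =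
        X.innerL q y (X.leftL q (X.innerL p (X.π p a) x') y')) x' ?_ fun a' => ?_
    · exact isClosed_eq (by fun_prop) (by fun_prop)
    refine X.fibre_induction
      (P := fun y => X.innerL r (X.mulL h (X.π p a) y) (X.mulL h (X.π p a') y') =
        X.innerL q y (X.leftL q (X.innerL p (X.π p a) (X.π p a')) y')) y ?_ fun b => ?_
    · exact isClosed_eq (by fun_prop) (by fun_prop)
    refine X.fibre_induction
      (P := fun y' => X.innerL r (X.mulL h (X.π p a) (X.π q b)) (X.mulL h (X.π p a') y') =
        X.innerL q (X.π q b) (X.leftL q (X.innerL p (X.π p a) (X.π p a')) y')) y' ?_ fun b' => ?_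
    · exact isClosed_eq (by fun_prop) (by fun_prop)
    subst h
    rw [mulL_π, mulL_π, innerL_π, innerL_π, leftL_π, innerL_π, X.L_mul, star_mul,
      ← map_star (X.α p),
      mul_assoc, X.L_α_mul, ← mul_assoc (star a), X.L_mul_α]
  dense_span_mul {p q r} h _ := by
    refine (X.denseRange_π r).mono ?_
    rintro _ ⟨a, rfl⟩
    refine Submodule.subset_span ⟨X.π p a, X.π q 1, ?_⟩
    rw [mulL_π, map_one, mul_one]
  unit := LinearEquiv.ofBijective (X.π 1) X.bijective_π_one
  inner_unit a b := by
    rw [inner_def]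
    exact (X.innerL_π 1 a b).trans (X.L_one _)
  smul_unit a b := X.leftL_π 1 a b
  op_smul_unit a b := (X.rightL_π 1 a b).trans (by rw [X.α_one]; rfl)
  unit_mul {p} h a x := by
    change X.mulL h (X.π 1 a) x = X.leftL p a x
    refine X.fibre_induction (P := fun x => X.mulL h (X.π 1 a) x = X.leftL p a x) x ?_ fun b => ?_
    · exact isClosed_eq (by fun_prop) (by fun_prop)
    rw [mulL_π, leftL_π, X.α_one]
  mul_unit {p} h a x := by
    change X.mulL h x (X.π 1 a) = X.rightL p x a
    refine X.fibre_induction (P := fun x => X.mulL h x (X.π 1 a) = X.rightL p x a) x ?_ fun b => ?_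
    · exact isClosed_eq (by fun_prop) (by fun_prop)
    rw [mulL_π, rightL_π]

end ExelLarsenSystem


/-! ### Compact operators -/

namespace RightHilbertBimodule

variable {A : Type u} [CStarAlgebra A] {E : Type w} [NormedAddCommGroup E] [NormedSpace ℂ E]
  [CompleteSpace E] [Module A E] [Module Aᵐᵒᵖ E] [RightHilbertBimodule A E]

variable (A) in
theorem inner_add_left (x y z : E) :
    inner (A := A) (x + y) z = inner x z + inner y z := by
  rw [← star_inner, inner_add_right, star_add, star_inner, star_inner]

variable (A) in
theorem inner_smul_left (c : ℂ) (x y : E) :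
    inner (A := A) (c • x) y = starRingEnd ℂ c • inner x y := by
  rw [← star_inner, inner_smul_right, star_smul, star_inner]; rfl

variable (A) in
/-- The inner product of a right-Hilbert bimodule as a positive semidefinite form. -/
def preHilbert : PreHilbert E A where
  ip := LinearMap.mk₂'ₛₗ (starRingEnd ℂ) (RingHom.id ℂ) (fun x y => inner x y)
    (inner_add_left A) (inner_smul_left A) inner_add_right (fun c x y => inner_smul_right x c y)
  star_ip := star_inner
  pos := isPos_inner_self
  act x y := ⟨MulOpposite.op (inner x y) • x, fun w => inner_op_smul_right w x _⟩

theorem norm_inner_le (x y : E) : ‖inner (A := A) x y‖ ≤ ‖x‖ * ‖y‖ := by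
  have h : ∀ z : E, (preHilbert A).nrm z = ‖z‖ := fun z => by
    rw [← sq_eq_sq₀ (PreHilbert.nrm_nonneg _ _) (norm_nonneg _), PreHilbert.nrm_sq,
      norm_sq_eq (A := A)]; rfl
  have := (preHilbert A).norm_ip_le x y
  rwa [h, h] at this

theorem norm_op_smul_le (x : E) (a : A) : ‖MulOpposite.op a • x‖ ≤ ‖x‖ * ‖a‖ := by
  refine le_of_sq_le_sq ?_ (by positivity)
  have h1 : inner (MulOpposite.op a • x) (MulOpposite.op a • x) = star a * inner x x * a := by
    rw [inner_op_smul_right, ← star_inner, inner_op_smul_right, star_mul, star_inner]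
  rw [norm_sq_eq (A := A), h1, mul_pow, norm_sq_eq (A := A) x]
  refine (norm_mul_le _ _).trans ?_
  have := norm_mul_le (star a) (inner x x)
  rw [norm_star] at this
  nlinarith [norm_nonneg a]

theorem norm_smul_le' (a : A) (x : E) : ‖a • x‖ ≤ ‖a‖ * ‖x‖ := by
  refine le_of_sq_le_sq ?_ (by positivity)
  obtain ⟨c, hc⟩ := isPos_norm_smul_sub (1 : A) a
  have h1 : inner (A := A) (a • x) (a • x) = inner x ((star a * a) • x) := by
    rw [mul_smul, inner_smul_eq _ (a • x), star_star]
  have h2 : inner (A := A) (c • x) (c • x) = inner x ((star c * c) • x) := by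
    rw [mul_smul, inner_smul_eq _ (c • x), star_star]
  have h3 : inner (A := A) (c • x) (c • x) =
      ((‖a‖ ^ 2 : ℝ) : ℂ) • inner x x - inner (A := A) (a • x) (a • x) := by
    rw [h1, h2, ← hc, sub_smul, sub_eq_add_neg, inner_add_right, ← neg_one_smul ℂ, inner_smul_right,
      ← Complex.coe_smul, smul_smul_left]
    simp [inner_smul_right, sub_eq_add_neg]
  rw [mul_pow, norm_sq_eq (A := A), norm_sq_eq (A := A) x]
  have h4 : ‖((‖a‖ ^ 2 : ℝ) : ℂ) • inner (A := A) x x‖ = ‖a‖ ^ 2 * ‖inner (A := A) x x‖ := by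
    rw [norm_smul, Complex.norm_real, Real.norm_of_nonneg (sq_nonneg _)]
  rw [← h4]
  refine norm_le_of_isPos_sub (isPos_inner_self _) ?_
  rw [← h3]
  exact isPos_inner_self _

variable (A) in
/-- The operator `Θ_{ξ,η}`, `μ ↦ ξ · ⟨η, μ⟩`. -/
def theta (ξ η : E) : E →L[ℂ] E :=
  LinearMap.mkContinuous
    { toFun := fun μ => MulOpposite.op (inner (A := A) η μ) • ξ
      map_add' := fun x y => by rw [inner_add_right, MulOpposite.op_add, add_smul]
      map_smul' := fun c x => by rw [inner_smul_right, smul_op_smul, RingHom.id_apply] }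
    (‖ξ‖ * ‖η‖) fun μ => by
      refine (norm_op_smul_le ξ _).trans ?_
      rw [mul_assoc]
      exact mul_le_mul_of_nonneg_left (norm_inner_le η μ) (norm_nonneg ξ)

theorem theta_apply (ξ η μ : E) :
    theta A ξ η μ = MulOpposite.op (inner (A := A) η μ) • ξ := rfl

variable (A) in
/-- `T'` is the adjoint of `T`. -/
def IsAdjoint (T T' : E →L[ℂ] E) : Prop :=
  ∀ x y, inner (A := A) (T x) y = inner x (T' y)

theorem IsAdjoint.symm {T T' : E →L[ℂ] E} (h : IsAdjoint A T T') : IsAdjoint A T' T := fun x y => by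
  rw [← star_inner, ← h, star_inner]

theorem IsAdjoint.comp {T T' S S' : E →L[ℂ] E} (h : IsAdjoint A T T') (h' : IsAdjoint A S S') :
    IsAdjoint A (T * S) (S' * T') := fun _ _ => (h _ _).trans (h' _ _)

theorem IsAdjoint.norm_le {T T' : E →L[ℂ] E} (h : IsAdjoint A T T') : ‖T'‖ ≤ ‖T‖ := by
  refine T'.opNorm_le_bound (norm_nonneg _) fun y => ?_
  have h1 : ‖T' y‖ ^ 2 ≤ ‖T‖ * ‖T' y‖ * ‖y‖ := by
    rw [norm_sq_eq (A := A), ← h]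
    exact (norm_inner_le _ _).trans (mul_le_mul_of_nonneg_right (T.le_opNorm _) (norm_nonneg _))
  rcases (norm_nonneg (T' y)).eq_or_lt with h0 | h0
  · rw [← h0]; positivity
  · nlinarith

theorem isAdjoint_theta (ξ η : E) : IsAdjoint A (theta A ξ η) (theta A η ξ) := fun x y => by
  rw [theta_apply, theta_apply, inner_op_smul_right, ← star_inner, inner_op_smul_right, star_mul,
    star_inner, star_inner]

variable (A E) in
/-- Finite sums of the operators `Θ_{ξ,η}`, parametrized by formal sums of pairs. -/
def finiteRank : (E × E →₀ ℂ) →ₗ[ℂ] E →L[ℂ] E :=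
  Finsupp.linearCombination ℂ fun z => theta A z.1 z.2

variable (A E) in
/-- The space `K(E)` of generalised compact operators: the closed linear span of the `Θ_{ξ,η}` in the
operator norm. -/
def compacts : Submodule ℂ (E →L[ℂ] E) :=
  (Submodule.span ℂ {T | ∃ ξ η : E, T = theta A ξ η}).topologicalClosure

instance : IsBoundedSMul ℂ (compacts A E) :=
  IsBoundedSMul.of_norm_smul_le fun c T => norm_smul_le c (T : E →L[ℂ] E)

theorem theta_mem_compacts (ξ η : E) : theta A ξ η ∈ compacts A E :=
  Submodule.le_topologicalClosure _ (Submodule.subset_span ⟨ξ, η, rfl⟩)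

theorem range_finiteRank :
    LinearMap.range (finiteRank A E) = Submodule.span ℂ {T | ∃ ξ η : E, T = theta A ξ η} := by
  rw [finiteRank, Finsupp.range_linearCombination]
  congr 1
  ext T
  constructor
  · rintro ⟨z, rfl⟩
    exact ⟨z.1, z.2, rfl⟩
  · rintro ⟨ξ, η, rfl⟩
    exact ⟨(ξ, η), rfl⟩

theorem finiteRank_mem_compacts (v : E × E →₀ ℂ) : finiteRank A E v ∈ compacts A E := by
  refine Submodule.le_topologicalClosure _ ?_
  rw [← range_finiteRank]
  exact ⟨v, rfl⟩

variable (A E) in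
/-- `finiteRank` with values in `K(E)`. -/
def finiteRankK : (E × E →₀ ℂ) →ₗ[ℂ] compacts A E :=
  (finiteRank A E).codRestrict _ finiteRank_mem_compacts

theorem denseRange_finiteRankK : DenseRange (finiteRankK A E) := by
  rw [DenseRange, Subtype.dense_iff]
  intro T hT
  have h1 : (Subtype.val '' Set.range (finiteRankK A E)) =
      (Submodule.span ℂ {T | ∃ ξ η : E, T = theta A ξ η} : Set (E →L[ℂ] E)) := by
    rw [← range_finiteRank, ← Set.range_comp]; rfl
  have h2 : T ∈ closure (Submodule.span ℂ {T | ∃ ξ η : E, T = theta A ξ η} : Set (E →L[ℂ] E)) := hT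
  rw [← h1] at h2
  exact h2

theorem exists_isAdjoint_finiteRank (v : E × E →₀ ℂ) :
    ∃ v', IsAdjoint A (finiteRank A E v) (finiteRank A E v') := by
  induction v using Finsupp.induction_linear with
  | zero => exact ⟨0, fun x y => by
      have h1 := inner_smul_left A 0 (0 : E) y
      have h2 := inner_smul_right (A := A) x 0 (0 : E)
      simp only [zero_smul, map_zero] at h1 h2
      simp [h1, h2]⟩
  | add v w hv hw =>
    obtain ⟨v', hv⟩ := hv
    obtain ⟨w', hw⟩ := hw
    refine ⟨v' + w', fun x y => ?_⟩
    rw [map_add, map_add, add_apply, add_apply,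
      inner_add_left, inner_add_right, hv, hw]
  | single z c =>
    refine ⟨Finsupp.single (z.2, z.1) (starRingEnd ℂ c), fun x y => ?_⟩
    simp only [finiteRank, Finsupp.linearCombination_single, smul_apply]
    rw [inner_smul_left, inner_smul_right, isAdjoint_theta]

end RightHilbertBimodule

/-! ### The homomorphisms `ι`, representations, Nica covariance -/

theorem le_of_forall_pow_le {a r C : ℝ} (hr : 0 ≤ r)
    (h : ∀ n : ℕ, a ^ 2 ^ n ≤ C * r ^ 2 ^ n) : a ≤ r := by
  by_contra! hlt
  rcases hr.eq_or_lt with h0 | h0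
  · have h1 := h 0
    rw [← h0] at h1 hlt
    norm_num at h1
    linarith
  · have h1 : 1 < a / r := (one_lt_div h0).2 hlt
    obtain ⟨n, hn⟩ := pow_unbounded_of_one_lt C h1
    have h2 : (a / r) ^ n ≤ (a / r) ^ 2 ^ n := pow_le_pow_right₀ h1.le Nat.lt_two_pow_self.le
    have h3 := h n
    rw [div_pow _ _ (2 ^ n)] at h2
    have h4 : a ^ 2 ^ n / r ^ 2 ^ n ≤ C := (div_le_iff₀ (by positivity)).2 h3
    linarith

namespace ProductSystem

open RightHilbertBimodule

variable {A : Type u} [CStarAlgebra A] {S : Type v} [Monoid S] (M : ProductSystem.{u, v, w} A S)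

theorem norm_mul_le {p q r : S} (h : p * q = r) (x : M.fibre p) (y : M.fibre q) :
    ‖M.mul h x y‖ ≤ ‖x‖ * ‖y‖ := by
  refine le_of_sq_le_sq ?_ (by positivity)
  rw [norm_sq_eq (A := A), inner_mul_mul, mul_pow, norm_sq_eq (A := A) x]
  refine (norm_inner_le _ _).trans ?_
  have := norm_smul_le' (inner (A := A) x x) y
  nlinarith [norm_nonneg y]

/-- The map `∑ c_i (ξ_i, η_i) ↦ ∑ c_i T(ξ_i) η_i`. -/
def preIota {p q r : S} (h : p * q = r) (T : M.fibre p →L[ℂ] M.fibre p) :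
    (M.fibre p × M.fibre q →₀ ℂ) →ₗ[ℂ] M.fibre r :=
  Finsupp.linearCombination ℂ fun z => M.mul h (T z.1) z.2

theorem preIota_single {p q r : S} (h : p * q = r) (T : M.fibre p →L[ℂ] M.fibre p)
    (z : M.fibre p × M.fibre q) (c : ℂ) :
    M.preIota h T (Finsupp.single z c) = c • M.mul h (T z.1) z.2 := by
  simp [preIota]

/-- The operator `ι_p^r(T)` on `M_r`, `r = p q`, for an (adjointable) operator `T` on `M_p`: the
continuous linear operator with `ι_p^r(T)(ξ η) = T(ξ) η` for `ξ ∈ M_p`, `η ∈ M_q`. -/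
def iota {p q r : S} (h : p * q = r) (T : M.fibre p →L[ℂ] M.fibre p) :
    M.fibre r →L[ℂ] M.fibre r :=
  (M.preIota h T).extendOfNorm (M.preIota h (ContinuousLinearMap.id ℂ (M.fibre p)))

theorem denseRange_preIota {p q r : S} (h : p * q = r) :
    DenseRange (M.preIota h (ContinuousLinearMap.id ℂ (M.fibre p))) := by
  have hd : Dense (Submodule.span ℂ {z : M.fibre r | ∃ x y, z = M.mul h x y} : Set (M.fibre r)) := by
    by_cases hp : p = 1
    · subst hp
      obtain rfl : q = r := by rw [← h, one_mul]
      refine dense_univ.mono fun z _ => Submodule.subset_span ⟨M.unit 1, z, ?_⟩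
      rw [M.unit_mul h, one_smul]
    · exact M.dense_span_mul h hp
  refine hd.mono ?_
  change (_ : Set (M.fibre r)) ⊆
    (LinearMap.range (M.preIota h (ContinuousLinearMap.id ℂ (M.fibre p))) : Set (M.fibre r))
  rw [SetLike.coe_subset_coe, Submodule.span_le]
  rintro _ ⟨x, y, rfl⟩
  exact ⟨Finsupp.single (x, y) 1, by rw [preIota_single]; simp⟩

theorem inner_preIota {p q r : S} (h : p * q = r) {T T' : M.fibre p →L[ℂ] M.fibre p}
    (hT : IsAdjoint A T T') (R : M.fibre p →L[ℂ] M.fibre p) (v w : M.fibre p × M.fibre q →₀ ℂ) :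
    inner (A := A) (M.preIota h (T * R) v) (M.preIota h 1 w) =
      inner (A := A) (M.preIota h R v) (M.preIota h T' w) := by
  have h0 : ∀ {k : S} (x : M.fibre k), inner (A := A) x 0 = 0 := fun x =>
    map_zero ((RightHilbertBimodule.preHilbert A (E := M.fibre _)).ip x)
  have h0' : ∀ {k : S} (x : M.fibre k), inner (A := A) 0 x = 0 := fun x =>
    LinearMap.congr_fun (map_zero (RightHilbertBimodule.preHilbert A (E := M.fibre _)).ip) x
  induction v using Finsupp.induction_linear with
  | zero => rw [map_zero, map_zero, h0', h0']
  | add v v' hv hv' => rw [map_add, map_add, RightHilbertBimodule.inner_add_left, RightHilbertBimodule.inner_add_left, hv, hv']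
  | single z c =>
    induction w using Finsupp.induction_linear with
    | zero => rw [map_zero, map_zero, h0, h0]
    | add v v' hv hv' => rw [map_add, map_add, RightHilbertBimodule.inner_add_right, RightHilbertBimodule.inner_add_right, hv, hv']
    | single z' c' =>
      rw [preIota_single, preIota_single, preIota_single, preIota_single, RightHilbertBimodule.inner_smul_right,
        RightHilbertBimodule.inner_smul_right, RightHilbertBimodule.inner_smul_left, RightHilbertBimodule.inner_smul_left, inner_mul_mul, inner_mul_mul]
      change _ • _ • inner z.2 (inner (T (R z.1)) z'.1 • z'.2) = _
      rw [hT]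

theorem norm_preIota_pow_le {p q r : S} (h : p * q = r) (T : M.fibre p →L[ℂ] M.fibre p)
    (v : M.fibre p × M.fibre q →₀ ℂ) : ∃ C, 0 ≤ C ∧ ∀ n, ‖M.preIota h (T ^ n) v‖ ≤ C * ‖T‖ ^ n := by
  induction v using Finsupp.induction_linear with
  | zero => exact ⟨0, le_rfl, fun n => by simp⟩
  | add v w hv hw =>
    obtain ⟨C, hC0, hC⟩ := hv
    obtain ⟨D, hD0, hD⟩ := hw
    refine ⟨C + D, by positivity, fun n => ?_⟩
    rw [map_add, _root_.add_mul]
    exact (norm_add_le _ _).trans (add_le_add (hC n) (hD n))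
  | single z c =>
    refine ⟨‖c‖ * ‖z.1‖ * ‖z.2‖, by positivity, fun n => ?_⟩
    rw [preIota_single, norm_smul]
    have h1 := M.norm_mul_le h ((T ^ n) z.1) z.2
    have h2 : ‖(T ^ n) z.1‖ ≤ ‖T‖ ^ n * ‖z.1‖ := by
      induction n with
      | zero => simp
      | succ k ih =>
        rw [pow_succ', pow_succ', _root_.mul_assoc]
        refine (T.le_opNorm ((T ^ k) z.1)).trans ?_
        have := M.norm_mul_le h ((T ^ k) z.1) z.2
        exact mul_le_mul_of_nonneg_left (ih this) (norm_nonneg _)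
    calc ‖c‖ * ‖M.mul h ((T ^ n) z.1) z.2‖ ≤ ‖c‖ * (‖T‖ ^ n * ‖z.1‖ * ‖z.2‖) := by
          refine mul_le_mul_of_nonneg_left (h1.trans ?_) (norm_nonneg c)
          exact mul_le_mul_of_nonneg_right h2 (norm_nonneg _)
      _ = _ := by ring

theorem norm_preIota_le {p q r : S} (h : p * q = r) {T T' : M.fibre p →L[ℂ] M.fibre p}
    (hT : IsAdjoint A T T') (v : M.fibre p × M.fibre q →₀ ℂ) :
    ‖M.preIota h T v‖ ≤ ‖T‖ * ‖M.preIota h 1 v‖ := by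
  set N := ‖M.preIota h 1 v‖ with hN
  have hstep : ∀ {R R' : M.fibre p →L[ℂ] M.fibre p}, IsAdjoint A R R' →
      ‖M.preIota h R v‖ ^ 2 ≤ N * ‖M.preIota h (R' * R) v‖ := by
    intro R R' hR
    rw [norm_sq_eq (A := A), ← M.inner_preIota h hR.symm R v v, mul_comm]
    exact norm_inner_le _ _
  have hS : IsAdjoint A (T' * T) (T' * T) := hT.symm.comp hT
  have hSn : ∀ n : ℕ, IsAdjoint A ((T' * T) ^ n) ((T' * T) ^ n) := by
    intro n
    induction n with
    | zero => exact fun x y => rfl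
    | succ n ih =>
      have := ih.comp hS
      rwa [← pow_succ, ← pow_succ'] at this
  have hN0 : 0 ≤ N := norm_nonneg _
  have h1 : ‖M.preIota h (T' * T) v‖ ≤ N * ‖T' * T‖ := by
    rcases hN0.eq_or_lt with h0 | h0
    · have := hstep hS
      rw [← h0, zero_mul] at this
      rw [← h0, zero_mul]
      nlinarith [norm_nonneg (M.preIota h (T' * T) v)]
    · obtain ⟨C, hC0, hC⟩ := M.norm_preIota_pow_le h (T' * T) v
      refine le_of_forall_pow_le (C := C / N) (by positivity) fun n => ?_
      have key : ‖M.preIota h (T' * T) v‖ ^ 2 ^ n * N ≤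
          N ^ 2 ^ n * ‖M.preIota h ((T' * T) ^ 2 ^ n) v‖ := by
        induction n with
        | zero => simp [mul_comm]
        | succ n ih =>
          have h2 := hstep (hSn (2 ^ n))
          rw [← pow_add, ← two_mul, ← pow_succ'] at h2
          set f := ‖M.preIota h ((T' * T) ^ 2 ^ n) v‖
          set f' := ‖M.preIota h ((T' * T) ^ 2 ^ (n + 1)) v‖
          set g := ‖M.preIota h (T' * T) v‖
          have h3 : (g ^ 2 ^ n * N) ^ 2 ≤ (N ^ 2 ^ n * f) ^ 2 :=
            pow_le_pow_left₀ (by positivity) ih 2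
          have h4 : (N ^ 2 ^ n) ^ 2 * f ^ 2 ≤ (N ^ 2 ^ n) ^ 2 * (N * f') :=
            mul_le_mul_of_nonneg_left h2 (by positivity)
          have e1 : g ^ 2 ^ (n + 1) = (g ^ 2 ^ n) ^ 2 := by rw [← pow_mul, pow_succ]
          have e2 : N ^ 2 ^ (n + 1) = (N ^ 2 ^ n) ^ 2 := by rw [← pow_mul, pow_succ]
          rw [e1, e2]
          rw [mul_pow, mul_pow] at h3
          refine le_of_mul_le_mul_right ?_ h0
          nlinarith
      have h5 := hC (2 ^ n)
      rw [mul_pow, div_mul_eq_mul_div, le_div_iff₀ h0]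
      refine key.trans ?_
      calc N ^ 2 ^ n * ‖M.preIota h ((T' * T) ^ 2 ^ n) v‖ ≤ N ^ 2 ^ n * (C * ‖T' * T‖ ^ 2 ^ n) :=
            mul_le_mul_of_nonneg_left h5 (by positivity)
        _ = _ := by ring
  refine le_of_sq_le_sq ?_ (by positivity)
  have h2 : ‖T' * T‖ ≤ ‖T‖ * ‖T‖ :=
    (_root_.norm_mul_le _ _).trans (mul_le_mul_of_nonneg_right hT.norm_le (norm_nonneg _))
  calc ‖M.preIota h T v‖ ^ 2 ≤ N * (N * (‖T‖ * ‖T‖)) :=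
        (hstep hT).trans (mul_le_mul_of_nonneg_left
          (h1.trans (mul_le_mul_of_nonneg_left h2 hN0)) hN0)
    _ = (‖T‖ * N) ^ 2 := by ring

theorem norm_preIota_compacts_le {p q r : S} (h : p * q = r) {T : M.fibre p →L[ℂ] M.fibre p}
    (hT : T ∈ compacts A (M.fibre p)) (v : M.fibre p × M.fibre q →₀ ℂ) :
    ‖M.preIota h T v‖ ≤ ‖T‖ * ‖M.preIota h 1 v‖ := by
  have hcont : Continuous fun R : M.fibre p →L[ℂ] M.fibre p => M.preIota h R v := by
    have hm : ∀ y : M.fibre q, Continuous fun x : M.fibre p => M.mul h x y := fun y =>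
      (LinearMap.mkContinuous
        ({ toFun := fun x => M.mul h x y
           map_add' := fun x x' => M.add_mul h x x' y
           map_smul' := fun c x => M.smul_mul h c x y } : M.fibre p →ₗ[ℂ] M.fibre r) ‖y‖ fun x => by
            rw [mul_comm]; exact M.norm_mul_le h x y).continuous
    induction v using Finsupp.induction_linear with
    | zero => simp only [map_zero]; exact continuous_const
    | add v w hv hw => simp only [map_add]; exact hv.add hw
    | single z c =>
      simp only [preIota_single]
      exact ((hm z.2).comp (by fun_prop)).const_smul c
  have hcl : IsClosed {R : M.fibre p →L[ℂ] M.fibre p | ‖M.preIota h R v‖ ≤ ‖R‖ * ‖M.preIota h 1 v‖} :=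
    isClosed_le hcont.norm (continuous_norm.mul continuous_const)
  refine hcl.closure_subset_iff.2 ?_ hT
  rw [← range_finiteRank]
  rintro _ ⟨z, rfl⟩
  obtain ⟨z', hz⟩ := exists_isAdjoint_finiteRank (A := A) z
  exact M.norm_preIota_le h hz v

theorem iota_mul_of_isAdjoint {p q r : S} (h : p * q = r) {T T' : M.fibre p →L[ℂ] M.fibre p}
    (hT : IsAdjoint A T T') (x : M.fibre p) (y : M.fibre q) :
    M.iota h T (M.mul h x y) = M.mul h (T x) y := by
  have h1 := LinearMap.extendOfNorm_eq (M.denseRange_preIota h)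
    (f := M.preIota h T) ⟨‖T‖, M.norm_preIota_le h hT⟩ (Finsupp.single (x, y) 1)
  rw [preIota_single, preIota_single, one_smul, one_smul] at h1
  exact h1

theorem iota_mul {p q r : S} (h : p * q = r) {T : M.fibre p →L[ℂ] M.fibre p}
    (hT : T ∈ compacts A (M.fibre p)) (x : M.fibre p) (y : M.fibre q) :
    M.iota h T (M.mul h x y) = M.mul h (T x) y := by
  have h1 := LinearMap.extendOfNorm_eq (M.denseRange_preIota h)
    (f := M.preIota h T) ⟨‖T‖, M.norm_preIota_compacts_le h hT⟩ (Finsupp.single (x, y) 1)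
  rw [preIota_single, preIota_single, one_smul, one_smul] at h1
  exact h1

end ProductSystem


namespace ProductSystem

open RightHilbertBimodule

variable {A : Type u} [CStarAlgebra A] {S : Type v} [Monoid S] (M : ProductSystem.{u, v, w} A S)

/-- A representation of the product system `M` in the C*-algebra `B`. -/
structure IsRepresentation {B : Type*} [NonUnitalCStarAlgebra B] (ψ : ∀ p, M.fibre p → B) :
    Prop where
  map_add : ∀ p x y, ψ p (x + y) = ψ p x + ψ p y
  map_smul : ∀ p (c : ℂ) x, ψ p (c • x) = c • ψ p x
  /-- `ψ_1` is multiplicative on `A = M_1`. -/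
  map_unit_mul : ∀ a b, ψ 1 (M.unit (a * b)) = ψ 1 (M.unit a) * ψ 1 (M.unit b)
  /-- `ψ_1` preserves the involution of `A = M_1`. -/
  map_unit_star : ∀ a, ψ 1 (M.unit (star a)) = star (ψ 1 (M.unit a))
  map_mul : ∀ {p q r : S} (h : p * q = r) x y, ψ p x * ψ q y = ψ r (M.mul h x y)
  star_mul : ∀ p x y, star (ψ p x) * ψ p y = ψ 1 (M.unit (inner x y))

/-- The map `∑ c_i (ξ_i, η_i) ↦ ∑ c_i ψ_p(ξ_i) ψ_p(η_i)*`. -/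
def prePsi {B : Type*} [NonUnitalCStarAlgebra B] (ψ : ∀ p, M.fibre p → B) (p : S) :
    (M.fibre p × M.fibre p →₀ ℂ) →ₗ[ℂ] B :=
  Finsupp.linearCombination ℂ fun z => ψ p z.1 * star (ψ p z.2)

/-- The map `ψ^{(p)} : K(M_p) → B` of a representation `ψ` of `M` in `B`: the continuous linear map
with `ψ^{(p)}(Θ_{ξ,η}) = ψ_p(ξ) ψ_p(η)*`. -/
def psiK {B : Type*} [NonUnitalCStarAlgebra B] (ψ : ∀ p, M.fibre p → B) (p : S) :
    compacts A (M.fibre p) →L[ℂ] B :=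
  (M.prePsi ψ p).extendOfNorm (finiteRankK A (M.fibre p))

namespace IsRepresentation

variable {M} {B : Type*} [NonUnitalCStarAlgebra B] {ψ : ∀ p, M.fibre p → B}
  (hψ : M.IsRepresentation ψ)

theorem norm_le (hψ : M.IsRepresentation ψ) (p : S) (x : M.fibre p) : ‖ψ p x‖ ≤ ‖x‖ := by
  let f : A →⋆ₙₐ[ℂ] B :=
    { toFun := fun a => ψ 1 (M.unit a)
      map_smul' := fun c a => by simp [hψ.map_smul]
      map_zero' := by
        have := hψ.map_smul 1 0 0
        simpa using this
      map_add' := fun a b => by simp [hψ.map_add]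
      map_mul' := hψ.map_unit_mul
      map_star' := hψ.map_unit_star }
  refine le_of_sq_le_sq ?_ (norm_nonneg _)
  have h1 : ψ 1 (M.unit (inner x x)) = f (inner x x) := rfl
  rw [sq, ← CStarRing.norm_star_mul_self, hψ.star_mul, norm_sq_eq (A := A), h1]
  exact NonUnitalStarAlgHom.norm_apply_le f _

theorem prePsi_single (p : S) (z : M.fibre p × M.fibre p) (c : ℂ) :
    M.prePsi ψ p (Finsupp.single z c) = c • (ψ p z.1 * star (ψ p z.2)) := by
  simp [prePsi]

theorem prePsi_mul (hψ : M.IsRepresentation ψ) (p : S) (v : M.fibre p × M.fibre p →₀ ℂ)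
    (x : M.fibre p) : M.prePsi ψ p v * ψ p x = ψ p (finiteRank A (M.fibre p) v x) := by
  have h0 : ψ p 0 = 0 := by
    have := hψ.map_smul p 0 0
    simpa using this
  induction v using Finsupp.induction_linear with
  | zero => simp [h0]
  | add v w hv hw =>
    rw [_root_.map_add, _root_.add_mul, hv, hw, _root_.map_add, add_apply, hψ.map_add]
  | single z c =>
    rw [prePsi_single, smul_mul_assoc, _root_.mul_assoc, hψ.star_mul, hψ.map_mul (mul_one p),
      M.mul_unit, ← theta_apply, ← hψ.map_smul]
    simp [finiteRank]

theorem exists_star_prePsi (p : S) (v : M.fibre p × M.fibre p →₀ ℂ) :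
    ∃ v', IsAdjoint A (finiteRank A (M.fibre p) v) (finiteRank A (M.fibre p) v') ∧
      M.prePsi ψ p v' = star (M.prePsi ψ p v) := by
  induction v using Finsupp.induction_linear with
  | zero =>
    refine ⟨0, fun x y => ?_, by simp⟩
    have h1 := RightHilbertBimodule.inner_smul_left A 0 (0 : M.fibre p) y
    have h2 := RightHilbertBimodule.inner_smul_right (A := A) x 0 (0 : M.fibre p)
    simp only [zero_smul, map_zero] at h1 h2
    simp [h1, h2]
  | add v w hv hw =>
    obtain ⟨v', hv, hv'⟩ := hv
    obtain ⟨w', hw, hw'⟩ := hw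
    refine ⟨v' + w', fun x y => ?_, by rw [_root_.map_add, _root_.map_add, star_add, hv', hw']⟩
    rw [_root_.map_add, _root_.map_add, add_apply, add_apply, RightHilbertBimodule.inner_add_left,
      RightHilbertBimodule.inner_add_right, hv, hw]
  | single z c =>
    refine ⟨Finsupp.single (z.2, z.1) (starRingEnd ℂ c), fun x y => ?_, ?_⟩
    · simp only [finiteRank, Finsupp.linearCombination_single, smul_apply]
      rw [RightHilbertBimodule.inner_smul_left, RightHilbertBimodule.inner_smul_right,
        isAdjoint_theta]
    · rw [prePsi_single, prePsi_single, star_smul, StarMul.star_mul, star_star]; rfl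

theorem norm_prePsi_le (hψ : M.IsRepresentation ψ) (p : S) (v : M.fibre p × M.fibre p →₀ ℂ) :
    ‖M.prePsi ψ p v‖ ≤ ‖finiteRank A (M.fibre p) v‖ := by
  obtain ⟨v', hadj, hstar⟩ := exists_star_prePsi (ψ := ψ) p v
  set T := finiteRank A (M.fibre p) v
  set T' := finiteRank A (M.fibre p) v'
  set b : Unitization ℂ B := ((star (M.prePsi ψ p v) * M.prePsi ψ p v : B) : Unitization ℂ B)
    with hb
  have hbn : ∀ (n : ℕ) x, b ^ n * (ψ p x : Unitization ℂ B) = (ψ p (((T' * T) ^ n) x) : B) := by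
    intro n
    induction n with
    | zero => intro x; rw [pow_zero, one_mul]; rfl
    | succ n ih =>
      intro x
      rw [pow_succ, _root_.mul_assoc, hb, ← Unitization.inr_mul, _root_.mul_assoc, hψ.prePsi_mul,
        ← hstar, hψ.prePsi_mul, hstar, ← hb, ih]
      rfl
  have hbound : ∀ w : M.fibre p × M.fibre p →₀ ℂ, ∃ C, 0 ≤ C ∧ ∀ n : ℕ,
      ‖b ^ n * (M.prePsi ψ p w : Unitization ℂ B)‖ ≤ C * ‖T' * T‖ ^ n := by
    intro w
    induction w using Finsupp.induction_linear with
    | zero => exact ⟨0, le_rfl, fun n => by simp⟩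
    | add v w hv hw =>
      obtain ⟨C, hC0, hC⟩ := hv
      obtain ⟨D, hD0, hD⟩ := hw
      refine ⟨C + D, by positivity, fun n => ?_⟩
      rw [_root_.map_add, Unitization.inr_add, _root_.mul_add, _root_.add_mul]
      exact (norm_add_le _ _).trans (add_le_add (hC n) (hD n))
    | single z c =>
      refine ⟨‖c‖ * ‖z.1‖ * ‖z.2‖, by positivity, fun n => ?_⟩
      rw [prePsi_single, Unitization.inr_smul, mul_smul_comm, norm_smul, Unitization.inr_mul,
        ← _root_.mul_assoc, hbn]
      have h1 : ‖((T' * T) ^ n) z.1‖ ≤ ‖T' * T‖ ^ n * ‖z.1‖ := by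
        clear hbn
        induction n with
        | zero => simp
        | succ k ih =>
          rw [pow_succ', pow_succ', _root_.mul_assoc ‖T' * T‖]
          exact ((T' * T).le_opNorm (((T' * T) ^ k) z.1)).trans
            (mul_le_mul_of_nonneg_left ih (norm_nonneg _))
      have h2 : ‖(star (ψ p z.2) : B)‖ ≤ ‖z.2‖ := by
        rw [norm_star]; exact hψ.norm_le p _
      calc _ ≤ ‖c‖ * (‖T' * T‖ ^ n * ‖z.1‖ * ‖z.2‖) := by
            refine mul_le_mul_of_nonneg_left ?_ (norm_nonneg c)
            refine (_root_.norm_mul_le _ _).trans ?_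
            rw [Unitization.norm_inr, Unitization.norm_inr]
            exact mul_le_mul ((hψ.norm_le p _).trans h1) h2 (norm_nonneg _) (by positivity)
        _ = _ := by ring
  have hsa : IsSelfAdjoint b := by
    rw [hb]
    exact (IsSelfAdjoint.star_mul_self _).inr ℂ
  have hnb : ‖b‖ = ‖M.prePsi ψ p v‖ ^ 2 := by
    rw [hb, Unitization.norm_inr, CStarRing.norm_star_mul_self, sq]
  have h1 : ‖b‖ ≤ ‖T' * T‖ := by
    obtain ⟨C, hC0, hC⟩ := hbound v'
    have h2 : ∀ n : ℕ, ‖b‖ ^ 2 ^ n * ‖T' * T‖ ≤ C * ‖M.prePsi ψ p v‖ * ‖T' * T‖ ^ 2 ^ n := by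
      intro n
      obtain ⟨m, hm⟩ : ∃ m, 2 ^ n = m + 1 := ⟨2 ^ n - 1, by have := Nat.one_le_two_pow (n := n); omega⟩
      rw [← hsa.norm_pow_two_pow, hm, pow_succ]
      nth_rewrite 2 [hb]
      rw [← hstar, Unitization.inr_mul, ← _root_.mul_assoc]
      have h3 := hC m
      have h4 := _root_.norm_mul_le (b ^ m * (M.prePsi ψ p v' : Unitization ℂ B))
        (M.prePsi ψ p v : Unitization ℂ B)
      rw [Unitization.norm_inr] at h4
      rw [pow_succ]
      have h5 : 0 ≤ ‖T' * T‖ := norm_nonneg _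
      have h6 : 0 ≤ ‖M.prePsi ψ p v‖ := norm_nonneg _
      calc _ ≤ (C * ‖T' * T‖ ^ m * ‖M.prePsi ψ p v‖) * ‖T' * T‖ := by gcongr; exact h4.trans (by gcongr)
        _ = _ := by ring
    rcases (norm_nonneg (T' * T)).eq_or_lt with h0 | h0
    · have h3 : ‖b ^ 1 * (M.prePsi ψ p v' : Unitization ℂ B)‖ ≤ 0 := by simpa [← h0] using hC 1
      have h4 : b * b = 0 := by
        have h5 : b ^ 1 * (M.prePsi ψ p v' : Unitization ℂ B) = 0 :=
          norm_le_zero_iff.1 h3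
        nth_rewrite 2 [hb]
        rw [← hstar, Unitization.inr_mul, ← _root_.mul_assoc, ← pow_one b, h5, zero_mul]
      have h5 := hsa.norm_pow_two_pow 1
      rw [pow_one, sq, h4, norm_zero] at h5
      rw [← h0]
      nlinarith [norm_nonneg b]
    · refine le_of_forall_pow_le (C := C * ‖M.prePsi ψ p v‖ / ‖T' * T‖) h0.le fun n => ?_
      rw [div_mul_eq_mul_div, le_div_iff₀ h0]
      exact h2 n
  refine le_of_sq_le_sq ?_ (norm_nonneg _)
  rw [← hnb]
  refine h1.trans ((_root_.norm_mul_le _ _).trans ?_)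
  rw [sq]
  exact mul_le_mul_of_nonneg_right hadj.norm_le (norm_nonneg _)

theorem psiK_theta (hψ : M.IsRepresentation ψ) (p : S) (ξ η : M.fibre p) :
    M.psiK ψ p ⟨theta A ξ η, theta_mem_compacts ξ η⟩ = ψ p ξ * star (ψ p η) := by
  have h1 := LinearMap.extendOfNorm_eq (denseRange_finiteRankK (A := A) (E := M.fibre p))
    (f := M.prePsi ψ p) ⟨1, fun v => by rw [one_mul]; exact hψ.norm_prePsi_le p v⟩
    (Finsupp.single (ξ, η) 1)
  rw [prePsi_single, one_smul] at h1
  rw [← h1, psiK]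
  congr 1
  ext1
  simp [finiteRankK, finiteRank]

end IsRepresentation

/-- `M` is compactly aligned: if `pS ∩ qS = rS`, then `ι_p^r(T) ι_q^r(T')` is compact for all compact
`T` and `T'`. -/
def IsCompactlyAligned : Prop :=
  ∀ (p q r p' q' : S) (h : p * p' = r) (h' : q * q' = r),
    Set.range (p * ·) ∩ Set.range (q * ·) = Set.range (r * ·) →
    ∀ T ∈ compacts A (M.fibre p), ∀ T' ∈ compacts A (M.fibre q),
      M.iota h T ∘L M.iota h' T' ∈ compacts A (M.fibre r)

variable {M} in
/-- Nica covariant representations of a compactly aligned product system in a C*-algebra. -/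
structure IsNicaCovariant (hM : M.IsCompactlyAligned) {B : Type*} [NonUnitalCStarAlgebra B]
    (ψ : ∀ p, M.fibre p → B) : Prop extends M.IsRepresentation ψ where
  psiK_mul : ∀ (p q r p' q' : S) (h : p * p' = r) (h' : q * q' = r)
    (hr : Set.range (p * ·) ∩ Set.range (q * ·) = Set.range (r * ·))
    (T : compacts A (M.fibre p)) (T' : compacts A (M.fibre q)),
    M.psiK ψ p T * M.psiK ψ q T' =
      M.psiK ψ r ⟨M.iota h T ∘L M.iota h' T', hM p q r p' q' h h' hr T T.2 T' T'.2⟩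
  psiK_mul_eq_zero : ∀ p q : S,
    (¬ ∃ r, Set.range (p * ·) ∩ Set.range (q * ·) = Set.range (r * ·)) →
    ∀ (T : compacts A (M.fibre p)) (T' : compacts A (M.fibre q)), M.psiK ψ p T * M.psiK ψ q T' = 0

/-- The universal unital C*-algebra generated by the elements of a Nica covariant representation of
`M`. Representations `ψ` are not required to satisfy `ψ_1(1) = 1`, so that every Nica covariant
representation in a C*-algebra `B`, unital or not, gives one in the unital C*-algebra obtained from
`B` by adjoining a unit. -/
abbrev NTUnital (hM : M.IsCompactlyAligned) : Type max v w :=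
  UnivCStar (X := Σ p, M.fibre p) (fun _ _ f => IsNicaCovariant hM fun p x => f ⟨p, x⟩)
    fun z => ⟨‖z.2‖, fun _ _ _ hf => hf.norm_le z.1 z.2⟩

/-- The canonical map of `M` into `NTUnital`. -/
def preJ (hM : M.IsCompactlyAligned) (p : S) (x : M.fibre p) : M.NTUnital hM :=
  UnivCStar.gen _ _ ⟨p, x⟩

/-- The closed *-subalgebra generated by the universal Nica covariant representation. -/
def ntSubalgebra (hM : M.IsCompactlyAligned) : NonUnitalStarSubalgebra ℂ (M.NTUnital hM) :=
  (NonUnitalStarAlgebra.adjoin ℂ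
    (Set.range fun z : Σ p, M.fibre p => M.preJ hM z.1 z.2)).topologicalClosure

/-- The Nica-Toeplitz algebra `NT(M)`, the universal C*-algebra generated by a Nica covariant
representation of `M`. (Its unit is `j_1(1)`, which differs from the unit of `NTUnital`.) -/
def NT (hM : M.IsCompactlyAligned) : Type max v w := M.ntSubalgebra hM

instance (hM : M.IsCompactlyAligned) : NonUnitalCStarAlgebra (M.NT hM) :=
  NonUnitalStarSubalgebra.nonUnitalCStarAlgebra (M.ntSubalgebra hM)
    (h_closed := NonUnitalStarSubalgebra.isClosed_topologicalClosure _)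

/-- The universal Nica covariant representation `j_M`. -/
def j (hM : M.IsCompactlyAligned) (p : S) (x : M.fibre p) : M.NT hM :=
  ⟨M.preJ hM p x, NonUnitalStarSubalgebra.le_topologicalClosure _
    (NonUnitalStarAlgebra.subset_adjoin ℂ _ ⟨⟨p, x⟩, rfl⟩)⟩

end ProductSystem

/-! ### Algebraic dynamical systems -/

/-- An algebraic dynamical system `(G, P, θ)`. -/
structure AlgebraicDynamicalSystem (G : Type u) (P : Type v) [Group G] [Monoid P] where
  countable_group : Countable G
  countable_monoid : Countable P
  /-- `P` is left cancellative. -/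
  left_cancel : ∀ p q q' : P, p * q = p * q' → q = q'
  /-- The intersection of two principal right ideals of `P` is empty or a principal right ideal. -/
  right_lcm : ∀ p q : P, Set.range (p * ·) ∩ Set.range (q * ·) = ∅ ∨
    ∃ r, Set.range (p * ·) ∩ Set.range (q * ·) = Set.range (r * ·)
  /-- The action of `P` by endomorphisms of `G`. -/
  θ : P →* Monoid.End G
  injective : ∀ p, Function.Injective (θ p)
  /-- `θ` respects the order on `P`. -/
  range_inter : ∀ p q r : P, Set.range (p * ·) ∩ Set.range (q * ·) = Set.range (r * ·) →
    Set.range (θ p) ∩ Set.range (θ q) = Set.range (θ r)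

namespace AlgebraicDynamicalSystem

variable {G : Type u} {P : Type v} [Group G] [Monoid P] (D : AlgebraicDynamicalSystem G P)

open GroupCStar

theorem θ_mul (p q : P) (g : G) : D.θ (p * q) g = D.θ p (D.θ q g) := by
  rw [map_mul]; rfl

theorem θ_one (g : G) : D.θ 1 g = g := by
  rw [map_one]; rfl

/-- `alpha` as a continuous linear map. -/
def alphaC (φ : Monoid.End G) : GroupCStar G →L[ℂ] GroupCStar G :=
  ⟨(alpha φ).toAlgHom.toLinearMap, continuous_alpha φ⟩

/-- The action `α` of `P` on `C*(G)`, `α_p(δ_g) = δ_{θ_p(g)}`, and the transfer operators `L_p`,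
`L_p(δ_{θ_p(g)}) = δ_g` and `L_p(δ_h) = 0` for `h ∉ θ_p(G)`. -/
def exelLarsen : ExelLarsenSystem (GroupCStar G) P where
  α p := alpha (D.θ p)
  α_one a := by
    have : alphaC (D.θ 1) = ContinuousLinearMap.id ℂ (GroupCStar G) := clm_ext fun g =>
      (alpha_delta _ g).trans (by rw [θ_one]; rfl)
    exact congrArg (fun f : GroupCStar G →L[ℂ] GroupCStar G => f a) this
  α_mul p q a := by
    have : alphaC (D.θ (p * q)) = alphaC (D.θ p) ∘L alphaC (D.θ q) := clm_ext fun g => by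
      refine (alpha_delta _ g).trans (Eq.symm ?_)
      refine (congrArg (alpha (D.θ p)) (alpha_delta (D.θ q) g)).trans ?_
      rw [alpha_delta, θ_mul]
    exact congrArg (fun f : GroupCStar G →L[ℂ] GroupCStar G => f a) this
  L p := transfer (D.θ p) (D.injective p)
  L_one a := by
    have : transfer (D.θ 1) (D.injective 1) = ContinuousLinearMap.id ℂ (GroupCStar G) :=
      clm_ext fun g => by
        have := transfer_delta_map (D.θ 1) (D.injective 1) g
        rwa [θ_one] at this
    exact congrArg (fun f : GroupCStar G →L[ℂ] GroupCStar G => f a) this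
  L_mul p q a := by
    have : transfer (D.θ (p * q)) (D.injective (p * q)) =
        transfer (D.θ q) (D.injective q) ∘L transfer (D.θ p) (D.injective p) :=
      clm_ext fun g => by
        rw [ContinuousLinearMap.comp_apply]
        by_cases hg : g ∈ Set.range (D.θ p)
        · obtain ⟨h, rfl⟩ := hg
          rw [transfer_delta_map]
          by_cases hh : h ∈ Set.range (D.θ q)
          · obtain ⟨k, rfl⟩ := hh
            rw [transfer_delta_map, ← θ_mul, transfer_delta_map]
          · rw [transfer_delta_of_notMem _ _ hh, transfer_delta_of_notMem]
            rintro ⟨k, hk⟩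
            rw [θ_mul] at hk
            exact hh ⟨k, D.injective p hk⟩
        · rw [transfer_delta_of_notMem _ _ hg, map_zero, transfer_delta_of_notMem]
          rintro ⟨k, hk⟩
          rw [θ_mul] at hk
          exact hg ⟨_, hk⟩
    exact congrArg (fun f : GroupCStar G →L[ℂ] GroupCStar G => f a) this
  L_unital p := by
    have := transfer_delta_map (D.θ p) (D.injective p) 1
    rwa [map_one, delta_one] at this
  L_star p a := transfer_star _ _ a
  L_pos p a := isPos_transfer _ _ a
  L_α_mul p a b := by
    rw [← star_star (alpha (D.θ p) a * b), transfer_star, star_mul, ← map_star (alpha (D.θ p)),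
      transfer_mul_alpha, star_mul, star_star, ← transfer_star, star_star]

/-- The product system `M` of right-Hilbert `C*(G)`-bimodules over `P`. -/
abbrev productSystem : ProductSystem.{u, v, u} (GroupCStar G) P := D.exelLarsen.productSystem

/-- The quotient map `π_p : C*(G) → M_p`. -/
def π (p : P) : GroupCStar G →ₗ[ℂ] D.productSystem.fibre p := D.exelLarsen.π p

theorem mul_π_delta (p q : P) (g h : G) :
    D.productSystem.mul rfl (D.π p (delta g)) (D.π q (delta h)) =
      D.π (p * q) (delta (g * D.θ p h)) := by
  refine (D.exelLarsen.mulL_π rfl (delta g) (delta h)).trans ?_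
  rw [delta_mul, ← alpha_delta]; rfl

/-- A unitary representation `u` of `G` and an isometric representation `s` of `P` in the unital
C*-algebra `B` which satisfy the defining relations of `A[G,P,θ]`. -/
structure IsCovariantPair {B : Type*} [CStarAlgebra B] (u : G → B) (s : P → B) : Prop where
  u_one : u 1 = 1
  u_mul : ∀ g h, u (g * h) = u g * u h
  u_unitary : ∀ g, u g ∈ unitary B
  s_one : s 1 = 1
  s_mul : ∀ p q, s (p * q) = s p * s q
  s_isometry : ∀ p, star (s p) * s p = 1
  s_mul_u : ∀ p g, s p * u g = u (D.θ p g) * s p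
  star_s_mul : ∀ (p q r p' q' : P) (g k l : G),
    Set.range (p * ·) ∩ Set.range (q * ·) = Set.range (r * ·) → p * p' = r → q * q' = r →
    g = D.θ p k * D.θ q l⁻¹ →
    star (s p) * u g * s q = u k * s p' * star (s q') * star (u l)
  star_s_mul_eq_zero : ∀ (p q : P) (g : G),
    (¬ ∃ (r p' q' : P) (k l : G),
      Set.range (p * ·) ∩ Set.range (q * ·) = Set.range (r * ·) ∧ p * p' = r ∧ q * q' = r ∧
        g = D.θ p k * D.θ q l⁻¹) →
    star (s p) * u g * s q = 0

theorem norm_le_one_of_star_mul_self {B : Type*} [CStarAlgebra B] {b : B} (h : star b * b = 1) :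
    ‖b‖ ≤ 1 := by
  have h1 := CStarRing.norm_star_mul_self (x := b)
  have h2 := CStarRing.norm_star_mul_self (x := (1 : B))
  rw [star_one, mul_one] at h2
  rw [h] at h1
  have h3 : ‖(1 : B)‖ ≤ 1 := by nlinarith [norm_nonneg (1 : B)]
  nlinarith [norm_nonneg b]

/-- The universal C*-algebra `A[G,P,θ]`. -/
abbrev Alg : Type max u v :=
  UnivCStar (X := G ⊕ P) (fun _ _ f => D.IsCovariantPair (f ∘ Sum.inl) (f ∘ Sum.inr)) fun x =>
    ⟨1, fun _ _ f hf => by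
      rcases x with g | p
      · exact norm_le_one_of_star_mul_self (b := f (Sum.inl g)) (hf.u_unitary g).1
      · exact norm_le_one_of_star_mul_self (b := f (Sum.inr p)) (hf.s_isometry p)⟩

/-- The generating unitary representation of `G` in `A[G,P,θ]`. -/
def u (g : G) : D.Alg := UnivCStar.gen _ _ (Sum.inl g)

/-- The generating isometric representation of `P` in `A[G,P,θ]`. -/
def s (p : P) : D.Alg := UnivCStar.gen _ _ (Sum.inr p)

end AlgebraicDynamicalSystem

end ADS

end

noncomputable section

namespace ADS

/-! Both algebras are universal, so it suffices to turn a covariant pair (u, s) into a Nica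
covariant representation of M and conversely, in mutually inverse ways. The dictionary is
ψ_p(π_p(δ_g)) = u_g s_p. Given (u, s), let u(a) be the integrated form of u on C*(G). The case q = p
of the defining relations says s_p* u(a) s_p = u(L_p(a)), so π_p(a) ↦ u(a) s_p preserves inner
products and is well defined; s_p u_g = u_{θ_p(g)} s_p makes it multiplicative. This is
`IsCovariantPair.isRepresentation_rep`.

The essential point is that Nica covariance is exactly the relation for s_p* u_g s_q. The space
K(M_p) is the closed span of the matrix units Θ^p_{g,h} = Θ_{π_p(δ_g), π_p(δ_h)}. Such an operator
sends δ_{hθ_p(k)} to δ_{gθ_p(k)} and kills δ_x for x outside hθ_p(G). Suppose pP ∩ qP = rP. If c⁻¹a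
= θ_p(k)θ_q(l⁻¹), then cθ_p(G) ∩ aθ_q(G) is a left coset of θ_p(G) ∩ θ_q(G) = θ_r(G), and the
product of the images of Θ^p_{g,c} and Θ^q_{a,b} on M_r is Θ^r_{gθ_p(k), bθ_q(l)}; if c⁻¹a has no
such factorization, the cosets are disjoint and the product is 0. These are `iotaK_comp` and
`iotaK_comp_eq_zero`, and `isCompactlyAligned` follows by linearity and continuity.

On matrix units, Nica covariance evaluates u_g s_p (s_p* u_{c⁻¹a} s_q) s_q* u_b*. That is the
defining relation multiplied by u_g s_p on the left and by (u_b s_q)* on the right, which gives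
`IsCovariantPair.isNicaCovariant_rep`. Since the s_p are isometries and the u_g unitaries, the outer
factors can be cancelled again, which gives `isCovariantPair_of_isNicaCovariant`.

Two general facts complete the argument. A universal C*-algebra satisfies its own relations, because
these can be tested in jointly injective families of quotients (`UnivCStar.rel_gen`). And NT(M),
defined as a non-unital algebra, has the unit j_1(1) (`j_one_mul`), so that it can receive a unital
homomorphism from A[G,P,θ]. -/

theorem continuous_of_starHom {B : Type*} {C : Type*} [NonUnitalCStarAlgebra B]
    [NonUnitalCStarAlgebra C] (φ : B →⋆ₙₐ[ℂ] C) : Continuous φ :=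
  AddMonoidHomClass.continuous_of_bound φ 1 fun b => by
    rw [one_mul]; exact NonUnitalStarAlgHom.norm_apply_le φ b

/-! ### The universal property of the completion in a C*-seminorm. -/

namespace CStarSeminorm

variable {R : Type u} [Ring R] [Algebra ℂ R] [StarRing R] {B : Type v} [CStarAlgebra B]

/-- The C*-seminorm `a ↦ ‖φ a‖` of a *-homomorphism `φ` into a C*-algebra. -/
def ofHom (φ : R →⋆ₐ[ℂ] B) : CStarSeminorm R where
  toFun a := ‖φ a‖
  map_zero' := by rw [map_zero, norm_zero]
  add_le' a b := by rw [map_add]; exact norm_add_le _ _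
  neg' a := by rw [map_neg, norm_neg]
  smul' c a := by rw [map_smul, norm_smul]
  mul_le' a b := by rw [map_mul]; exact norm_mul_le _ _
  star_mul_self' a := by rw [map_mul, map_star, CStarRing.norm_star_mul_self, sq]

theorem ofHom_apply (φ : R →⋆ₐ[ℂ] B) (a : R) : ofHom φ a = ‖φ a‖ := rfl

variable [StarModule ℂ R] (ρ : CStarSeminorm R)

theorem induction_compl {p : ρ.Compl → Prop} (x : ρ.Compl) (hp : IsClosed {x | p x})
    (h : ∀ a, p (ρ.toCompl a)) : p x :=
  ρ.denseRange_toCompl.induction_on x hp h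

/-- The continuous linear extension to `ρ.Compl` of a linear map bounded by `ρ`. -/
def liftL (φ : R →⋆ₐ[ℂ] B) : ρ.Compl →L[ℂ] B :=
  φ.toAlgHom.toLinearMap.extendOfNorm ρ.toCompl.toAlgHom.toLinearMap

theorem liftL_toCompl (φ : R →⋆ₐ[ℂ] B) (h : ∀ a, ‖φ a‖ ≤ ρ a) (a : R) :
    ρ.liftL φ (ρ.toCompl a) = φ a :=
  LinearMap.extendOfNorm_eq (f := φ.toAlgHom.toLinearMap) (e := ρ.toCompl.toAlgHom.toLinearMap)
    ρ.denseRange_toCompl ⟨1, fun a => by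
      rw [one_mul]; exact (h a).trans_eq (ρ.norm_toCompl a).symm⟩ a

/-- The extension to `ρ.Compl` of a *-homomorphism bounded by `ρ`. -/
def lift (φ : R →⋆ₐ[ℂ] B) (h : ∀ a, ‖φ a‖ ≤ ρ a) : ρ.Compl →⋆ₐ[ℂ] B where
  toFun := ρ.liftL φ
  map_one' := by rw [← map_one ρ.toCompl, ρ.liftL_toCompl φ h, map_one]
  map_mul' x y := by
    refine ρ.denseRange_toCompl.induction_on₂
      (p := fun x y => ρ.liftL φ (x * y) = ρ.liftL φ x * ρ.liftL φ y) ?_ ?_ x y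
    · exact isClosed_eq (by fun_prop) (by fun_prop)
    · intro a b
      rw [← map_mul, ρ.liftL_toCompl φ h, ρ.liftL_toCompl φ h, ρ.liftL_toCompl φ h, map_mul]
  map_zero' := map_zero _
  map_add' := map_add _
  commutes' c := by
    rw [Algebra.algebraMap_eq_smul_one, map_smul, ← map_one ρ.toCompl, ρ.liftL_toCompl φ h,
      map_one, Algebra.algebraMap_eq_smul_one]
  map_star' x := by
    refine ρ.induction_compl (p := fun x => ρ.liftL φ (star x) = star (ρ.liftL φ x)) x ?_ ?_
    · exact isClosed_eq (by fun_prop) (by fun_prop)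
    · intro a
      rw [← map_star, ρ.liftL_toCompl φ h, ρ.liftL_toCompl φ h, map_star]

theorem lift_toCompl (φ : R →⋆ₐ[ℂ] B) (h : ∀ a, ‖φ a‖ ≤ ρ a) (a : R) :
    ρ.lift φ h (ρ.toCompl a) = φ a := ρ.liftL_toCompl φ h a

/-- The seminorm is ‖φ a‖ itself, so the lift is isometric on the dense image of `R` and hence
everywhere. The completion is thus a copy of a C*-subalgebra of `B`, and relations can be pulled
back to it from `B`. -/
theorem injective_lift_ofHom (φ : R →⋆ₐ[ℂ] B) (x : (ofHom φ).Compl)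
    (hx : (ofHom φ).lift φ (fun _ => le_rfl) x = 0) : x = 0 := by
  have h1 : ∀ x, ‖(ofHom φ).liftL φ x‖ = ‖x‖ := fun x => by
    refine (ofHom φ).induction_compl (p := fun x => ‖(ofHom φ).liftL φ x‖ = ‖x‖) x ?_ ?_
    · exact isClosed_eq (by fun_prop) (by fun_prop)
    · intro a
      rw [liftL_toCompl _ _ fun _ => le_rfl, norm_toCompl, ofHom_apply]
  rw [← norm_eq_zero, ← h1]
  exact norm_eq_zero.2 hx

end CStarSeminorm

/-! ### Homomorphisms out of the free *-algebra. -/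

namespace FreeStarAlg

variable {X : Type u} {B : Type v} [CStarAlgebra B]

/-- The homomorphism of algebras underlying `lift`. -/
def liftAlg (f : X → B) : FreeStarAlg X →ₐ[ℂ] B :=
  MonoidAlgebra.lift ℂ B (FreeMonoid (X × Bool))
    (FreeMonoid.lift fun l => if l.2 then star (f l.1) else f l.1)

theorem liftAlg_gen (f : X → B) (x : X) : liftAlg f (gen x) = f x := by
  refine (MonoidAlgebra.lift_of _ _).trans ?_
  simp

theorem liftAlg_star_gen (f : X → B) (x : X) : liftAlg f (star (gen x)) = star (f x) := by
  rw [star_gen]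
  refine (MonoidAlgebra.lift_of _ _).trans ?_
  simp

/-- The *-homomorphism of the free *-algebra with prescribed values on the generators. -/
def lift (f : X → B) : FreeStarAlg X →⋆ₐ[ℂ] B :=
  { liftAlg f with
    map_star' := fun a => by
      change liftAlg f (star a) = star (liftAlg f a)
      induction a using FreeStarAlg.induction with
      | one => simp
      | gen_mul x a ih => rw [star_mul, map_mul, map_mul, star_mul, ih, liftAlg_gen, liftAlg_star_gen]
      | star_gen_mul x a ih =>
        rw [star_mul, star_star, map_mul, map_mul, star_mul, ih, liftAlg_gen, liftAlg_star_gen,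
          star_star]
      | add a b ha hb => rw [star_add, map_add, map_add, star_add, ha, hb]
      | smul c a ha => rw [star_smul, map_smul, map_smul, star_smul, ha] }

theorem lift_gen (f : X → B) (x : X) : lift f (gen x) = f x := liftAlg_gen f x

theorem hom_ext {φ ψ : FreeStarAlg X →⋆ₐ[ℂ] B} (h : ∀ x, φ (gen x) = ψ (gen x)) : φ = ψ := by
  ext a
  induction a using FreeStarAlg.induction with
  | one => rw [map_one, map_one]
  | gen_mul x a ih => rw [map_mul, map_mul, ih, h]
  | star_gen_mul x a ih => rw [map_mul, map_mul, ih, map_star, map_star, h]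
  | add a b ha hb => rw [map_add, map_add, ha, hb]
  | smul c a ha => rw [map_smul, map_smul, ha]

end FreeStarAlg

/-- The relation `Rel` holds in a C*-algebra as soon as it holds in the images under a jointly
injective family of *-homomorphisms. -/
def IsReflected {X : Type u} (Rel : ∀ (B : Type u) [CStarAlgebra B], (X → B) → Prop) : Prop :=
  ∀ (B : Type u) [CStarAlgebra B] (f : X → B) (ι : Type u) (C : ι → Type u)
    [∀ i, CStarAlgebra (C i)] (Φ : ∀ i, B →⋆ₐ[ℂ] C i), (∀ b, (∀ i, Φ i b = 0) → b = 0) →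
    (∀ i, Rel (C i) fun x => Φ i (f x)) → Rel B f

/-! ### The universal property of a universal C*-algebra with reflected relations. -/

namespace UnivCStar

variable {X : Type u} {Rel : ∀ (B : Type u) [CStarAlgebra B], (X → B) → Prop}
  {hRel : ∀ x, ∃ C : ℝ, ∀ (B : Type u) [CStarAlgebra B] (f : X → B), Rel B f → ‖f x‖ ≤ C}

variable (Rel hRel) in
/-- The canonical map of the free *-algebra into the universal C*-algebra. -/
def ofFree : FreeStarAlg X →⋆ₐ[ℂ] UnivCStar Rel hRel :=
  (CStarSeminorm.sup _ (bddAbove_admissible hRel)).toCompl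

theorem denseRange_ofFree : DenseRange (ofFree Rel hRel) :=
  (CStarSeminorm.sup _ (bddAbove_admissible hRel)).denseRange_toCompl

variable (hRel) in
/-- The extension of a *-homomorphism dominated by an admissible seminorm. -/
def liftOfLE {B : Type v} [CStarAlgebra B] (φ : FreeStarAlg X →⋆ₐ[ℂ] B)
    {ρ : CStarSeminorm (FreeStarAlg X)} (hρ : ρ ∈ admissible Rel) (h : ∀ a, ‖φ a‖ ≤ ρ a) :
    UnivCStar Rel hRel →⋆ₐ[ℂ] B :=
  (CStarSeminorm.sup _ (bddAbove_admissible hRel)).lift φ fun a =>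
    (h a).trans (CStarSeminorm.le_sup _ _ hρ a)

theorem liftOfLE_ofFree {B : Type v} [CStarAlgebra B] (φ : FreeStarAlg X →⋆ₐ[ℂ] B)
    {ρ : CStarSeminorm (FreeStarAlg X)} (hρ : ρ ∈ admissible Rel) (h : ∀ a, ‖φ a‖ ≤ ρ a)
    (a : FreeStarAlg X) : liftOfLE hRel φ hρ h (ofFree Rel hRel a) = φ a :=
  CStarSeminorm.lift_toCompl _ _ _ _

variable (hRel) in
/-- The homomorphism of the universal C*-algebra onto the one defined by an admissible seminorm. -/
def toAdmissible (ρ : admissible Rel) : UnivCStar Rel hRel →⋆ₐ[ℂ] ρ.1.Compl :=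
  liftOfLE hRel ρ.1.toCompl ρ.2 fun a => (ρ.1.norm_toCompl a).le

theorem toAdmissible_ofFree (ρ : admissible Rel) (a : FreeStarAlg X) :
    toAdmissible hRel ρ (ofFree Rel hRel a) = ρ.1.toCompl a := liftOfLE_ofFree _ _ _ _

/-- The norm is the supremum of the admissible seminorms, but only on the image of the free algebra,
so `b` is approximated by some `a` there. Each quotient map is contractive and kills `b`, hence ρ(a)
≤ ‖b - a‖ for every admissible ρ. The supremum ‖a‖ is then small, and so is ‖b‖. -/
theorem eq_zero_of_toAdmissible (b : UnivCStar Rel hRel)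
    (hb : ∀ ρ : admissible Rel, toAdmissible hRel ρ b = 0) : b = 0 := by
  rw [← norm_le_zero_iff]
  refine le_of_forall_pos_le_add fun ε hε => ?_
  obtain ⟨a, ha⟩ := denseRange_ofFree.exists_dist_lt b (half_pos hε)
  rw [dist_eq_norm] at ha
  have h1 : ‖ofFree Rel hRel a‖ ≤ ε / 2 := by
    refine ((CStarSeminorm.sup _ (bddAbove_admissible hRel)).norm_toCompl a).trans_le ?_
    refine CStarSeminorm.sup_le _ _ (half_pos hε).le fun ρ hρ => ?_
    have h2 := NonUnitalStarAlgHom.norm_apply_le (toAdmissible hRel ⟨ρ, hρ⟩)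
      (b - ofFree Rel hRel a)
    rw [map_sub, hb, zero_sub, norm_neg, toAdmissible_ofFree, CStarSeminorm.norm_toCompl] at h2
    exact h2.trans ha.le
  have h3 := norm_add_le (b - ofFree Rel hRel a) (ofFree Rel hRel a)
  rw [sub_add_cancel] at h3
  linarith

/-- The quotients by admissible seminorms satisfy `Rel` by definition and are jointly injective, so
reflection carries `Rel` back to the universal algebra. -/
theorem rel_gen (h : IsReflected Rel) : Rel (UnivCStar Rel hRel) (gen Rel hRel) := by
  refine h _ _ (admissible Rel) _ (toAdmissible hRel) eq_zero_of_toAdmissible fun ρ => ?_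
  have h1 : (fun x => toAdmissible hRel ρ (gen Rel hRel x)) =
      fun x => ρ.1.toCompl (FreeStarAlg.gen x) := funext fun x => toAdmissible_ofFree ρ _
  rw [h1]
  exact ρ.2

/-- Admissibility asks for `Rel` in the completion of the free algebra and not in `B`. That
completion embeds in `B`, so reflection along this one-member injective family suffices. -/
theorem ofHom_mem_admissible (h : IsReflected Rel) {B : Type u} [CStarAlgebra B] {f : X → B}
    (hf : Rel B f) : CStarSeminorm.ofHom (FreeStarAlg.lift f) ∈ admissible Rel := by
  refine h _ _ PUnit (fun _ => B)
    (fun _ => (CStarSeminorm.ofHom (FreeStarAlg.lift f)).lift (FreeStarAlg.lift f) fun _ => le_rfl)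
    (fun b hb => CStarSeminorm.injective_lift_ofHom _ b (hb ⟨⟩)) fun _ => ?_
  have h1 : (fun x => (CStarSeminorm.ofHom (FreeStarAlg.lift f)).lift (FreeStarAlg.lift f)
      (fun _ => le_rfl) ((CStarSeminorm.ofHom (FreeStarAlg.lift f)).toCompl (FreeStarAlg.gen x))) =
      f := funext fun x => (CStarSeminorm.lift_toCompl _ _ _ _).trans (FreeStarAlg.lift_gen f x)
  rw [h1]
  exact hf

/-- The universal property of the universal C*-algebra. -/
def lift (h : IsReflected Rel) {B : Type u} [CStarAlgebra B] {f : X → B} (hf : Rel B f) :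
    UnivCStar Rel hRel →⋆ₐ[ℂ] B :=
  liftOfLE hRel (FreeStarAlg.lift f) (ofHom_mem_admissible h hf) fun _ => le_rfl

theorem lift_gen (h : IsReflected Rel) {B : Type u} [CStarAlgebra B] {f : X → B} (hf : Rel B f)
    (x : X) : lift (hRel := hRel) h hf (gen Rel hRel x) = f x :=
  (liftOfLE_ofFree _ _ _ _).trans (FreeStarAlg.lift_gen f x)

theorem hom_ext {B : Type v} [CStarAlgebra B] {φ ψ : UnivCStar Rel hRel →⋆ₐ[ℂ] B}
    (h : ∀ x, φ (gen Rel hRel x) = ψ (gen Rel hRel x)) : φ = ψ := by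
  have h1 : φ.comp (ofFree Rel hRel) = ψ.comp (ofFree Rel hRel) := FreeStarAlg.hom_ext h
  ext b
  refine denseRange_ofFree.induction_on (p := fun b => φ b = ψ b) b ?_ fun a => ?_
  · exact isClosed_eq (continuous_of_starHom φ.toNonUnitalStarAlgHom)
      (continuous_of_starHom ψ.toNonUnitalStarAlgHom)
  · exact DFunLike.congr_fun h1 a

end UnivCStar

/-! ### Representations of the group C*-algebra -/

section GroupRep

variable {G : Type u} [Group G] {B : Type v} [CStarAlgebra B]

namespace GroupAlg

/-- The homomorphism of algebras underlying `lift`. -/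
def liftAlg (f : G →* B) : GroupAlg G →ₐ[ℂ] B := MonoidAlgebra.lift ℂ B G f

theorem liftAlg_of (f : G →* B) (g : G) : liftAlg f (of g) = f g := MonoidAlgebra.lift_of f g

/-- The *-homomorphism of `ℂ[G]` defined by a unitary representation of `G`. -/
def lift (f : G →* B) (hf : ∀ g, star (f g) = f g⁻¹) : GroupAlg G →⋆ₐ[ℂ] B :=
  { liftAlg f with
    map_star' := fun a => by
      change liftAlg f (star a) = star (liftAlg f a)
      induction a using GroupAlg.induction with
      | of g =>
        rw [star_of, liftAlg_of, liftAlg_of, hf]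
      | add a b ha hb => rw [star_add, map_add, map_add, star_add, ha, hb]
      | smul c a ha => rw [star_smul, map_smul, map_smul, star_smul, ha] }

theorem lift_of (f : G →* B) (hf : ∀ g, star (f g) = f g⁻¹) (g : G) : lift f hf (of g) = f g :=
  liftAlg_of f g

end GroupAlg

namespace GroupCStar

/-- The *-homomorphism of `C*(G)` defined by a unitary representation of `G`. -/
def lift (f : G →* B) (hf : ∀ g, star (f g) = f g⁻¹) : GroupCStar G →⋆ₐ[ℂ] B :=
  -- The norm of a *-representation is itself a C*-seminorm, hence bounded by the largest one.
  (maxSeminorm G).lift (GroupAlg.lift f hf) fun a =>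
    le_maxSeminorm (CStarSeminorm.ofHom (GroupAlg.lift f hf)) a

theorem lift_delta (f : G →* B) (hf : ∀ g, star (f g) = f g⁻¹) (g : G) :
    lift f hf (delta g) = f g :=
  (CStarSeminorm.lift_toCompl _ _ _ _).trans (GroupAlg.lift_of f hf g)

/-- A closed condition that is linear holds on `C*(G)` if it holds for the `δ_g`. -/
theorem induction {p : GroupCStar G → Prop} (a : GroupCStar G) (delta : ∀ g, p (delta g))
    (add : ∀ a b, p a → p b → p (a + b)) (smul : ∀ (c : ℂ) a, p a → p (c • a))
    (closed : IsClosed {a | p a}) : p a := by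
  refine denseRange_incl.induction_on (p := p) a closed fun a => ?_
  induction a using GroupAlg.induction with
  | of g => exact delta g
  | add a b ha hb => rw [map_add]; exact add _ _ ha hb
  | smul c a ha => rw [map_smul]; exact smul _ _ ha

end GroupCStar

end GroupRep

/-! ### Compact operators -/

namespace RightHilbertBimodule

variable {A : Type u} [CStarAlgebra A] {E : Type w} [NormedAddCommGroup E] [NormedSpace ℂ E]
  [CompleteSpace E] [Module A E] [Module Aᵐᵒᵖ E] [RightHilbertBimodule A E]

/-- The scalar `c` acts as right multiplication by the central element `c • 1`, which commutes with
the right action of `a`. -/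
theorem op_smul_smul (a : A) (c : ℂ) (x : E) :
    MulOpposite.op a • (c • x) = c • (MulOpposite.op a • x) := by
  have h1 : c • x = MulOpposite.op (c • (1 : A)) • x := by
    rw [smul_op_smul, MulOpposite.op_one, one_smul]
  rw [h1, ← mul_smul, ← MulOpposite.op_mul, smul_mul_assoc, one_mul, smul_op_smul]

theorem norm_theta_le (ξ η : E) : ‖theta A ξ η‖ ≤ ‖ξ‖ * ‖η‖ :=
  LinearMap.mkContinuous_norm_le _ (by positivity) _

variable (A) in
/-- `Θ_{ξ,η}` as an element of `K(E)`. -/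
def thetaK (ξ η : E) : compacts A E := ⟨theta A ξ η, theta_mem_compacts ξ η⟩

theorem thetaK_add_left (ξ ξ' η : E) : thetaK A (ξ + ξ') η = thetaK A ξ η + thetaK A ξ' η := by
  ext μ
  exact smul_add _ _ _

theorem thetaK_smul_left (c : ℂ) (ξ η : E) : thetaK A (c • ξ) η = c • thetaK A ξ η := by
  ext μ
  exact op_smul_smul _ _ _

theorem thetaK_add_right (ξ η η' : E) : thetaK A ξ (η + η') = thetaK A ξ η + thetaK A ξ η' := by
  ext μ
  change MulOpposite.op (inner (A := A) (η + η') μ) • ξ =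
    MulOpposite.op (inner (A := A) η μ) • ξ + MulOpposite.op (inner (A := A) η' μ) • ξ
  rw [inner_add_left, MulOpposite.op_add, add_smul]

theorem thetaK_smul_right (c : ℂ) (ξ η : E) :
    thetaK A ξ (c • η) = starRingEnd ℂ c • thetaK A ξ η := by
  ext μ
  change MulOpposite.op (inner (A := A) (c • η) μ) • ξ =
    starRingEnd ℂ c • MulOpposite.op (inner (A := A) η μ) • ξ
  rw [inner_smul_left, smul_op_smul]

theorem continuous_thetaK_left (η : E) : Continuous fun ξ : E => thetaK A ξ η :=
  (LinearMap.mkContinuous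
    ({ toFun := fun ξ => thetaK A ξ η
       map_add' := fun ξ ξ' => thetaK_add_left ξ ξ' η
       map_smul' := fun c ξ => thetaK_smul_left c ξ η } : E →ₗ[ℂ] compacts A E) ‖η‖ fun ξ => by
        rw [mul_comm]; exact norm_theta_le ξ η).continuous

theorem continuous_thetaK_right (ξ : E) : Continuous fun η : E => thetaK A ξ η :=
  (LinearMap.mkContinuous
    ({ toFun := fun η => thetaK A ξ η
       map_add' := fun η η' => thetaK_add_right ξ η η'
       map_smul' := fun c η => thetaK_smul_right c ξ η } : E →ₗ⋆[ℂ] compacts A E) ‖ξ‖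
    fun η => norm_theta_le ξ η).continuous

/-- Linear combinations of the operators Θ_{ξ,η} are dense, and a closed linear condition need only
be tested on the operators themselves. -/
theorem compacts_induction {p : compacts A E → Prop} (T : compacts A E)
    (theta : ∀ ξ η, p (thetaK A ξ η)) (add : ∀ S T, p S → p T → p (S + T))
    (smul : ∀ (c : ℂ) T, p T → p (c • T)) (closed : IsClosed {T | p T}) : p T := by
  refine denseRange_finiteRankK.induction_on (p := p) T closed fun v => ?_
  induction v using Finsupp.induction_linear with
  | zero =>
    -- Writing 0 as a scalar multiple of some Θ avoids a separate hypothesis for the zero operator.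
    rw [map_zero, ← zero_smul ℂ (thetaK A (0 : E) 0)]
    exact smul _ _ (theta _ _)
  | add v w hv hw => rw [map_add]; exact add _ _ hv hw
  | single z c =>
    have h1 : finiteRankK A E (Finsupp.single z c) = c • thetaK A z.1 z.2 := by
      ext1
      simp [finiteRankK, finiteRank, thetaK]
    rw [h1]
    exact smul _ _ (theta _ _)

end RightHilbertBimodule

namespace ProductSystem

open RightHilbertBimodule

variable {A : Type u} [CStarAlgebra A] {S : Type v} [Monoid S] (M : ProductSystem.{u, v, w} A S)

/-! ### The operators `ι` as bounded linear maps -/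

/-- The products ξη span a dense subspace of `M.fibre r`. Since `iota` is known through its values
on such products, this is how identities between these operators are verified. -/
theorem clm_ext_mul {p q r : S} (h : p * q = r) {E : Type*} [NormedAddCommGroup E]
    [NormedSpace ℂ E] {f g : M.fibre r →L[ℂ] E}
    (hfg : ∀ x y, f (M.mul h x y) = g (M.mul h x y)) : f = g := by
  ext z
  refine (M.denseRange_preIota h).induction_on (p := fun z => f z = g z) z ?_ fun v => ?_
  · exact isClosed_eq f.continuous g.continuous
  · induction v using Finsupp.induction_linear with
    | zero => rw [map_zero, map_zero, map_zero]
    | add v w hv hw => rw [_root_.map_add, _root_.map_add, _root_.map_add, hv, hw]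
    | single z c =>
      rw [preIota_single, _root_.map_smul, _root_.map_smul]
      exact congrArg (c • ·) (hfg _ _)

/-- `ι_p^r` as a bounded linear map on `K(M_p)`. -/
def iotaK {p q r : S} (h : p * q = r) : compacts A (M.fibre p) →L[ℂ] M.fibre r →L[ℂ] M.fibre r :=
  LinearMap.mkContinuous
    { toFun := fun T => M.iota h T
      map_add' := fun T T' => M.clm_ext_mul h fun x y => by
        rw [add_apply, M.iota_mul h (T + T').2, M.iota_mul h T.2, M.iota_mul h T'.2]
        exact M.add_mul h _ _ _
      map_smul' := fun c T => M.clm_ext_mul h fun x y => by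
        rw [smul_apply, M.iota_mul h (c • T).2, M.iota_mul h T.2]
        exact M.smul_mul h _ _ _ } 1 fun T => by
    rw [one_mul]
    -- The constant 1 expresses ‖ι_p^r(T)‖ ≤ ‖T‖.
    exact LinearMap.opNorm_extendOfNorm_le (M.denseRange_preIota h) (norm_nonneg _)
      (M.norm_preIota_compacts_le h T.2)

theorem iotaK_apply {p q r : S} (h : p * q = r) (T : compacts A (M.fibre p)) :
    M.iotaK h T = M.iota h T := rfl

/-- The map `(T, T') ↦ ι_p^r(T) ι_q^r(T')` for a compactly aligned product system. -/
def mulK (hM : M.IsCompactlyAligned) {p q r p' q' : S} (h : p * p' = r) (h' : q * q' = r)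
    (hr : Set.range (p * ·) ∩ Set.range (q * ·) = Set.range (r * ·))
    (T : compacts A (M.fibre p)) (T' : compacts A (M.fibre q)) : compacts A (M.fibre r) :=
  ⟨M.iota h T ∘L M.iota h' T', hM p q r p' q' h h' hr T T.2 T' T'.2⟩

section mulK

variable {M} (hM : M.IsCompactlyAligned) {p q r p' q' : S} (h : p * p' = r) (h' : q * q' = r)
    (hr : Set.range (p * ·) ∩ Set.range (q * ·) = Set.range (r * ·))

theorem mulK_coe (T : compacts A (M.fibre p)) (T' : compacts A (M.fibre q)) :
    (M.mulK hM h h' hr T T' : M.fibre r →L[ℂ] M.fibre r) = M.iotaK h T ∘L M.iotaK h' T' := rfl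

theorem mulK_add_left (T₁ T₂ : compacts A (M.fibre p)) (T' : compacts A (M.fibre q)) :
    M.mulK hM h h' hr (T₁ + T₂) T' = M.mulK hM h h' hr T₁ T' + M.mulK hM h h' hr T₂ T' := by
  ext1
  rw [Submodule.coe_add, mulK_coe, mulK_coe, mulK_coe, _root_.map_add,
    ContinuousLinearMap.add_comp]

theorem mulK_add_right (T : compacts A (M.fibre p)) (T₁ T₂ : compacts A (M.fibre q)) :
    M.mulK hM h h' hr T (T₁ + T₂) = M.mulK hM h h' hr T T₁ + M.mulK hM h h' hr T T₂ := by
  ext1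
  rw [Submodule.coe_add, mulK_coe, mulK_coe, mulK_coe, _root_.map_add,
    ContinuousLinearMap.comp_add]

theorem mulK_smul_left (c : ℂ) (T : compacts A (M.fibre p)) (T' : compacts A (M.fibre q)) :
    M.mulK hM h h' hr (c • T) T' = c • M.mulK hM h h' hr T T' := by
  ext1
  rw [Submodule.coe_smul, mulK_coe, mulK_coe, _root_.map_smul, ContinuousLinearMap.smul_comp]

theorem mulK_smul_right (c : ℂ) (T : compacts A (M.fibre p)) (T' : compacts A (M.fibre q)) :
    M.mulK hM h h' hr T (c • T') = c • M.mulK hM h h' hr T T' := by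
  ext1
  rw [Submodule.coe_smul, mulK_coe, mulK_coe, _root_.map_smul, ContinuousLinearMap.comp_smul]

theorem continuous_mulK_left (T' : compacts A (M.fibre q)) :
    Continuous fun T => M.mulK hM h h' hr T T' :=
  Continuous.subtype_mk (f := fun T => M.iotaK h T ∘L M.iotaK h' T') (by fun_prop) _

theorem continuous_mulK_right (T : compacts A (M.fibre p)) :
    Continuous fun T' => M.mulK hM h h' hr T T' :=
  Continuous.subtype_mk (f := fun T' => M.iotaK h T ∘L M.iotaK h' T') (by fun_prop) _

end mulK

/-! ### Representations and *-homomorphisms -/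

section Reflect

variable {M} {B : Type*} [NonUnitalCStarAlgebra B] {ψ : ∀ p, M.fibre p → B}

theorem IsRepresentation.map {C : Type*} [NonUnitalCStarAlgebra C] (hψ : M.IsRepresentation ψ)
    (Φ : B →⋆ₙₐ[ℂ] C) : M.IsRepresentation fun p x => Φ (ψ p x) where
  map_add p x y := by rw [hψ.map_add, _root_.map_add]
  map_smul p c x := by rw [hψ.map_smul, _root_.map_smul]
  map_unit_mul a b := by rw [hψ.map_unit_mul, _root_.map_mul]
  map_unit_star a := by rw [hψ.map_unit_star, map_star]
  map_mul h x y := by rw [← _root_.map_mul, hψ.map_mul h]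
  star_mul p x y := by rw [← map_star, ← _root_.map_mul, hψ.star_mul]

/-- Both sides are continuous and linear in `T`, and they agree on every Θ_{ξ,η} because Φ is a
*-homomorphism. This makes Nica covariance compatible with passing to quotients and subalgebras. -/
theorem IsRepresentation.psiK_map {C : Type*} [NonUnitalCStarAlgebra C]
    (hψ : M.IsRepresentation ψ) (Φ : B →⋆ₙₐ[ℂ] C) (p : S) (T : compacts A (M.fibre p)) :
    Φ (M.psiK ψ p T) = M.psiK (fun p x => Φ (ψ p x)) p T := by
  have hΦ := continuous_of_starHom Φ
  refine compacts_induction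
    (p := fun T => Φ (M.psiK ψ p T) = M.psiK (fun p x => Φ (ψ p x)) p T) T ?_ ?_ ?_ ?_
  · intro ξ η
    rw [thetaK, hψ.psiK_theta, (hψ.map Φ).psiK_theta, _root_.map_mul, map_star]
  · intro T T' hT hT'
    rw [_root_.map_add, _root_.map_add, _root_.map_add, hT, hT']
  · intro c T hT
    rw [_root_.map_smul, _root_.map_smul, _root_.map_smul, hT]
  · exact isClosed_eq (by fun_prop) (by fun_prop)

variable {ι : Type*} {C : ι → Type*} [∀ i, NonUnitalCStarAlgebra (C i)] (Φ : ∀ i, B →⋆ₙₐ[ℂ] C i)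

/-- Every axiom of a representation is an equation in `B` between *-polynomial expressions in the
values of ψ, so it may be tested after applying the maps Φ_i. -/
theorem IsRepresentation.of_jointlyInjective (hΦ : ∀ b, (∀ i, Φ i b = 0) → b = 0)
    (h : ∀ i, M.IsRepresentation fun p x => Φ i (ψ p x)) : M.IsRepresentation ψ := by
  have key : ∀ b b', (∀ i, Φ i b = Φ i b') → b = b' := fun b b' hb =>
    sub_eq_zero.1 (hΦ _ fun i => by rw [map_sub, hb, sub_self])
  constructor
  · exact fun p x y => key _ _ fun i => by rw [_root_.map_add]; exact (h i).map_add p x y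
  · exact fun p c x => key _ _ fun i => by rw [_root_.map_smul]; exact (h i).map_smul p c x
  · exact fun a b => key _ _ fun i =>
      ((h i).map_unit_mul a b).trans (_root_.map_mul (Φ i) _ _).symm
  · exact fun a => key _ _ fun i =>
      ((h i).map_unit_star a).trans (map_star (Φ i) _).symm
  · exact fun hpq x y => key _ _ fun i => by rw [_root_.map_mul]; exact (h i).map_mul hpq x y
  · exact fun p x y => key _ _ fun i => by
      rw [_root_.map_mul, map_star]; exact (h i).star_mul p x y

/-- The covariance conditions involve ψ^{(p)}, which is defined by continuous extension. They become
testable under the Φ_i through `IsRepresentation.psiK_map`, once ψ itself is known to be a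
representation. -/
theorem IsNicaCovariant.of_jointlyInjective {hM : M.IsCompactlyAligned}
    (hΦ : ∀ b, (∀ i, Φ i b = 0) → b = 0)
    (h : ∀ i, IsNicaCovariant hM fun p x => Φ i (ψ p x)) : IsNicaCovariant hM ψ := by
  have hψ : M.IsRepresentation ψ :=
    .of_jointlyInjective Φ hΦ fun i => (h i).toIsRepresentation
  have key : ∀ b b', (∀ i, Φ i b = Φ i b') → b = b' := fun b b' hb =>
    sub_eq_zero.1 (hΦ _ fun i => by rw [map_sub, hb, sub_self])
  refine { hψ with psiK_mul := ?_, psiK_mul_eq_zero := ?_ }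
  · exact fun p q r p' q' hp hq hr T T' => key _ _ fun i => by
      rw [_root_.map_mul, hψ.psiK_map, hψ.psiK_map, hψ.psiK_map]
      exact (h i).psiK_mul p q r p' q' hp hq hr T T'
  · exact fun p q hr T T' => hΦ _ fun i => by
      rw [_root_.map_mul, hψ.psiK_map, hψ.psiK_map]
      exact (h i).psiK_mul_eq_zero p q hr T T'

theorem isReflected_isNicaCovariant (hM : M.IsCompactlyAligned) :
    IsReflected.{max v w} (X := Σ p, M.fibre p)
      fun _ _ f => IsNicaCovariant hM fun p x => f ⟨p, x⟩ :=
  fun _ _ _ _ _ _ Φ hΦ h => .of_jointlyInjective (fun i => (Φ i).toNonUnitalStarAlgHom) hΦ h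

variable (M) in
theorem isNicaCovariant_preJ (hM : M.IsCompactlyAligned) : IsNicaCovariant hM (M.preJ hM) :=
  UnivCStar.rel_gen (isReflected_isNicaCovariant hM)

end Reflect

end ProductSystem

/-! ### The generators of A[G,P,θ] satisfy the defining relations. -/

namespace AlgebraicDynamicalSystem

variable {G : Type u} {P : Type v} [Group G] [Monoid P] (D : AlgebraicDynamicalSystem G P)

/-- For fixed indices each relation is one or two equations between *-polynomials in the generators.
Its side conditions concern only G and P, so they do not change with the target algebra. -/
theorem isReflected_isCovariantPair : IsReflected.{max u v} (X := G ⊕ P)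
    fun _ _ f => D.IsCovariantPair (f ∘ Sum.inl) (f ∘ Sum.inr) := by
  intro B _ f ι C _ Φ hΦ h
  have key : ∀ b b', (∀ i, Φ i b = Φ i b') → b = b' := fun b b' hb =>
    sub_eq_zero.1 (hΦ _ fun i => by rw [map_sub, hb, sub_self])
  constructor
  · exact key _ _ fun i => by rw [map_one]; exact (h i).u_one
  · exact fun x y => key _ _ fun i => by rw [map_mul]; exact (h i).u_mul x y
  · refine fun x => Unitary.mem_iff.2 ⟨key _ _ fun i => ?_, key _ _ fun i => ?_⟩
    · rw [map_mul, map_star, map_one]; exact ((h i).u_unitary x).1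
    · rw [map_mul, map_star, map_one]; exact ((h i).u_unitary x).2
  · exact key _ _ fun i => by rw [map_one]; exact (h i).s_one
  · exact fun x y => key _ _ fun i => by rw [map_mul]; exact (h i).s_mul x y
  · exact fun x => key _ _ fun i => by
      rw [map_mul, map_star, map_one]; exact (h i).s_isometry x
  · exact fun p g => key _ _ fun i => by rw [map_mul, map_mul]; exact (h i).s_mul_u p g
  · exact fun p q r p' q' g k l hr hp hq hg => key _ _ fun i => by
      simp only [map_mul, map_star]; exact (h i).star_s_mul p q r p' q' g k l hr hp hq hg
  · exact fun p q g hg => key _ _ fun i => by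
      simp only [map_mul, map_star, map_zero]; exact (h i).star_s_mul_eq_zero p q g hg

theorem isCovariantPair : D.IsCovariantPair D.u D.s :=
  UnivCStar.rel_gen D.isReflected_isCovariantPair

end AlgebraicDynamicalSystem

namespace ExelLarsenSystem

variable {A : Type u} [CStarAlgebra A] {S : Type v} [Monoid S] (X : ExelLarsenSystem A S)

/-- Since π_p(b) = b · π_p(1), the norm of π_p(b) is at most ‖b‖ ‖π_p(1)‖. -/
theorem continuous_π (p : S) : Continuous (X.π p) :=
  (LinearMap.mkContinuous (X.π p) ‖X.π p 1‖ fun b => by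
    have := X.norm_π_mul_le p b 1
    rwa [mul_one, mul_comm] at this).continuous

end ExelLarsenSystem

namespace AlgebraicDynamicalSystem

open GroupCStar RightHilbertBimodule

variable {G : Type u} {P : Type v} [Group G] [Monoid P] (D : AlgebraicDynamicalSystem G P)

/-! ### The fibres of the product system -/

theorem continuous_π (p : P) : Continuous (D.π p) := D.exelLarsen.continuous_π p

/-- The vectors π_p(δ_g) span a dense subspace: the δ_g span a dense subspace of C*(G), and π_p is
continuous with dense range. -/
theorem fibre_induction {p : P} {q : D.productSystem.fibre p → Prop} (x : D.productSystem.fibre p)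
    (delta : ∀ g, q (D.π p (delta g))) (add : ∀ x y, q x → q y → q (x + y))
    (smul : ∀ (c : ℂ) x, q x → q (c • x)) (closed : IsClosed {x | q x}) : q x := by
  refine (D.exelLarsen.denseRange_π p).induction_on (p := q) x closed fun a => ?_
  refine GroupCStar.induction (p := fun a => q (D.π p a)) a delta ?_ ?_ ?_
  · intro a b ha hb
    rw [map_add]
    exact add _ _ ha hb
  · intro c a ha
    rw [map_smul]
    exact smul _ _ ha
  · exact closed.preimage (D.continuous_π p)

theorem fibre_clm_ext {p : P} {E : Type*} [NormedAddCommGroup E] [NormedSpace ℂ E]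
    {f g : D.productSystem.fibre p →L[ℂ] E} (h : ∀ x, f (D.π p (delta x)) = g (D.π p (delta x))) :
    f = g := by
  ext z
  refine D.fibre_induction (q := fun z => f z = g z) z h ?_ ?_ ?_
  · intro x y hx hy
    rw [map_add, map_add, hx, hy]
  · intro c x hx
    rw [map_smul, map_smul, hx]
  · exact isClosed_eq f.continuous g.continuous

theorem unit_eq_π (a : GroupCStar G) : D.productSystem.unit a = D.π 1 a := rfl

theorem mul_π {p q r : P} (h : p * q = r) (a b : GroupCStar G) :
    D.productSystem.mul h (D.π p a) (D.π q b) = D.π r (a * alpha (D.θ p) b) :=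
  D.exelLarsen.mulL_π h a b

theorem mul_π_delta' {p q r : P} (h : p * q = r) (g h' : G) :
    D.productSystem.mul h (D.π p (delta g)) (D.π q (delta h')) = D.π r (delta (g * D.θ p h')) := by
  rw [mul_π, alpha_delta, delta_mul]

theorem inner_π (p : P) (a b : GroupCStar G) :
    RightHilbertBimodule.inner (A := GroupCStar G) (D.π p a : D.productSystem.fibre p) (D.π p b) =
      transfer (D.θ p) (D.injective p) (star a * b) :=
  D.exelLarsen.innerL_π p a b

theorem op_smul_π (p : P) (a b : GroupCStar G) :
    MulOpposite.op b • (D.π p a : D.productSystem.fibre p) = D.π p (a * alpha (D.θ p) b) :=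
  D.exelLarsen.rightL_π p a b

/-- The matrix units `Θ_{π_p(δ_g), π_p(δ_h)}` of `K(M_p)`. -/
def thetaDelta (p : P) (g h : G) : compacts (GroupCStar G) (D.productSystem.fibre p) :=
  thetaK (GroupCStar G) (D.π p (delta g)) (D.π p (delta h))

theorem thetaDelta_apply (p : P) (g h x : G) :
    (D.thetaDelta p g h).1 (D.π p (delta x)) =
      D.π p (delta g * alpha (D.θ p) (transfer (D.θ p) (D.injective p) (delta (h⁻¹ * x)))) := by
  refine (theta_apply _ _ _).trans ?_
  rw [inner_π, op_smul_π, star_delta, ← delta_mul]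

/-- Together with `thetaDelta_notMem` this describes a matrix unit completely: it translates the
left coset hθ_p(G) onto gθ_p(G) and annihilates the vectors of all other cosets. -/
theorem thetaDelta_mem (p : P) (g h k : G) :
    (D.thetaDelta p g h).1 (D.π p (delta (h * D.θ p k))) = D.π p (delta (g * D.θ p k)) := by
  rw [thetaDelta_apply, inv_mul_cancel_left, transfer_delta_map, alpha_delta, delta_mul]

theorem thetaDelta_notMem (p : P) {g h x : G} (hx : h⁻¹ * x ∉ Set.range (D.θ p)) :
    (D.thetaDelta p g h).1 (D.π p (delta x)) = 0 := by
  rw [thetaDelta_apply, transfer_delta_of_notMem _ _ hx, map_zero, mul_zero, map_zero]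

/-- Θ_{ξ,η} is linear in ξ, conjugate linear in η and continuous in each, so both vectors can be
reduced to the form π_p(δ_g). -/
theorem compacts_induction {p : P}
    {q : compacts (GroupCStar G) (D.productSystem.fibre p) → Prop}
    (T : compacts (GroupCStar G) (D.productSystem.fibre p))
    (theta : ∀ g h, q (D.thetaDelta p g h)) (add : ∀ S T, q S → q T → q (S + T))
    (smul : ∀ (c : ℂ) T, q T → q (c • T)) (closed : IsClosed {T | q T}) : q T := by
  refine RightHilbertBimodule.compacts_induction (p := q) T (fun ξ η => ?_) add smul closed
  refine D.fibre_induction (q := fun ξ => q (thetaK _ ξ η)) ξ (fun g => ?_) ?_ ?_ ?_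
  · refine D.fibre_induction (q := fun η => q (thetaK _ (D.π p (delta g)) η)) η (theta g) ?_ ?_ ?_
    · intro x y hx hy
      rw [thetaK_add_right]
      exact add _ _ hx hy
    · intro c x hx
      rw [thetaK_smul_right]
      exact smul _ _ hx
    · exact closed.preimage (continuous_thetaK_right _)
  · intro x y hx hy
    rw [thetaK_add_left]
    exact add _ _ hx hy
  · intro c x hx
    rw [thetaK_smul_left]
    exact smul _ _ hx
  · exact closed.preimage (continuous_thetaK_left _)

/-! ### Compact alignment -/

/-- Every vector π_r(a) is a single product with left factor in M_p, so ι_p^r(T) acts on it in the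
way T acts on π_p(a). -/
theorem π_eq_mul {p p' r : P} (h : p * p' = r) (a : GroupCStar G) :
    D.π r a = D.productSystem.mul h (D.π p a) (D.π p' 1) := by
  rw [mul_π, map_one, mul_one]

theorem iotaK_thetaDelta_mem {p p' r : P} (h : p * p' = r) (g b k : G) :
    D.productSystem.iotaK h (D.thetaDelta p g b) (D.π r (delta (b * D.θ p k))) =
      D.π r (delta (g * D.θ p k)) := by
  rw [D.π_eq_mul h, ProductSystem.iotaK_apply, ProductSystem.iota_mul _ h (D.thetaDelta p g b).2,
    thetaDelta_mem, ← D.π_eq_mul h]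

theorem iotaK_thetaDelta_notMem {p p' r : P} (h : p * p' = r) {g b x : G}
    (hx : b⁻¹ * x ∉ Set.range (D.θ p)) :
    D.productSystem.iotaK h (D.thetaDelta p g b) (D.π r (delta x)) = 0 := by
  rw [D.π_eq_mul h, ProductSystem.iotaK_apply, ProductSystem.iota_mul _ h (D.thetaDelta p g b).2,
    D.thetaDelta_notMem p hx]
  exact DFunLike.congr_fun (map_zero (D.exelLarsen.mulL h)) _

variable {p q r p' q' : P} (h : p * p' = r) (h' : q * q' = r)

/-- The inner operator sends bθ_q(n) to aθ_q(n) = cθ_p(k)θ_q(l⁻¹n). The outer operator does not kill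
this exactly when θ_q(l⁻¹n) ∈ θ_p(G), that is, when it lies in θ_p(G) ∩ θ_q(G) = θ_r(G). The
surviving indices are therefore bθ_q(l)θ_r(m'), each sent to gθ_p(k)θ_r(m'), which is the action of
one matrix unit of M_r. -/
theorem iotaK_comp (hr : Set.range (p * ·) ∩ Set.range (q * ·) = Set.range (r * ·))
    (g a b k l : G) {c : G} (hc : c⁻¹ * a = D.θ p k * D.θ q l⁻¹) :
    D.productSystem.iotaK h (D.thetaDelta p g c) ∘L
      D.productSystem.iotaK h' (D.thetaDelta q a b) =
        D.thetaDelta r (g * D.θ p k) (b * D.θ q l) := by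
  have hra := D.range_inter p q r hr
  have hcq : ∀ n, c⁻¹ * (a * D.θ q n) = D.θ p k * D.θ q (l⁻¹ * n) := fun n => by
    rw [← mul_assoc, hc, mul_assoc, ← map_mul]
  refine D.fibre_clm_ext fun x => ?_
  rw [ContinuousLinearMap.comp_apply]
  by_cases hx : b⁻¹ * x ∈ Set.range (D.θ q)
  · obtain ⟨n, hn⟩ := hx
    obtain rfl : x = b * D.θ q n := by rw [hn, mul_inv_cancel_left]
    rw [iotaK_thetaDelta_mem]
    have hb : (b * D.θ q l)⁻¹ * (b * D.θ q n) = D.θ q (l⁻¹ * n) := by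
      rw [map_mul, map_inv]; group
    -- As this element always lies in θ_q(G), membership in θ_p(G) is equivalent to membership in
    -- θ_r(G).
    by_cases hy : D.θ q (l⁻¹ * n) ∈ Set.range (D.θ p)
    · have hy' : D.θ q (l⁻¹ * n) ∈ Set.range (D.θ r) := hra ▸ ⟨hy, Set.mem_range_self _⟩
      obtain ⟨m, hm⟩ := hy
      obtain ⟨m', hm'⟩ := hy'
      -- The index is written in the coset of `c` on which the outer operator acts, and in `e2` in
      -- the coset on which the matrix unit of M_r acts. Here θ_p(m) = θ_q(l⁻¹n) = θ_r(m').
      have e1 : a * D.θ q n = c * D.θ p (k * m) := by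
        rw [map_mul, hm, ← hcq, mul_inv_cancel_left]
      have e2 : b * D.θ q n = b * D.θ q l * D.θ r m' := by
        rw [hm', ← hb, mul_inv_cancel_left]
      rw [e1, iotaK_thetaDelta_mem, e2, thetaDelta_mem, map_mul, hm, hm', mul_assoc]
    · rw [D.iotaK_thetaDelta_notMem h, D.thetaDelta_notMem r]
      · rw [hb, ← hra]
        exact fun hh => hy hh.1
      · rw [hcq]
        rintro ⟨m, hm⟩
        exact hy ⟨k⁻¹ * m, by rw [map_mul, hm, map_inv, inv_mul_cancel_left]⟩
  -- If x ∉ bθ_q(G), the right side vanishes as well, because bθ_q(l)θ_r(G) ⊆ bθ_q(G).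
  · rw [D.iotaK_thetaDelta_notMem h' hx, map_zero, D.thetaDelta_notMem r]
    rw [← hra]
    rintro ⟨-, m, hm⟩
    exact hx ⟨l * m, by rw [map_mul, hm]; group⟩

/-- A vector surviving both operators would give c⁻¹aθ_q(n) = θ_p(m), and then c⁻¹a =
θ_p(m)θ_q(n⁻¹). -/
theorem iotaK_comp_eq_zero {g a b c : G} (hc : ¬ ∃ k l, c⁻¹ * a = D.θ p k * D.θ q l⁻¹) :
    D.productSystem.iotaK h (D.thetaDelta p g c) ∘L
      D.productSystem.iotaK h' (D.thetaDelta q a b) = 0 := by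
  refine D.fibre_clm_ext fun x => ?_
  rw [ContinuousLinearMap.comp_apply, zero_apply]
  by_cases hx : b⁻¹ * x ∈ Set.range (D.θ q)
  · obtain ⟨n, hn⟩ := hx
    obtain rfl : x = b * D.θ q n := by rw [hn, mul_inv_cancel_left]
    rw [iotaK_thetaDelta_mem, iotaK_thetaDelta_notMem]
    rintro ⟨m, hm⟩
    refine hc ⟨m, n, ?_⟩
    rw [hm, map_inv]
    group
  · rw [D.iotaK_thetaDelta_notMem h' hx, map_zero]

/-- The compact operators form a closed subspace and (T, T') ↦ ι(T)ι(T') is bilinear and separately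
continuous. So only matrix units matter, and their products are again matrix units or 0. -/
theorem isCompactlyAligned : D.productSystem.IsCompactlyAligned := by
  intro p q r p' q' h h' hr T hT T' hT'
  have hcl : IsClosed (compacts (GroupCStar G) (D.productSystem.fibre r) :
      Set (D.productSystem.fibre r →L[ℂ] D.productSystem.fibre r)) :=
    Submodule.isClosed_topologicalClosure _
  refine D.compacts_induction
    (q := fun T => D.productSystem.iotaK h T ∘L D.productSystem.iota h' T' ∈
      compacts (GroupCStar G) (D.productSystem.fibre r)) ⟨T, hT⟩ (fun g c => ?_) ?_ ?_ ?_
  · refine D.compacts_induction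
      (q := fun T' => D.productSystem.iotaK h (D.thetaDelta p g c) ∘L D.productSystem.iotaK h' T' ∈
        compacts (GroupCStar G) (D.productSystem.fibre r)) ⟨T', hT'⟩ (fun a b => ?_) ?_ ?_ ?_
    · by_cases hc : ∃ k l, c⁻¹ * a = D.θ p k * D.θ q l⁻¹
      · obtain ⟨k, l, hc⟩ := hc
        rw [D.iotaK_comp h h' hr g a b k l hc]
        exact Subtype.prop _
      · rw [D.iotaK_comp_eq_zero h h' hc]
        exact zero_mem _
    · intro S T hS hT
      rw [map_add, ContinuousLinearMap.comp_add]
      exact add_mem hS hT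
    · intro z T hT
      rw [map_smul, ContinuousLinearMap.comp_smul]
      exact Submodule.smul_mem _ _ hT
    · exact hcl.preimage (by fun_prop)
  · intro S T hS hT
    rw [map_add, ContinuousLinearMap.add_comp]
    exact add_mem hS hT
  · intro z T hT
    rw [map_smul, ContinuousLinearMap.smul_comp]
    exact Submodule.smul_mem _ _ hT
  · exact hcl.preimage (by fun_prop)

theorem mulK_thetaDelta (hM : D.productSystem.IsCompactlyAligned)
    (hr : Set.range (p * ·) ∩ Set.range (q * ·) = Set.range (r * ·))
    (g a b k l : G) {c : G} (hc : c⁻¹ * a = D.θ p k * D.θ q l⁻¹) :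
    D.productSystem.mulK hM h h' hr (D.thetaDelta p g c) (D.thetaDelta q a b) =
      D.thetaDelta r (g * D.θ p k) (b * D.θ q l) :=
  Subtype.ext (D.iotaK_comp h h' hr g a b k l hc)

theorem mulK_thetaDelta_eq_zero (hM : D.productSystem.IsCompactlyAligned)
    (hr : Set.range (p * ·) ∩ Set.range (q * ·) = Set.range (r * ·))
    {g a b c : G} (hc : ¬ ∃ k l, c⁻¹ * a = D.θ p k * D.θ q l⁻¹) :
    D.productSystem.mulK hM h h' hr (D.thetaDelta p g c) (D.thetaDelta q a b) = 0 :=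
  Subtype.ext (D.iotaK_comp_eq_zero h h' hc)

end AlgebraicDynamicalSystem

namespace AlgebraicDynamicalSystem

open GroupCStar RightHilbertBimodule

variable {G : Type u} {P : Type v} [Group G] [Monoid P] (D : AlgebraicDynamicalSystem G P)

/-! ### The representation of the product system defined by a covariant pair -/

namespace IsCovariantPair

variable {D} {B : Type w} [CStarAlgebra B] {u : G → B} {s : P → B} (h : D.IsCovariantPair u s)

include h in
theorem star_u (g : G) : star (u g) = u g⁻¹ := by
  have h1 := (h.u_unitary g).1
  calc star (u g) = star (u g) * (u g * u g⁻¹) := by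
        rw [← h.u_mul, mul_inv_cancel, h.u_one, mul_one]
    _ = u g⁻¹ := by rw [← mul_assoc, h1, one_mul]

/-- The *-homomorphism of `C*(G)` defined by `u`. -/
def intU : GroupCStar G →⋆ₐ[ℂ] B :=
  lift { toFun := u, map_one' := h.u_one, map_mul' := h.u_mul } h.star_u

theorem intU_delta (g : G) : h.intU (delta g) = u g := lift_delta _ _ g

theorem continuous_intU : Continuous h.intU :=
  continuous_of_starHom h.intU.toNonUnitalStarAlgHom

theorem s_mul_intU (p : P) (a : GroupCStar G) :
    s p * h.intU a = h.intU (alpha (D.θ p) a) * s p := by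
  have h1 := h.continuous_intU
  have h2 := continuous_alpha (D.θ p)
  refine GroupCStar.induction (p := fun a => s p * h.intU a = h.intU (alpha (D.θ p) a) * s p) a
    ?_ ?_ ?_ ?_
  · intro g
    rw [alpha_delta, intU_delta, intU_delta, h.s_mul_u]
  · intro a b ha hb
    rw [map_add, map_add, map_add, mul_add, add_mul, ha, hb]
  · intro c a ha
    rw [map_smul, map_smul, map_smul, mul_smul_comm, smul_mul_assoc, ha]
  · exact isClosed_eq (by fun_prop) (by fun_prop)

include h in
-- This mirrors the product π_p(δ_g)π_q(δ_k) = π_{pq}(δ_{gθ_p(k)}) of M; it is also used backwards,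
-- to split off a factor from s_r.
theorem u_mul_θ_mul_s (p q : P) (g k : G) :
    u (g * D.θ p k) * s (p * q) = u g * s p * (u k * s q) := by
  rw [h.u_mul, h.s_mul, mul_assoc (u g), ← mul_assoc _ (s p), ← h.s_mul_u]
  simp only [mul_assoc]

include h in
-- This is the defining relation with q = r = p, p' = q' = 1, k = g and l = 1.
theorem star_s_mul_u_mul_s (p : P) (g : G) : star (s p) * u (D.θ p g) * s p = u g := by
  rw [h.star_s_mul p p p 1 1 (D.θ p g) g 1 (Set.inter_self _) (mul_one p) (mul_one p)
    (by rw [inv_one, map_one, mul_one]), h.s_one, h.u_one, star_one, mul_one, mul_one, mul_one]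

include h in
-- For q = p a factorization θ_p(k)θ_p(l⁻¹) lies in θ_p(G), so the vanishing case of the relations
-- applies.
theorem star_s_mul_u_mul_s_of_notMem (p : P) {g : G} (hg : g ∉ Set.range (D.θ p)) :
    star (s p) * u g * s p = 0 := by
  refine h.star_s_mul_eq_zero p p g ?_
  rintro ⟨-, -, -, k, l, -, -, -, rfl⟩
  exact hg ⟨k * l⁻¹, map_mul _ _ _⟩

/-- Compression by s_p implements the transfer operator; it is checked on the δ_g and extended by
continuity. This is what makes the representation of M compatible with inner products. -/
theorem star_s_mul_intU_mul_s (p : P) (a : GroupCStar G) :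
    star (s p) * h.intU a * s p = h.intU (transfer (D.θ p) (D.injective p) a) := by
  have h1 := h.continuous_intU
  refine GroupCStar.induction
    (p := fun a => star (s p) * h.intU a * s p = h.intU (transfer (D.θ p) (D.injective p) a)) a
    ?_ ?_ ?_ ?_
  · intro g
    rw [intU_delta]
    by_cases hg : g ∈ Set.range (D.θ p)
    · obtain ⟨k, rfl⟩ := hg
      rw [transfer_delta_map, intU_delta, h.star_s_mul_u_mul_s]
    · rw [transfer_delta_of_notMem _ _ hg, map_zero, h.star_s_mul_u_mul_s_of_notMem p hg]
  · intro a b ha hb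
    rw [map_add, map_add, map_add, mul_add, add_mul, ha, hb]
  · intro c a ha
    rw [map_smul, map_smul, map_smul, mul_smul_comm, smul_mul_assoc, ha]
  · exact isClosed_eq (by fun_prop) (by fun_prop)

theorem star_intU_mul_s_mul (p : P) (a b : GroupCStar G) :
    star (h.intU a * s p) * (h.intU b * s p) =
      h.intU (transfer (D.θ p) (D.injective p) (star a * b)) := by
  rw [← h.star_s_mul_intU_mul_s, star_mul, map_mul, map_star]
  simp only [mul_assoc]

/-- The squared norms are those of u(L_p(a*a)) and L_p(a*a), and u is contractive. Hence u(a)s_p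
depends only on π_p(a), and the map extends to all of M_p. -/
theorem norm_intU_mul_s_le (p : P) (a : GroupCStar G) : ‖h.intU a * s p‖ ≤ ‖D.π p a‖ := by
  refine le_of_sq_le_sq ?_ (norm_nonneg _)
  rw [sq, ← CStarRing.norm_star_mul_self, h.star_intU_mul_s_mul]
  exact (NonUnitalStarAlgHom.norm_apply_le h.intU _).trans_eq (D.exelLarsen.norm_π_sq p a).symm

/-- The maps `M_p → B`, `π_p(a) ↦ u(a) s_p`. -/
def rep (p : P) : D.productSystem.fibre p →L[ℂ] B :=
  (LinearMap.mulRight ℂ (s p) ∘ₗ h.intU.toAlgHom.toLinearMap).extendOfNorm (D.π p)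

theorem rep_π (p : P) (a : GroupCStar G) : h.rep p (D.π p a) = h.intU a * s p :=
  LinearMap.extendOfNorm_eq (f := LinearMap.mulRight ℂ (s p) ∘ₗ h.intU.toAlgHom.toLinearMap)
    (e := D.π p) (D.exelLarsen.denseRange_π p) ⟨1, fun a => by
      rw [one_mul]; exact h.norm_intU_mul_s_le p a⟩ a

theorem rep_π_delta (p : P) (g : G) : h.rep p (D.π p (delta g)) = u g * s p := by
  rw [rep_π, intU_delta]

theorem rep_unit (a : GroupCStar G) : h.rep 1 (D.productSystem.unit a) = h.intU a := by
  rw [unit_eq_π, rep_π, h.s_one, mul_one]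

theorem isRepresentation_rep : D.productSystem.IsRepresentation fun p x => h.rep p x where
  map_add p x y := map_add _ x y
  map_smul p c x := map_smul _ c x
  map_unit_mul a b := by rw [rep_unit, rep_unit, rep_unit, map_mul]
  map_unit_star a := by rw [rep_unit, rep_unit, map_star]
  map_mul {p q r} hr x y := by
    change h.rep p x * h.rep q y = h.rep r (D.exelLarsen.mulL hr x y)
    refine D.exelLarsen.fibre_induction
      (P := fun x => h.rep p x * h.rep q y = h.rep r (D.exelLarsen.mulL hr x y)) x ?_ fun a => ?_
    · exact isClosed_eq ((h.rep p).continuous.mul continuous_const)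
        ((h.rep r).continuous.comp ((D.exelLarsen.mulL hr).flip y).continuous)
    · refine D.exelLarsen.fibre_induction (P := fun y => h.rep p (D.π p a) * h.rep q y =
        h.rep r (D.exelLarsen.mulL hr (D.π p a) y)) y ?_ fun b => ?_
      · exact isClosed_eq (continuous_const.mul (h.rep q).continuous)
          ((h.rep r).continuous.comp (D.exelLarsen.mulL hr (D.π p a)).continuous)
      refine (congrArg₂ (· * ·) (h.rep_π p a) (h.rep_π q b)).trans (Eq.symm ?_)
      refine (congrArg (h.rep r) (D.mul_π hr a b)).trans ?_
      -- Moving `s p` past `h.intU b` replaces b by α_p(b), which is the twist in the product of M.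
      subst hr
      rw [rep_π, map_mul, h.s_mul, mul_assoc, ← mul_assoc _ (s p), ← h.s_mul_intU]
      simp only [mul_assoc]
  star_mul p x y := by
    rw [rep_unit]
    have h1 := h.continuous_intU
    change star (h.rep p x) * h.rep p y = h.intU (D.exelLarsen.innerL p x y)
    refine D.exelLarsen.fibre_induction (P := fun x => star (h.rep p x) * h.rep p y =
      h.intU (D.exelLarsen.innerL p x y)) x ?_ fun a => ?_
    · exact isClosed_eq ((h.rep p).continuous.star.mul continuous_const)
        (h1.comp (by fun_prop))
    · refine D.exelLarsen.fibre_induction (P := fun y => star (h.rep p (D.π p a)) * h.rep p y =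
        h.intU (D.exelLarsen.innerL p (D.π p a) y)) y ?_ fun b => ?_
      · exact isClosed_eq (continuous_const.mul (h.rep p).continuous)
          (h1.comp (by fun_prop))
      refine (congrArg₂ (fun x y => star x * y) (h.rep_π p a) (h.rep_π p b)).trans (Eq.symm ?_)
      refine (congrArg h.intU (D.inner_π p a b)).trans ?_
      rw [h.star_intU_mul_s_mul]

end IsCovariantPair

/-! ### Nica covariance in terms of the generators -/

section

variable {D} {B : Type w} [NonUnitalCStarAlgebra B] {ψ : ∀ p, D.productSystem.fibre p → B}

theorem psiK_thetaDelta (hψ : D.productSystem.IsRepresentation ψ) (p : P) (g h : G) :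
    D.productSystem.psiK ψ p (D.thetaDelta p g h) =
      ψ p (D.π p (delta g)) * star (ψ p (D.π p (delta h))) :=
  hψ.psiK_theta p _ _

/-- Each tuple lists additivity, homogeneity and continuity in either variable. Separate continuity
suffices, since the arguments are reduced to matrix units one at a time. -/
theorem bilinear_ext {p q : P} {F F' : compacts (GroupCStar G) (D.productSystem.fibre p) →
      compacts (GroupCStar G) (D.productSystem.fibre q) → B}
    (h : ∀ g c a b, F (D.thetaDelta p g c) (D.thetaDelta q a b) =
      F' (D.thetaDelta p g c) (D.thetaDelta q a b))
    (hF : (∀ S T T', F (S + T) T' = F S T' + F T T') ∧ (∀ (c : ℂ) T T', F (c • T) T' = c • F T T') ∧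
      (∀ T', Continuous fun T => F T T') ∧ (∀ T S T', F T (S + T') = F T S + F T T') ∧
      (∀ (c : ℂ) T T', F T (c • T') = c • F T T') ∧ (∀ T, Continuous fun T' => F T T'))
    (hF' : (∀ S T T', F' (S + T) T' = F' S T' + F' T T') ∧
      (∀ (c : ℂ) T T', F' (c • T) T' = c • F' T T') ∧
      (∀ T', Continuous fun T => F' T T') ∧ (∀ T S T', F' T (S + T') = F' T S + F' T T') ∧
      (∀ (c : ℂ) T T', F' T (c • T') = c • F' T T') ∧ (∀ T, Continuous fun T' => F' T T'))
    (T : compacts (GroupCStar G) (D.productSystem.fibre p))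
    (T' : compacts (GroupCStar G) (D.productSystem.fibre q)) : F T T' = F' T T' := by
  obtain ⟨h1, h2, h3, h4, h5, h6⟩ := hF
  obtain ⟨h1', h2', h3', h4', h5', h6'⟩ := hF'
  refine D.compacts_induction (q := fun T => F T T' = F' T T') T (fun g c => ?_) ?_ ?_
    (isClosed_eq (h3 T') (h3' T'))
  · refine D.compacts_induction (q := fun T' => F (D.thetaDelta p g c) T' =
      F' (D.thetaDelta p g c) T') T' (h g c) ?_ ?_ (isClosed_eq (h6 _) (h6' _))
    · intro S T hS hT
      rw [h4, h4', hS, hT]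
    · intro c T hT
      rw [h5, h5', hT]
  · intro S T hS hT
    rw [h1, h1', hS, hT]
  · intro c T hT
    rw [h2, h2', hT]

/-- Both covariance conditions are bilinear in (T, T') and can be tested on matrix units, where
`mulK` is known. The hypothesis `hzero` serves twice: when p and q have no least common multiple,
and when they have one but c⁻¹a does not factor. -/
theorem isNicaCovariant_of_delta (hM : D.productSystem.IsCompactlyAligned)
    (hψ : D.productSystem.IsRepresentation ψ)
    (hmul : ∀ (p q r : P) (g c a b k l : G),
      Set.range (p * ·) ∩ Set.range (q * ·) = Set.range (r * ·) →
      c⁻¹ * a = D.θ p k * D.θ q l⁻¹ →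
      ψ p (D.π p (delta g)) * star (ψ p (D.π p (delta c))) *
        (ψ q (D.π q (delta a)) * star (ψ q (D.π q (delta b)))) =
      ψ r (D.π r (delta (g * D.θ p k))) * star (ψ r (D.π r (delta (b * D.θ q l)))))
    (hzero : ∀ (p q : P) (g c a b : G),
      (¬ ∃ (r : P) (k l : G), Set.range (p * ·) ∩ Set.range (q * ·) = Set.range (r * ·) ∧
        c⁻¹ * a = D.θ p k * D.θ q l⁻¹) →
      ψ p (D.π p (delta g)) * star (ψ p (D.π p (delta c))) *
        (ψ q (D.π q (delta a)) * star (ψ q (D.π q (delta b)))) = 0) :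
    ProductSystem.IsNicaCovariant hM ψ := by
  refine { hψ with psiK_mul := ?_, psiK_mul_eq_zero := ?_ }
  · intro p q r p' q' h h' hr T T'
    change _ = D.productSystem.psiK ψ r (D.productSystem.mulK hM h h' hr T T')
    refine bilinear_ext
      (F := fun T T' => D.productSystem.psiK ψ p T * D.productSystem.psiK ψ q T')
      (F' := fun T T' => D.productSystem.psiK ψ r (D.productSystem.mulK hM h h' hr T T'))
      (fun g c a b => ?_) ⟨?_, ?_, ?_, ?_, ?_, ?_⟩ ⟨?_, ?_, ?_, ?_, ?_, ?_⟩ T T'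
    · rw [psiK_thetaDelta hψ, psiK_thetaDelta hψ]
      by_cases hc : ∃ k l, c⁻¹ * a = D.θ p k * D.θ q l⁻¹
      · obtain ⟨k, l, hc⟩ := hc
        rw [D.mulK_thetaDelta h h' hM hr g a b k l hc, psiK_thetaDelta hψ,
          hmul p q r g c a b k l hr hc]
      · rw [D.mulK_thetaDelta_eq_zero h h' hM hr hc, map_zero, hzero]
        rintro ⟨-, k, l, -, hkl⟩
        exact hc ⟨k, l, hkl⟩
    · intro S T T'; rw [map_add, add_mul]
    · intro c T T'; rw [map_smul, smul_mul_assoc]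
    · intro T'; fun_prop
    · intro T S T'; rw [map_add, mul_add]
    · intro c T T'; rw [map_smul, mul_smul_comm]
    · intro T; fun_prop
    · intro S T T'; rw [ProductSystem.mulK_add_left, map_add]
    · intro c T T'; rw [ProductSystem.mulK_smul_left, map_smul]
    · intro T'
      exact (ContinuousLinearMap.continuous _).comp
        (ProductSystem.continuous_mulK_left hM h h' hr T')
    · intro T S T'; rw [ProductSystem.mulK_add_right, map_add]
    · intro c T T'; rw [ProductSystem.mulK_smul_right, map_smul]
    · intro T
      exact (ContinuousLinearMap.continuous _).comp
        (ProductSystem.continuous_mulK_right hM h h' hr T)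
  · intro p q hr T T'
    refine bilinear_ext
      (F := fun T T' => D.productSystem.psiK ψ p T * D.productSystem.psiK ψ q T')
      (F' := fun _ _ => 0)
      (fun g c a b => ?_) ⟨?_, ?_, ?_, ?_, ?_, ?_⟩ ⟨?_, ?_, ?_, ?_, ?_, ?_⟩ T T'
    · rw [psiK_thetaDelta hψ, psiK_thetaDelta hψ, hzero]
      rintro ⟨r, -, -, h, -⟩
      exact hr ⟨r, h⟩
    · intro S T T'; rw [map_add, add_mul]
    · intro c T T'; rw [map_smul, smul_mul_assoc]
    · intro T'; fun_prop
    · intro T S T'; rw [map_add, mul_add]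
    · intro c T T'; rw [map_smul, mul_smul_comm]
    · intro T; fun_prop
    all_goals intros; first | exact continuous_const | simp

end

/-- The element r = r · 1 belongs to rP, hence to both pP and qP. -/
theorem exists_mul_eq {p q r : P}
    (hr : Set.range (p * ·) ∩ Set.range (q * ·) = Set.range (r * ·)) :
    ∃ p' q', p * p' = r ∧ q * q' = r := by
  have h1 : r ∈ Set.range (p * ·) ∩ Set.range (q * ·) := hr ▸ ⟨1, mul_one r⟩
  obtain ⟨⟨p', hp⟩, q', hq⟩ := h1
  exact ⟨p', q', hp, hq⟩

/-- In a product of two matrix units the inner factor is s_p* u_{c⁻¹a} s_q, to which the defining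
relations apply directly. -/
theorem IsCovariantPair.isNicaCovariant_rep {D : AlgebraicDynamicalSystem G P} {B : Type w}
    [CStarAlgebra B] {u : G → B} {s : P → B} (h : D.IsCovariantPair u s)
    (hM : D.productSystem.IsCompactlyAligned) :
    ProductSystem.IsNicaCovariant hM fun p x => h.rep p x := by
  have e : ∀ (p q : P) (g c a b : G), u g * s p * star (u c * s p) * (u a * s q * star (u b * s q))
      = u g * s p * (star (s p) * u (c⁻¹ * a) * s q) * star (u b * s q) := by
    intro p q g c a b
    rw [h.u_mul, star_mul, h.star_u]
    simp only [mul_assoc]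
  refine isNicaCovariant_of_delta hM h.isRepresentation_rep ?_ ?_
  · intro p q r g c a b k l hr hc
    obtain ⟨p', q', hp, hq⟩ := exists_mul_eq hr
    simp only [rep_π_delta]
    rw [e, h.star_s_mul p q r p' q' _ k l hr hp hq hc]
    -- The same r is split as pp' in the left factor and as qq' in the right one, so that u_g s_p
    -- and u_b s_q can be extracted.
    subst hp
    rw [h.u_mul_θ_mul_s, ← hq, h.u_mul_θ_mul_s, star_mul (u b * s q), star_mul (u l)]
    simp only [mul_assoc]
  · intro p q g c a b hc
    simp only [rep_π_delta]
    rw [e, h.star_s_mul_eq_zero, mul_zero, zero_mul]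
    rintro ⟨r, -, -, k, l, hr, -, -, hkl⟩
    exact hc ⟨r, k, l, hr, hkl⟩

end AlgebraicDynamicalSystem

/-- A C*-algebra with a two-sided unit is a unital C*-algebra. -/
@[reducible] def cstarAlgebraOfUnit {B : Type w} [inst : NonUnitalCStarAlgebra B] (e : B)
    (h₁ : ∀ b, e * b = b) (h₂ : ∀ b, b * e = b) : CStarAlgebra B :=
  letI i1 : NormedRing B :=
    { (inferInstance : NonUnitalNormedRing B) with
      one := e
      one_mul := h₁
      mul_one := h₂ }
  letI i2 : NormedAlgebra ℂ B :=
    { Algebra.ofModule (R := ℂ) (A := B) smul_mul_assoc mul_smul_comm with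
      norm_smul_le := norm_smul_le }
  { i1, i2, inst with }

/-! ### The unit defined by ψ_1(1), and homomorphisms of NT(M). -/

namespace ProductSystem

open RightHilbertBimodule

variable {A : Type u} [CStarAlgebra A] {S : Type v} [Monoid S] {M : ProductSystem.{u, v, w} A S}

section Unit

variable {B : Type*} [NonUnitalCStarAlgebra B] {ψ : ∀ p, M.fibre p → B}
  (hψ : M.IsRepresentation ψ)

include hψ

theorem IsRepresentation.unit_one_mul (p : S) (x : M.fibre p) :
    ψ 1 (M.unit 1) * ψ p x = ψ p x := by
  rw [hψ.map_mul (one_mul p), M.unit_mul, one_smul]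

theorem IsRepresentation.mul_unit_one (p : S) (x : M.fibre p) :
    ψ p x * ψ 1 (M.unit 1) = ψ p x := by
  rw [hψ.map_mul (mul_one p), M.mul_unit, MulOpposite.op_one, one_smul]

theorem IsRepresentation.star_unit_one : star (ψ 1 (M.unit 1)) = ψ 1 (M.unit 1) := by
  rw [← hψ.map_unit_star, star_one]

end Unit

/-! ### The Nica-Toeplitz algebra -/

section NT

variable (hM : M.IsCompactlyAligned)

/-- The inclusion of `NT(M)` into the unital universal algebra. -/
def ntIncl : M.NT hM →⋆ₙₐ[ℂ] M.NTUnital hM :=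
  NonUnitalStarSubalgebraClass.subtype (M.ntSubalgebra hM)

theorem ntIncl_injective : Function.Injective (M.ntIncl hM) := Subtype.val_injective

/-- The maps ψ^{(p)} of `j` are extensions formed inside NT(M) itself. Covariance is reflected along
the injective inclusion into `NTUnital`, where it is known. -/
theorem isNicaCovariant_j : IsNicaCovariant hM (M.j hM) :=
  .of_jointlyInjective (fun _ : Unit => M.ntIncl hM)
    (fun _ hb => M.ntIncl_injective hM ((hb ()).trans (map_zero _).symm))
    fun _ => M.isNicaCovariant_preJ hM

variable {hM} in
-- NT(M) is a closure inside `NTUnital`, so the *-algebra generated by the j_p(x) is dense in it as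
-- a space of its own.
theorem nt_induction {q : M.NT hM → Prop} (b : M.NT hM) (j : ∀ p x, q (M.j hM p x))
    (zero : q 0) (add : ∀ a b, q a → q b → q (a + b)) (mul : ∀ a b, q a → q b → q (a * b))
    (smul : ∀ (c : ℂ) a, q a → q (c • a)) (star : ∀ a, q a → q (star a))
    (closed : IsClosed {b | q b}) : q b := by
  set N := NonUnitalStarAlgebra.adjoin ℂ
    (Set.range fun z : Σ p, M.fibre p => M.preJ hM z.1 z.2) with hN
  have hle : N ≤ M.ntSubalgebra hM := NonUnitalStarSubalgebra.le_topologicalClosure _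
  have h1 : ∀ x (hx : x ∈ N), q ⟨x, hle hx⟩ := by
    intro x hx
    induction hx using NonUnitalStarAlgebra.adjoin_induction with
    | mem x hx =>
      obtain ⟨z, rfl⟩ := hx
      exact j z.1 z.2
    | add x y hx hy h h' => exact add _ _ h h'
    | zero => exact zero
    | mul x y hx hy h h' => exact mul _ _ h h'
    | smul c x hx h => exact smul c _ h
    | star x hx h => exact star _ h
  have h2 : Dense {b : M.ntSubalgebra hM | b.1 ∈ N} := by
    rw [Subtype.dense_iff]
    intro x hx
    have h3 : x ∈ closure (N : Set (M.NTUnital hM)) := hx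
    have h4 : (N : Set (M.NTUnital hM)) ⊆ Subtype.val '' {b : M.ntSubalgebra hM | b.1 ∈ N} :=
      fun y hy => ⟨⟨y, hle hy⟩, hy, rfl⟩
    exact closure_mono h4 h3
  exact closed.closure_subset_iff.2 (fun b hb => h1 b.1 hb) (h2 b)

/-- On generators this holds because 1 ∈ A acts trivially on both sides of each M_p. The condition
passes to sums, products, adjoints and limits. -/
theorem j_one_mul (b : M.NT hM) : M.j hM 1 (M.unit 1) * b = b ∧ b * M.j hM 1 (M.unit 1) = b := by
  have hj := (M.isNicaCovariant_j hM).toIsRepresentation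
  refine nt_induction (q := fun b => M.j hM 1 (M.unit 1) * b = b ∧ b * M.j hM 1 (M.unit 1) = b)
    b ?_ ?_ ?_ ?_ ?_ ?_ ?_
  · exact fun p x => ⟨hj.unit_one_mul p x, hj.mul_unit_one p x⟩
  · exact ⟨mul_zero _, zero_mul _⟩
  · exact fun a b ha hb => ⟨by rw [_root_.mul_add, ha.1, hb.1], by rw [_root_.add_mul, ha.2, hb.2]⟩
  · exact fun a b ha hb => ⟨by rw [← _root_.mul_assoc, ha.1], by rw [_root_.mul_assoc, hb.2]⟩
  · exact fun c a ha => ⟨by rw [mul_smul_comm, ha.1], by rw [smul_mul_assoc, ha.2]⟩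
  -- As j_1(1) is self-adjoint, taking adjoints exchanges the left and the right identity; hence the
  -- two are proved together.
  · intro a ha
    have h1 := congrArg star ha.1
    have h2 := congrArg star ha.2
    rw [star_mul, hj.star_unit_one] at h1 h2
    exact ⟨h2, h1⟩
  · exact (isClosed_eq (by fun_prop) (by fun_prop)).inter (isClosed_eq (by fun_prop) (by fun_prop))

variable {hM} in
theorem nt_hom_ext {B : Type*} [NonUnitalCStarAlgebra B] {φ χ : M.NT hM →⋆ₙₐ[ℂ] B}
    (h : ∀ p x, φ (M.j hM p x) = χ (M.j hM p x)) : φ = χ := by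
  ext b
  refine nt_induction (q := fun b => φ b = χ b) b h ?_ ?_ ?_ ?_ ?_ ?_
  · rw [map_zero, map_zero]
  · intro a b ha hb
    rw [_root_.map_add, _root_.map_add, ha, hb]
  · intro a b ha hb
    rw [_root_.map_mul, _root_.map_mul, ha, hb]
  · intro c a ha
    rw [_root_.map_smul, _root_.map_smul, ha]
  · intro a ha
    rw [map_star, map_star, ha]
  · exact isClosed_eq (continuous_of_starHom φ) (continuous_of_starHom χ)

theorem exists_ntUnital_hom {B : Type max v w} [CStarAlgebra B] {ψ : ∀ p, M.fibre p → B}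
    (hψ : IsNicaCovariant hM ψ) :
    ∃ Φ : M.NTUnital hM →⋆ₐ[ℂ] B, ∀ p x, Φ (M.preJ hM p x) = ψ p x :=
  ⟨UnivCStar.lift (isReflected_isNicaCovariant hM) (f := fun z : Σ p, M.fibre p => ψ z.1 z.2) hψ,
    fun p x => UnivCStar.lift_gen (hRel := fun z => ⟨‖z.2‖, fun _ _ _ hf => hf.norm_le z.1 z.2⟩)
      (isReflected_isNicaCovariant hM) (f := fun z : Σ p, M.fibre p => ψ z.1 z.2) hψ ⟨p, x⟩⟩

/-- The universal property of `NT(M)`. -/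
theorem exists_nt_hom {B : Type max v w} [CStarAlgebra B] {ψ : ∀ p, M.fibre p → B}
    (hψ : IsNicaCovariant hM ψ) :
    ∃ χ : M.NT hM →⋆ₙₐ[ℂ] B, ∀ p x, χ (M.j hM p x) = ψ p x := by
  obtain ⟨Φ, hΦ⟩ := exists_ntUnital_hom hM hψ
  exact ⟨Φ.toNonUnitalStarAlgHom.comp (M.ntIncl hM), hΦ⟩

end NT

end ProductSystem

namespace AlgebraicDynamicalSystem

open GroupCStar RightHilbertBimodule

variable {G : Type u} {P : Type v} [Group G] [Monoid P] {D : AlgebraicDynamicalSystem G P}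

/-! ### The covariant pair defined by a Nica covariant representation -/

section

variable {B : Type w} [NonUnitalCStarAlgebra B] {ψ : ∀ p, D.productSystem.fibre p → B}

section Rep

variable (hψ : D.productSystem.IsRepresentation ψ)

include hψ

theorem rep_mul_delta {p q r : P} (h : p * q = r) (g k : G) :
    ψ p (D.π p (delta g)) * ψ q (D.π q (delta k)) = ψ r (D.π r (delta (g * D.θ p k))) := by
  rw [hψ.map_mul h, mul_π_delta']

theorem star_rep_one_delta (g : G) :
    star (ψ 1 (D.π 1 (delta g))) = ψ 1 (D.π 1 (delta g⁻¹)) :=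
  ((hψ.map_unit_star (delta g)).symm.trans (by rw [star_delta]; rfl))

/-- The inner product is L_p(δ_{g⁻¹}δ_{gθ_p(k)}) = δ_k. The case k = 1 says that ψ_p(π_p(δ_g)) is an
isometry relative to ψ_1(1). -/
theorem star_rep_delta_mul (p : P) (g k : G) :
    star (ψ p (D.π p (delta g))) * ψ p (D.π p (delta (g * D.θ p k))) =
      ψ 1 (D.π 1 (delta k)) := by
  rw [hψ.star_mul, inner_π, star_delta, ← delta_mul, inv_mul_cancel_left, transfer_delta_map]
  rfl

theorem rep_mul_star_mul_self (p : P) (x : D.productSystem.fibre p) (g : G) :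
    x = D.π p (delta g) → ψ p x * star (ψ p x) * ψ p x = ψ p x := by
  rintro rfl
  have h1 := star_rep_delta_mul hψ p g 1
  rw [map_one, mul_one] at h1
  rw [mul_assoc, h1, rep_mul_delta hψ (mul_one p), map_one, mul_one]

end Rep

variable {hM : D.productSystem.IsCompactlyAligned} (hψ : ProductSystem.IsNicaCovariant hM ψ)

include hψ

/-- This is Nica covariance read on a pair of matrix units, whose product in K(M_r) was computed in
`mulK_thetaDelta`. -/
theorem delta_mul_star_mul_delta (p q r : P) (g c a b k l : G)
    (hr : Set.range (p * ·) ∩ Set.range (q * ·) = Set.range (r * ·))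
    (hc : c⁻¹ * a = D.θ p k * D.θ q l⁻¹) :
    ψ p (D.π p (delta g)) * star (ψ p (D.π p (delta c))) *
      (ψ q (D.π q (delta a)) * star (ψ q (D.π q (delta b)))) =
    ψ r (D.π r (delta (g * D.θ p k))) * star (ψ r (D.π r (delta (b * D.θ q l)))) := by
  have hrep := hψ.toIsRepresentation
  obtain ⟨p', q', h, h'⟩ := exists_mul_eq hr
  have h1 := hψ.psiK_mul p q r p' q' h h' hr (D.thetaDelta p g c) (D.thetaDelta q a b)
  change _ = D.productSystem.psiK ψ r (D.productSystem.mulK hM h h' hr _ _) at h1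
  rwa [D.mulK_thetaDelta h h' hM hr g a b k l hc, psiK_thetaDelta hrep, psiK_thetaDelta hrep,
    psiK_thetaDelta hrep] at h1

/-- There are two reasons to vanish: without a least common multiple of p and q, Nica covariance
gives 0 directly; with one, the operators ι already have product 0 on M_r. -/
theorem delta_mul_star_mul_delta_eq_zero (p q : P) (g c a b : G)
    (hc : ¬ ∃ (r : P) (k l : G), Set.range (p * ·) ∩ Set.range (q * ·) = Set.range (r * ·) ∧
        c⁻¹ * a = D.θ p k * D.θ q l⁻¹) :
    ψ p (D.π p (delta g)) * star (ψ p (D.π p (delta c))) *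
      (ψ q (D.π q (delta a)) * star (ψ q (D.π q (delta b)))) = 0 := by
  have hrep := hψ.toIsRepresentation
  rw [← psiK_thetaDelta hrep, ← psiK_thetaDelta hrep]
  by_cases hr : ∃ r, Set.range (p * ·) ∩ Set.range (q * ·) = Set.range (r * ·)
  · obtain ⟨r, hr⟩ := hr
    obtain ⟨p', q', h, h'⟩ := exists_mul_eq hr
    have h1 := hψ.psiK_mul p q r p' q' h h' hr (D.thetaDelta p g c) (D.thetaDelta q a b)
    change _ = D.productSystem.psiK ψ r (D.productSystem.mulK hM h h' hr _ _) at h1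
    rw [h1, D.mulK_thetaDelta_eq_zero h h' hM hr, map_zero]
    rintro ⟨k, l, hkl⟩
    exact hc ⟨r, k, l, hr, hkl⟩
  · exact hψ.psiK_mul_eq_zero p q hr _ _

/-- A product `s_p* u_g s_q` expressed through the range projections of `s_p` and `u_g s_q`. -/
theorem star_rep_mul_eq (p q : P) (g : G) :
    star (ψ p (D.π p (delta 1))) * ψ q (D.π q (delta g)) =
      star (ψ p (D.π p (delta 1))) * (ψ p (D.π p (delta 1)) * star (ψ p (D.π p (delta 1))) *
        (ψ q (D.π q (delta g)) * star (ψ q (D.π q (delta g))))) * ψ q (D.π q (delta g)) := by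
  have hrep := hψ.toIsRepresentation
  have h1 := rep_mul_star_mul_self hrep p _ 1 rfl
  have h2 := rep_mul_star_mul_self hrep q _ g rfl
  have h3 := congrArg star h1
  rw [star_mul, star_mul, star_star] at h3
  calc _ = star (ψ p (D.π p (delta 1))) *
        (ψ p (D.π p (delta 1)) * star (ψ p (D.π p (delta 1)))) *
        (ψ q (D.π q (delta g)) * star (ψ q (D.π q (delta g))) * ψ q (D.π q (delta g))) := by
        rw [h2, h3]
    _ = _ := by simp only [mul_assoc]

/-- The relation for s_p* u_g s_q is recovered by inserting the range projections s_p s_p* and (u_g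
s_q)(u_g s_q)*. Their product is evaluated by Nica covariance, and the outer factors then cancel
because the s_p are isometries. -/
theorem isCovariantPair_of_isNicaCovariant (h₁ : ∀ b, ψ 1 (D.productSystem.unit 1) * b = b)
    (h₂ : ∀ b, b * ψ 1 (D.productSystem.unit 1) = b) :
    @IsCovariantPair G P _ _ D B (cstarAlgebraOfUnit _ h₁ h₂)
      (fun g => ψ 1 (D.productSystem.unit (delta g))) (fun p => ψ p (D.π p 1)) := by
  have hrep := hψ.toIsRepresentation
  have hu : ∀ g k, ψ 1 (D.π 1 (delta (g * k))) = ψ 1 (D.π 1 (delta g)) * ψ 1 (D.π 1 (delta k)) :=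
    fun g k => by rw [rep_mul_delta hrep (mul_one 1), θ_one]
  have h1 : ψ 1 (D.π 1 (delta 1)) = ψ 1 (D.productSystem.unit 1) := by rw [delta_one]; rfl
  have hus : ∀ g p, ψ 1 (D.π 1 (delta g)) * ψ p (D.π p (delta 1)) = ψ p (D.π p (delta g)) :=
    fun g p => by rw [rep_mul_delta hrep (one_mul p), map_one, mul_one]
  have hsu : ∀ p g, ψ p (D.π p (delta 1)) * ψ 1 (D.π 1 (delta g)) = ψ p (D.π p (delta (D.θ p g))) :=
    fun p g => by rw [rep_mul_delta hrep (mul_one p), one_mul]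
  have hs : (fun p => ψ p (D.π p 1)) = fun p => ψ p (D.π p (delta 1)) := by rw [delta_one]
  rw [hs]
  -- `cstarAlgebraOfUnit` keeps the multiplication and the involution of B and takes ψ_1(1) as unit,
  -- so each relation is an identity in the non-unital algebra B.
  refine @IsCovariantPair.mk G P _ _ D B (cstarAlgebraOfUnit _ h₁ h₂) _ _ ?_ ?_ ?_ ?_ ?_ ?_ ?_ ?_ ?_
  · exact h1
  · exact hu
  · intro g
    refine ⟨?_, ?_⟩
    · refine (congrArg (· * _) (star_rep_one_delta hrep g)).trans ((hu _ _).symm.trans ?_)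
      rw [inv_mul_cancel]
      exact h1
    · refine (congrArg (_ * ·) (star_rep_one_delta hrep g)).trans ((hu _ _).symm.trans ?_)
      rw [mul_inv_cancel]
      exact h1
  · exact h1
  · intro p q
    refine ((rep_mul_delta hrep rfl 1 1).trans ?_).symm
    rw [map_one, mul_one]
  · intro p
    have := star_rep_delta_mul hrep p 1 1
    rw [map_one, mul_one] at this
    exact this.trans h1
  · exact fun p g => (hsu p g).trans (hus _ p).symm
  · intro p q r p' q' g k l hr hp hq hg
    refine Eq.trans (b := star (ψ p (D.π p (delta 1))) * ψ q (D.π q (delta g))) ?_ ?_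
    · exact (mul_assoc _ _ _).trans (congrArg (_ * ·) (hus g q))
    -- Since r = pp', the vector π_r(δ_{θ_p(k)}) is π_p(δ_{θ_p(k)})π_{p'}(1), and s_p* u_{θ_p(k)}
    -- s_p = u_k. The identity `e2` is the same for r = qq' and l.
    have e1 : star (ψ p (D.π p (delta 1))) * ψ r (D.π r (delta (1 * D.θ p k))) =
        ψ 1 (D.π 1 (delta k)) * ψ p' (D.π p' (delta 1)) := by
      have h3 := rep_mul_delta hrep hp (1 * D.θ p k) 1
      rw [map_one, mul_one] at h3
      rw [← h3, ← mul_assoc, star_rep_delta_mul hrep]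
    have e2 : star (ψ q (D.π q (delta g))) * ψ r (D.π r (delta (g * D.θ q l))) =
        ψ 1 (D.π 1 (delta l)) * ψ q' (D.π q' (delta 1)) := by
      have h3 := rep_mul_delta hrep hq (g * D.θ q l) 1
      rw [map_one, mul_one] at h3
      rw [← h3, ← mul_assoc, star_rep_delta_mul hrep]
    -- The range projections are the matrix units with both indices 1 for p and both indices g for
    -- q, so that c⁻¹a = g.
    rw [star_rep_mul_eq hψ, delta_mul_star_mul_delta hψ p q r 1 1 g g k l hr
      (by rw [inv_one, one_mul, hg]), ← mul_assoc, e1]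
    have e3 := congrArg star e2
    rw [star_mul, star_star, star_mul] at e3
    rw [mul_assoc, e3, ← mul_assoc]
    rfl
  · intro p q g hg
    refine Eq.trans (b := star (ψ p (D.π p (delta 1))) * ψ q (D.π q (delta g))) ?_ ?_
    · exact (mul_assoc _ _ _).trans (congrArg (_ * ·) (hus g q))
    rw [star_rep_mul_eq hψ, delta_mul_star_mul_delta_eq_zero hψ, mul_zero, zero_mul]
    rintro ⟨r, k, l, hr, hkl⟩
    obtain ⟨p', q', hp, hq⟩ := exists_mul_eq hr
    exact hg ⟨r, p', q', k, l, hr, hp, hq, by rw [← hkl, inv_one, one_mul]⟩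

end

/-! ### Homomorphisms out of A[G,P,θ]. -/

theorem alg_hom_ext {B : Type w} [CStarAlgebra B] {φ χ : D.Alg →⋆ₐ[ℂ] B}
    (hu : ∀ g, φ (D.u g) = χ (D.u g)) (hs : ∀ p, φ (D.s p) = χ (D.s p)) : φ = χ :=
  UnivCStar.hom_ext fun x => by
    rcases x with g | p
    · exact hu g
    · exact hs p

theorem exists_alg_hom {B : Type max u v} [CStarAlgebra B] {u : G → B} {s : P → B}
    (h : D.IsCovariantPair u s) :
    ∃ φ : D.Alg →⋆ₐ[ℂ] B, (∀ g, φ (D.u g) = u g) ∧ ∀ p, φ (D.s p) = s p :=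
  have hf : D.IsCovariantPair (Sum.elim u s ∘ Sum.inl) (Sum.elim u s ∘ Sum.inr) := h
  ⟨UnivCStar.lift D.isReflected_isCovariantPair hf,
    fun g => UnivCStar.lift_gen D.isReflected_isCovariantPair hf (Sum.inl g),
    fun p => UnivCStar.lift_gen D.isReflected_isCovariantPair hf (Sum.inr p)⟩

/-- The universal property of A[G,P,θ] needs a unital target, supplied by ψ_1(1). The unit is
forgotten afterwards, so that the map lands in B with its original structure, as needed for NT(M).
-/
theorem exists_hom_of_isNicaCovariant {B : Type max u v} [NonUnitalCStarAlgebra B]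
    {ψ : ∀ p, D.productSystem.fibre p → B} {hM : D.productSystem.IsCompactlyAligned}
    (hψ : ProductSystem.IsNicaCovariant hM ψ) (h₁ : ∀ b, ψ 1 (D.productSystem.unit 1) * b = b)
    (h₂ : ∀ b, b * ψ 1 (D.productSystem.unit 1) = b) :
    ∃ φ : D.Alg →⋆ₙₐ[ℂ] B, (∀ g, φ (D.u g) = ψ 1 (D.productSystem.unit (delta g))) ∧
      ∀ p, φ (D.s p) = ψ p (D.π p 1) := by
  obtain ⟨φ, hu, hs⟩ := @exists_alg_hom G P _ _ D B (cstarAlgebraOfUnit _ h₁ h₂) _ _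
    (isCovariantPair_of_isNicaCovariant hψ h₁ h₂)
  exact ⟨@StarAlgHom.toNonUnitalStarAlgHom ℂ D.Alg B _ _ _ _ (_) (_) (_) φ, hu, hs⟩

end AlgebraicDynamicalSystem

end ADS

end

/-! ### The isomorphism: the two canonical homomorphisms are mutually inverse. -/

theorem theorem7p7 {G : Type u} {P : Type v} [Group G] [Monoid P]
    (D : ADS.AlgebraicDynamicalSystem G P) :
    ∃ (hM : D.productSystem.IsCompactlyAligned) (φ : D.Alg ≃⋆ₐ[ℂ] D.productSystem.NT hM),
      (∀ g : G, φ (D.u g) =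
        D.productSystem.j hM 1 (D.productSystem.unit (ADS.GroupCStar.delta g))) ∧
      (∀ p : P, φ (D.s p) = D.productSystem.j hM p (D.π p 1)) := by
  have hM := D.isCompactlyAligned
  obtain ⟨φ, hu, hs⟩ := ADS.AlgebraicDynamicalSystem.exists_hom_of_isNicaCovariant
    (ADS.ProductSystem.isNicaCovariant_j hM)
    (fun b => (ADS.ProductSystem.j_one_mul hM b).1) (fun b => (ADS.ProductSystem.j_one_mul hM b).2)
  have hus := D.isCovariantPair
  obtain ⟨χ, hχ⟩ := ADS.ProductSystem.exists_nt_hom hM (hus.isNicaCovariant_rep hM)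
  have hχu : ∀ g, χ (φ (D.u g)) = D.u g := fun g => by
    rw [hu, hχ, hus.rep_unit, hus.intU_delta]
  have hχs : ∀ p, χ (φ (D.s p)) = D.s p := fun p => by
    rw [hs, hχ, hus.rep_π, map_one, one_mul]
  have h1 : χ.comp φ = NonUnitalStarAlgHom.id ℂ D.Alg := by
    -- Uniqueness on A[G,P,θ] concerns unital homomorphisms. The composite is unital because it
    -- fixes u_1 = 1.
    let χφ : D.Alg →⋆ₐ[ℂ] D.Alg :=
      { (χ.comp φ) with
        map_one' := by
          have := hχu 1
          rwa [hus.u_one] at this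
        commutes' := fun c => by
          have := hχu 1
          rw [hus.u_one] at this
          change χ (φ (algebraMap ℂ D.Alg c)) = _
          rw [Algebra.algebraMap_eq_smul_one, map_smul, map_smul, this] }
    have h2 : χφ = StarAlgHom.id ℂ D.Alg := ADS.AlgebraicDynamicalSystem.alg_hom_ext hχu hχs
    ext b
    exact DFunLike.congr_fun h2 b
  have h2 : φ.comp χ = NonUnitalStarAlgHom.id ℂ (D.productSystem.NT hM) := by
    refine ADS.ProductSystem.nt_hom_ext fun p x => ?_
    change φ (χ (D.productSystem.j hM p x)) = D.productSystem.j hM p x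
    have hj := (ADS.ProductSystem.isNicaCovariant_j hM).toIsRepresentation
    rw [hχ]
    have hφ := ADS.continuous_of_starHom φ
    refine D.fibre_induction (q := fun x => φ (hus.rep p x) = D.productSystem.j hM p x) x
      ?_ ?_ ?_ ?_
    · intro g
      -- The image of u_g s_p is j_1(δ_g) j_p(π_p(1)) = j_p(δ_g · π_p(1)), and δ_g · π_p(1) =
      -- π_p(δ_g).
      rw [hus.rep_π_delta, map_mul, hu, hs, hj.map_mul (one_mul p), D.productSystem.unit_mul]
      refine congrArg (D.productSystem.j hM p) ((D.exelLarsen.leftL_π p _ _).trans ?_)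
      rw [mul_one]
      rfl
    · intro x y hx hy
      rw [map_add, map_add, hx, hy, hj.map_add]
    · intro c x hx
      rw [map_smul, map_smul, hx, hj.map_smul]
    · exact isClosed_eq (hφ.comp (hus.rep p).continuous)
        (AddMonoidHomClass.continuous_of_bound
          (AddMonoidHom.mk' (D.productSystem.j hM p) (hj.map_add p)) 1 fun x => by
            rw [one_mul]; exact hj.norm_le p x)
  refine ⟨hM, StarAlgEquiv.ofBijective φ ⟨?_, ?_⟩, hu, hs⟩
  · exact Function.LeftInverse.injective (g := χ) fun b => DFunLike.congr_fun h1 b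
  · exact Function.RightInverse.surjective (g := χ) fun b => DFunLike.congr_fun h2 b
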